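/- **Corollary (Admissibility of the transitivity rule of Relational Higher-Order Logic).** *Setting.* Types are $\tau ::= \mathbb B \mid \mathbb N \mid \mathsf{list}_\tau \mid \tau\times\tau \mid \tau\to\tau$. Terms are those of a simply typed $\lambda$-calculus (PCF) with pairs, projections, booleans, natural numbers, lists, the corresponding case constructs, and recursive definitions $\mathsf{letrec}\ f\ x = e$ of type $I\to\sigma$ with $I\in\{\mathbb N,\mathsf{list}_\tau\}$. A recursive definition is typable only if it passes a test $\mathrm{Def}(f,x,e)$, meant to ensure that recursive calls are made on smaller arguments. The test is a parameter; it may depend on the typing context and on the type of the definition, and it is only required to be stable under well-typed substitution for the free variables of the definition. The basic predicates, with the types of their arguments and a set of closed axioms, are a parameter too. Assertions are built from the basic predicates, typed equality, and the comparisons $|t|\le|u|$, $|t|<|u|$ of sizes of natural numbers or of lists, with the connectives $\top,\bot,\wedge,\vee,\Rightarrow$ and quantification over all types. $\Gamma\mid\Psi\vdash\phi$ denotes derivability in higher-order logic (HOL): natural deduction with $\beta\iota\mu$-conversion and substitution of equals, the axioms of the basic predicates and of the size order, disjointness and injectivity of constructors, and induction and strong induction. $\Gamma\mid\Psi\vdash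 t:\sigma\mid\phi$, with $\phi$ an assertion in $\Gamma,\mathbf r:\sigma$, denotes derivability in Unary Higher-Order Logic (UHOL). $\Gamma\mid\Psi\vdash t_1:\sigma_1\sim t_2:\sigma_2\mid\phi$ denotes derivability in Relational Higher-Order Logic (RHOL): by its two-sided rules, its one-sided left and right rules, its structural rules and its recursion rules, some of which have HOL or UHOL judgments as premises. Such a judgment is required to be well formed: $\Gamma\vdash t_1:\sigma_1$, $\Gamma\vdash t_2:\sigma_2$, $\Psi$ is a set of well-typed assertions in $\Gamma$, and $\phi$ is a well-typed assertion in $\Gamma,\mathbf r_1:\sigma_1,\mathbf r_2:\sigma_2$, where $\mathbf r_1,\mathbf r_2$ are distinguished variables not in $\Gamma$ that stand for $t_1$ and $t_2$. *Statement.* Let $\Gamma$ be a context, $\Psi$ a set of assertions, $t_1,t_2,t_3$ terms, $\sigma_1,\sigma_2,\sigma_3$ types and $\phi,\phi'$ assertions. If $$\Gamma\mid\Psi\vdash t_1:\sigma_1\sim t_2:\sigma_2\mid\phi\qquad\text{and}\qquad \Gamma\mid\Psi\vdash t_2:\sigma_2\sim t_3:\sigma_3\mid\phi'$$ are derivable in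 RHOL, then $$\Gamma\mid\Psi\vdash t_1:\sigma_1\sim t_3:\sigma_3\mid \phi[t_2/\mathbf r_2]\wedge\phi'[t_2/\mathbf r_1]$$ is derivable in RHOL. -/

import Mathlib

namespace RelLogic

universe u

/-! Types, terms, substitution. Variables are de Bruijn indices, so that terms are identified up to
renaming of bound variables and substitution is capture-free. -/

inductive Ty : Type
  | bool : Ty
  | nat : Ty
  | list : Ty → Ty
  | prod : Ty → Ty → Ty
  | arrow : Ty → Ty → Ty

/-- The types over which recursion is allowed. -/
inductive Ty.IsInd : Ty → Prop
  | nat : Ty.IsInd Ty.nat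
  | list (τ : Ty) : Ty.IsInd (Ty.list τ)

/-- A context; index `0` is the variable declared last, i.e. `Γ, x : τ` is `τ :: Γ`. -/
abbrev Ctx : Type := List Ty

/-- Raw terms. `lam τ t` binds index `0` in `t`; `letrec e` is `letrec f x = e`, where index `0` of
`e` is the recursive function `f` and index `1` is its argument `x`. -/
inductive Tm : Type
  | var : ℕ → Tm
  | pair : Tm → Tm → Tm
  | fst : Tm → Tm
  | snd : Tm → Tm
  | app : Tm → Tm → Tm
  | lam : Ty → Tm → Tm
  | tt : Tm
  | ff : Tm
  | zero : Tm
  | nil : Tm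
  | succ : Tm → Tm
  | cons : Tm → Tm → Tm
  | casenat : Tm → Tm → Tm → Tm
  | casebool : Tm → Tm → Tm → Tm
  | caselist : Tm → Tm → Tm → Tm
  | letrec : Tm → Tm

/-- `t .: σ` maps index `0` to `t` and index `i + 1` to `σ i`. -/
def scons (t : Tm) (σ : ℕ → Tm) : ℕ → Tm
  | 0 => t
  | i + 1 => σ i

infixr:67 " .: " => scons

/-- The substitution that shifts every variable by `k`. -/
def sh (k : ℕ) : ℕ → Tm := fun i => Tm.var (i + k)

def upRen (ρ : ℕ → ℕ) : ℕ → ℕ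
  | 0 => 0
  | i + 1 => ρ i + 1

def Tm.rename (ρ : ℕ → ℕ) : Tm → Tm
  | .var i => .var (ρ i)
  | .pair t u => .pair (t.rename ρ) (u.rename ρ)
  | .fst t => .fst (t.rename ρ)
  | .snd t => .snd (t.rename ρ)
  | .app t u => .app (t.rename ρ) (u.rename ρ)
  | .lam τ t => .lam τ (t.rename (upRen ρ))
  | .tt => .tt
  | .ff => .ff
  | .zero => .zero
  | .nil => .nil
  | .succ t => .succ (t.rename ρ)
  | .cons t u => .cons (t.rename ρ) (u.rename ρ)
  | .casenat t u v => .casenat (t.rename ρ) (u.rename ρ) (v.rename ρ)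
  | .casebool t u v => .casebool (t.rename ρ) (u.rename ρ) (v.rename ρ)
  | .caselist t u v => .caselist (t.rename ρ) (u.rename ρ) (v.rename ρ)
  | .letrec e => .letrec (e.rename (upRen (upRen ρ)))

/-- A substitution under one binder. -/
def up (σ : ℕ → Tm) : ℕ → Tm := Tm.var 0 .: fun i => (σ i).rename Nat.succ

/-- Simultaneous capture-free substitution. -/
def Tm.subst (σ : ℕ → Tm) : Tm → Tm
  | .var i => σ i
  | .pair t u => .pair (t.subst σ) (u.subst σ)
  | .fst t => .fst (t.subst σ)
  | .snd t => .snd (t.subst σ)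
  | .app t u => .app (t.subst σ) (u.subst σ)
  | .lam τ t => .lam τ (t.subst (up σ))
  | .tt => .tt
  | .ff => .ff
  | .zero => .zero
  | .nil => .nil
  | .succ t => .succ (t.subst σ)
  | .cons t u => .cons (t.subst σ) (u.subst σ)
  | .casenat t u v => .casenat (t.subst σ) (u.subst σ) (v.subst σ)
  | .casebool t u v => .casebool (t.subst σ) (u.subst σ) (v.subst σ)
  | .caselist t u v => .caselist (t.subst σ) (u.subst σ) (v.subst σ)
  | .letrec e => .letrec (e.subst (up (up σ)))

/-- `t` seen in a context extended by `k` fresh variables. -/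
def Tm.wk (k : ℕ) (t : Tm) : Tm := t.subst (sh k)

/-- `t[u/x]`, where `x` is index `0` of `t`. -/
def Tm.inst (t u : Tm) : Tm := t.subst (u .: Tm.var)

/-! Reduction and conversion. -/

/-- Terms with a constructor in head position. -/
inductive Tm.IsConstr : Tm → Prop
  | tt : Tm.IsConstr .tt
  | ff : Tm.IsConstr .ff
  | zero : Tm.IsConstr .zero
  | nil : Tm.IsConstr .nil
  | succ (t : Tm) : Tm.IsConstr (.succ t)
  | cons (t u : Tm) : Tm.IsConstr (.cons t u)

/-- One step of beta-, iota- or mu-reduction, anywhere in a term. -/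
inductive Red : Tm → Tm → Prop
  | beta (τ : Ty) (t u : Tm) : Red (.app (.lam τ t) u) (t.inst u)
  | fst_pair (t u : Tm) : Red (.fst (.pair t u)) t
  | snd_pair (t u : Tm) : Red (.snd (.pair t u)) u
  | casenat_zero (u v : Tm) : Red (.casenat .zero u v) u
  | casenat_succ (t u v : Tm) : Red (.casenat (.succ t) u v) (.app v t)
  | casebool_tt (u v : Tm) : Red (.casebool .tt u v) u
  | casebool_ff (u v : Tm) : Red (.casebool .ff u v) v
  | caselist_nil (u v : Tm) : Red (.caselist .nil u v) u
  | caselist_cons (h t u v : Tm) : Red (.caselist (.cons h t) u v) (.app (.app v h) t)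
  | mu (e c : Tm) : c.IsConstr → Red (.app (.letrec e) c) (e.subst (.letrec e .: c .: Tm.var))
  | pair_left {t t' : Tm} (u : Tm) : Red t t' → Red (.pair t u) (.pair t' u)
  | pair_right (t : Tm) {u u' : Tm} : Red u u' → Red (.pair t u) (.pair t u')
  | fst {t t' : Tm} : Red t t' → Red (.fst t) (.fst t')
  | snd {t t' : Tm} : Red t t' → Red (.snd t) (.snd t')
  | app_left {t t' : Tm} (u : Tm) : Red t t' → Red (.app t u) (.app t' u)
  | app_right (t : Tm) {u u' : Tm} : Red u u' → Red (.app t u) (.app t u')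
  | lam (τ : Ty) {t t' : Tm} : Red t t' → Red (.lam τ t) (.lam τ t')
  | succ {t t' : Tm} : Red t t' → Red (.succ t) (.succ t')
  | cons_left {t t' : Tm} (u : Tm) : Red t t' → Red (.cons t u) (.cons t' u)
  | cons_right (t : Tm) {u u' : Tm} : Red u u' → Red (.cons t u) (.cons t u')
  | casenat₁ {t t' : Tm} (u v : Tm) : Red t t' → Red (.casenat t u v) (.casenat t' u v)
  | casenat₂ (t : Tm) {u u' : Tm} (v : Tm) : Red u u' → Red (.casenat t u v) (.casenat t u' v)
  | casenat₃ (t u : Tm) {v v' : Tm} : Red v v' → Red (.casenat t u v) (.casenat t u v')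
  | casebool₁ {t t' : Tm} (u v : Tm) : Red t t' → Red (.casebool t u v) (.casebool t' u v)
  | casebool₂ (t : Tm) {u u' : Tm} (v : Tm) : Red u u' → Red (.casebool t u v) (.casebool t u' v)
  | casebool₃ (t u : Tm) {v v' : Tm} : Red v v' → Red (.casebool t u v) (.casebool t u v')
  | caselist₁ {t t' : Tm} (u v : Tm) : Red t t' → Red (.caselist t u v) (.caselist t' u v)
  | caselist₂ (t : Tm) {u u' : Tm} (v : Tm) : Red u u' → Red (.caselist t u v) (.caselist t u' v)
  | caselist₃ (t u : Tm) {v v' : Tm} : Red v v' → Red (.caselist t u v) (.caselist t u v')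
  | letrec {e e' : Tm} : Red e e' → Red (.letrec e) (.letrec e')

/-- Convertibility: the reflexive-symmetric-transitive closure of reduction. -/
def Conv : Tm → Tm → Prop := Relation.EqvGen Red

/-! Typing. -/

/-- The test imposed on recursive definitions: `D Γ I σ e` is the predicate `Def(f, x, e)` for a
definition `letrec f x = e` of type `I → σ` in the context `Γ`. How the test is done is left open;
it may but need not look at `Γ`, `I` and `σ`. -/
abbrev Guard : Type := Ctx → Ty → Ty → Tm → Prop

/-- `HasType D Γ t τ` is the typing judgment `Γ ⊢ t : τ`. -/
inductive HasType (D : Guard) : Ctx → Tm → Ty → Prop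
  | var {Γ : Ctx} {i : ℕ} {τ : Ty} : Γ[i]? = some τ → HasType D Γ (.var i) τ
  | pair {Γ : Ctx} {t u : Tm} {σ τ : Ty} : HasType D Γ t σ → HasType D Γ u τ →
      HasType D Γ (.pair t u) (.prod σ τ)
  | fst {Γ : Ctx} {t : Tm} {σ τ : Ty} : HasType D Γ t (.prod σ τ) → HasType D Γ (.fst t) σ
  | snd {Γ : Ctx} {t : Tm} {σ τ : Ty} : HasType D Γ t (.prod σ τ) → HasType D Γ (.snd t) τ
  | app {Γ : Ctx} {t u : Tm} {τ σ : Ty} : HasType D Γ t (.arrow τ σ) → HasType D Γ u τ →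
      HasType D Γ (.app t u) σ
  | lam {Γ : Ctx} {t : Tm} {τ σ : Ty} : HasType D (τ :: Γ) t σ →
      HasType D Γ (.lam τ t) (.arrow τ σ)
  | tt {Γ : Ctx} : HasType D Γ .tt .bool
  | ff {Γ : Ctx} : HasType D Γ .ff .bool
  | zero {Γ : Ctx} : HasType D Γ .zero .nat
  | nil {Γ : Ctx} {τ : Ty} : HasType D Γ .nil (.list τ)
  | succ {Γ : Ctx} {t : Tm} : HasType D Γ t .nat → HasType D Γ (.succ t) .nat
  | cons {Γ : Ctx} {t u : Tm} {τ : Ty} : HasType D Γ t τ → HasType D Γ u (.list τ) →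
      HasType D Γ (.cons t u) (.list τ)
  | casenat {Γ : Ctx} {t u v : Tm} {σ : Ty} : HasType D Γ t .nat → HasType D Γ u σ →
      HasType D Γ v (.arrow .nat σ) → HasType D Γ (.casenat t u v) σ
  | casebool {Γ : Ctx} {t u v : Tm} {σ : Ty} : HasType D Γ t .bool → HasType D Γ u σ →
      HasType D Γ v σ → HasType D Γ (.casebool t u v) σ
  | caselist {Γ : Ctx} {t u v : Tm} {τ σ : Ty} : HasType D Γ t (.list τ) → HasType D Γ u σ →
      HasType D Γ v (.arrow τ (.arrow (.list τ) σ)) → HasType D Γ (.caselist t u v) σ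
  | letrec {Γ : Ctx} {e : Tm} {I σ : Ty} : I.IsInd → HasType D (.arrow I σ :: I :: Γ) e σ →
      D Γ I σ e → HasType D Γ (.letrec e) (.arrow I σ)

/-- `θ` replaces the variables of `Γ` by terms of the same types in context `Δ`. -/
def SubstTyped (D : Guard) (Δ : Ctx) (θ : ℕ → Tm) (Γ : Ctx) : Prop :=
  ∀ (i : ℕ) (τ : Ty), Γ[i]? = some τ → HasType D Δ (θ i) τ

/-- The test on recursive definitions is stable under well-typed substitution for the free
variables of the definition. -/
def Guard.Stable (D : Guard) : Prop :=
  ∀ (Γ Δ : Ctx) (θ : ℕ → Tm) (I σ : Ty) (e : Tm), I.IsInd → SubstTyped D Δ θ Γ →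
    HasType D (.arrow I σ :: I :: Γ) e σ → D Γ I σ e → D Δ I σ (e.subst (up (up θ)))

/-! Assertions. -/

/-- Assertions over a type `P` of basic predicates. Equality at type `τ` and the comparisons
`|t| ≤ |u|`, `|t| < |u|` of the sizes of two elements of an inductive type are basic predicates
of every instance of the logic. -/
inductive Form (P : Type u) : Type u
  | pred : P → List Tm → Form P
  | eq : Ty → Tm → Tm → Form P
  | le : Ty → Tm → Tm → Form P
  | lt : Ty → Tm → Tm → Form P
  | top : Form P
  | bot : Form P
  | and : Form P → Form P → Form P
  | or : Form P → Form P → Form P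
  | imp : Form P → Form P → Form P
  | all : Ty → Form P → Form P
  | ex : Ty → Form P → Form P

/-- The basic predicates with the types of their arguments and their axioms. -/
structure Sig (P : Type u) where
  arity : P → List Ty
  axioms : Set (Form P)

def Form.subst {P : Type u} (σ : ℕ → Tm) : Form P → Form P
  | .pred p ts => .pred p (ts.map (Tm.subst σ))
  | .eq τ t u => .eq τ (t.subst σ) (u.subst σ)
  | .le τ t u => .le τ (t.subst σ) (u.subst σ)
  | .lt τ t u => .lt τ (t.subst σ) (u.subst σ)
  | .top => .top
  | .bot => .bot
  | .and φ ψ => .and (φ.subst σ) (ψ.subst σ)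
  | .or φ ψ => .or (φ.subst σ) (ψ.subst σ)
  | .imp φ ψ => .imp (φ.subst σ) (ψ.subst σ)
  | .all τ φ => .all τ (φ.subst (up σ))
  | .ex τ φ => .ex τ (φ.subst (up σ))

def Form.wk {P : Type u} (k : ℕ) (φ : Form P) : Form P := φ.subst (sh k)

/-- `φ[u/x]`, where `x` is index `0` of `φ`. -/
def Form.inst {P : Type u} (φ : Form P) (u : Tm) : Form P := φ.subst (u .: Tm.var)

/-- `φ[t₁/r₁][t₂/r₂]`, where `r₂` is index `0` and `r₁` is index `1` of `φ`. -/
def Form.inst2 {P : Type u} (φ : Form P) (t₁ t₂ : Tm) : Form P := φ.subst (t₂ .: t₁ .: Tm.var)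

def Form.iff {P : Type u} (φ ψ : Form P) : Form P := .and (.imp φ ψ) (.imp ψ φ)

/-- `Γ ⊢ φ`: the assertion `φ` is well typed in `Γ`. -/
inductive Form.Wf {P : Type u} (D : Guard) (S : Sig P) : Ctx → Form P → Prop
  | pred {Γ : Ctx} {p : P} {ts : List Tm} : List.Forall₂ (HasType D Γ) ts (S.arity p) →
      Form.Wf D S Γ (.pred p ts)
  | eq {Γ : Ctx} {τ : Ty} {t u : Tm} : HasType D Γ t τ → HasType D Γ u τ →
      Form.Wf D S Γ (.eq τ t u)
  | le {Γ : Ctx} {I : Ty} {t u : Tm} : I.IsInd → HasType D Γ t I → HasType D Γ u I →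
      Form.Wf D S Γ (.le I t u)
  | lt {Γ : Ctx} {I : Ty} {t u : Tm} : I.IsInd → HasType D Γ t I → HasType D Γ u I →
      Form.Wf D S Γ (.lt I t u)
  | top {Γ : Ctx} : Form.Wf D S Γ .top
  | bot {Γ : Ctx} : Form.Wf D S Γ .bot
  | and {Γ : Ctx} {φ ψ : Form P} : Form.Wf D S Γ φ → Form.Wf D S Γ ψ → Form.Wf D S Γ (.and φ ψ)
  | or {Γ : Ctx} {φ ψ : Form P} : Form.Wf D S Γ φ → Form.Wf D S Γ ψ → Form.Wf D S Γ (.or φ ψ)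
  | imp {Γ : Ctx} {φ ψ : Form P} : Form.Wf D S Γ φ → Form.Wf D S Γ ψ → Form.Wf D S Γ (.imp φ ψ)
  | all {Γ : Ctx} {τ : Ty} {φ : Form P} : Form.Wf D S (τ :: Γ) φ → Form.Wf D S Γ (.all τ φ)
  | ex {Γ : Ctx} {τ : Ty} {φ : Form P} : Form.Wf D S (τ :: Γ) φ → Form.Wf D S Γ (.ex τ φ)

/-- `Ψ` is a set of assertions that are well typed in `Γ`. -/
def WfHyps {P : Type u} (D : Guard) (S : Sig P) (Γ : Ctx) (Ψ : Set (Form P)) : Prop :=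
  ∀ ψ ∈ Ψ, Form.Wf D S Γ ψ

def wkHyps {P : Type u} (k : ℕ) (Ψ : Set (Form P)) : Set (Form P) := Form.wk k '' Ψ

/-! Higher-order logic. -/

/-- `HOL D S Γ Ψ φ` is derivability of the judgment `Γ | Ψ ⊢ φ`. -/
inductive HOL {P : Type u} (D : Guard) (S : Sig P) : Ctx → Set (Form P) → Form P → Prop
  | ax {Γ : Ctx} {Ψ : Set (Form P)} {φ : Form P} : WfHyps D S Γ Ψ → φ ∈ Ψ → HOL D S Γ Ψ φ
  /- the (closed) axioms of the basic predicates -/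
  | predAx {Γ : Ctx} {Ψ : Set (Form P)} {φ : Form P} : WfHyps D S Γ Ψ → φ ∈ S.axioms →
      φ.Wf D S [] → HOL D S Γ Ψ φ
  | conv {Γ : Ctx} {Ψ : Set (Form P)} {τ : Ty} {t t' : Tm} : WfHyps D S Γ Ψ →
      HasType D Γ t τ → HasType D Γ t' τ → Conv t t' → HOL D S Γ Ψ (.eq τ t t')
  | subst {Γ : Ctx} {Ψ : Set (Form P)} {τ : Ty} {t u : Tm} {φ : Form P} : φ.Wf D S (τ :: Γ) →
      HOL D S Γ Ψ (φ.inst t) → HOL D S Γ Ψ (.eq τ t u) → HOL D S Γ Ψ (φ.inst u)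
  | impI {Γ : Ctx} {Ψ : Set (Form P)} {φ ψ : Form P} : WfHyps D S Γ Ψ → ψ.Wf D S Γ →
      HOL D S Γ (insert ψ Ψ) φ → HOL D S Γ Ψ (.imp ψ φ)
  | impE {Γ : Ctx} {Ψ : Set (Form P)} {φ ψ : Form P} :
      HOL D S Γ Ψ (.imp ψ φ) → HOL D S Γ Ψ ψ → HOL D S Γ Ψ φ
  | allI {Γ : Ctx} {Ψ : Set (Form P)} {σ : Ty} {φ : Form P} : WfHyps D S Γ Ψ →
      HOL D S (σ :: Γ) (wkHyps 1 Ψ) φ → HOL D S Γ Ψ (.all σ φ)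
  | allE {Γ : Ctx} {Ψ : Set (Form P)} {σ : Ty} {φ : Form P} {t : Tm} :
      HOL D S Γ Ψ (.all σ φ) → HasType D Γ t σ → HOL D S Γ Ψ (φ.inst t)
  | exI {Γ : Ctx} {Ψ : Set (Form P)} {σ : Ty} {φ : Form P} {t : Tm} : φ.Wf D S (σ :: Γ) →
      HasType D Γ t σ → HOL D S Γ Ψ (φ.inst t) → HOL D S Γ Ψ (.ex σ φ)
  | exE {Γ : Ctx} {Ψ : Set (Form P)} {σ : Ty} {φ χ : Form P} : χ.Wf D S Γ →
      HOL D S Γ Ψ (.ex σ φ) → HOL D S (σ :: Γ) (insert φ (wkHyps 1 Ψ)) (χ.wk 1) → HOL D S Γ Ψ χ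
  | topI {Γ : Ctx} {Ψ : Set (Form P)} : WfHyps D S Γ Ψ → HOL D S Γ Ψ .top
  | botE {Γ : Ctx} {Ψ : Set (Form P)} {φ : Form P} : HOL D S Γ Ψ .bot → φ.Wf D S Γ → HOL D S Γ Ψ φ
  | andI {Γ : Ctx} {Ψ : Set (Form P)} {φ ψ : Form P} :
      HOL D S Γ Ψ φ → HOL D S Γ Ψ ψ → HOL D S Γ Ψ (.and φ ψ)
  | andE₁ {Γ : Ctx} {Ψ : Set (Form P)} {φ ψ : Form P} : HOL D S Γ Ψ (.and φ ψ) → HOL D S Γ Ψ φ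
  | andE₂ {Γ : Ctx} {Ψ : Set (Form P)} {φ ψ : Form P} : HOL D S Γ Ψ (.and φ ψ) → HOL D S Γ Ψ ψ
  | orI₁ {Γ : Ctx} {Ψ : Set (Form P)} {φ ψ : Form P} :
      HOL D S Γ Ψ φ → ψ.Wf D S Γ → HOL D S Γ Ψ (.or φ ψ)
  | orI₂ {Γ : Ctx} {Ψ : Set (Form P)} {φ ψ : Form P} :
      HOL D S Γ Ψ ψ → φ.Wf D S Γ → HOL D S Γ Ψ (.or φ ψ)
  | orE {Γ : Ctx} {Ψ : Set (Form P)} {φ ψ χ : Form P} : HOL D S Γ Ψ (.or φ ψ) →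
      HOL D S Γ (insert φ Ψ) χ → HOL D S Γ (insert ψ Ψ) χ → HOL D S Γ Ψ χ
  /- induction on booleans, natural numbers and lists; index `0` of `φ` is the induction variable -/
  | bool {Γ : Ctx} {Ψ : Set (Form P)} {φ : Form P} : φ.Wf D S (.bool :: Γ) →
      HOL D S Γ Ψ (φ.inst .tt) → HOL D S Γ Ψ (φ.inst .ff) → HOL D S Γ Ψ (.all .bool φ)
  | nat {Γ : Ctx} {Ψ : Set (Form P)} {φ : Form P} :
      HOL D S Γ Ψ (φ.inst .zero) →
      HOL D S (.nat :: Γ) (insert φ (wkHyps 1 Ψ)) (φ.subst (.succ (.var 0) .: sh 1)) →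
      HOL D S Γ Ψ (.all .nat φ)
  | list {Γ : Ctx} {Ψ : Set (Form P)} {τ : Ty} {φ : Form P} : φ.Wf D S (.list τ :: Γ) →
      HOL D S Γ Ψ (φ.inst .nil) →
      HOL D S (.list τ :: τ :: Γ) (insert (φ.subst (.var 0 .: sh 2)) (wkHyps 2 Ψ))
        (φ.subst (.cons (.var 1) (.var 0) .: sh 2)) →
      HOL D S Γ Ψ (.all (.list τ) φ)
  /- strong induction on the size -/
  | strong {Γ : Ctx} {Ψ : Set (Form P)} {I : Ty} {φ : Form P} : I.IsInd → WfHyps D S Γ Ψ →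
      HOL D S (I :: Γ)
        (insert (.all I (.imp (.lt I (.var 0) (.var 1)) (φ.subst (.var 0 .: sh 2)))) (wkHyps 1 Ψ))
        φ →
      HOL D S Γ Ψ (.all I φ)
  /- constructors do not overlap and are injective -/
  | tt_ne_ff {Γ : Ctx} {Ψ : Set (Form P)} : WfHyps D S Γ Ψ →
      HOL D S Γ Ψ (.imp (.eq .bool .tt .ff) .bot)
  | zero_ne_succ {Γ : Ctx} {Ψ : Set (Form P)} {t : Tm} : WfHyps D S Γ Ψ → HasType D Γ t .nat →
      HOL D S Γ Ψ (.imp (.eq .nat .zero (.succ t)) .bot)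
  | nil_ne_cons {Γ : Ctx} {Ψ : Set (Form P)} {τ : Ty} {h t : Tm} : WfHyps D S Γ Ψ →
      HasType D Γ (.cons h t) (.list τ) →
      HOL D S Γ Ψ (.imp (.eq (.list τ) .nil (.cons h t)) .bot)
  | succ_inj {Γ : Ctx} {Ψ : Set (Form P)} {t u : Tm} :
      HOL D S Γ Ψ (.eq .nat (.succ t) (.succ u)) → HOL D S Γ Ψ (.eq .nat t u)
  | cons_inj₁ {Γ : Ctx} {Ψ : Set (Form P)} {τ : Ty} {h t h' t' : Tm} :
      HOL D S Γ Ψ (.eq (.list τ) (.cons h t) (.cons h' t')) → HOL D S Γ Ψ (.eq τ h h')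
  | cons_inj₂ {Γ : Ctx} {Ψ : Set (Form P)} {τ : Ty} {h t h' t' : Tm} :
      HOL D S Γ Ψ (.eq (.list τ) (.cons h t) (.cons h' t')) → HOL D S Γ Ψ (.eq (.list τ) t t')
  /- the order of sizes: general laws -/
  | le_refl {Γ : Ctx} {Ψ : Set (Form P)} {I : Ty} {t : Tm} : WfHyps D S Γ Ψ → I.IsInd →
      HasType D Γ t I → HOL D S Γ Ψ (.le I t t)
  | le_trans {Γ : Ctx} {Ψ : Set (Form P)} {I : Ty} {t u v : Tm} :
      HOL D S Γ Ψ (.le I t u) → HOL D S Γ Ψ (.le I u v) → HOL D S Γ Ψ (.le I t v)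
  | lt_of_lt_of_le {Γ : Ctx} {Ψ : Set (Form P)} {I : Ty} {t u v : Tm} :
      HOL D S Γ Ψ (.lt I t u) → HOL D S Γ Ψ (.le I u v) → HOL D S Γ Ψ (.lt I t v)
  | lt_of_le_of_lt {Γ : Ctx} {Ψ : Set (Form P)} {I : Ty} {t u v : Tm} :
      HOL D S Γ Ψ (.le I t u) → HOL D S Γ Ψ (.lt I u v) → HOL D S Γ Ψ (.lt I t v)
  | le_of_lt {Γ : Ctx} {Ψ : Set (Form P)} {I : Ty} {t u : Tm} :
      HOL D S Γ Ψ (.lt I t u) → HOL D S Γ Ψ (.le I t u)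
  /- the order of sizes on natural numbers -/
  | zero_le {Γ : Ctx} {Ψ : Set (Form P)} {t : Tm} : WfHyps D S Γ Ψ → HasType D Γ t .nat →
      HOL D S Γ Ψ (.le .nat .zero t)
  | not_succ_le_zero {Γ : Ctx} {Ψ : Set (Form P)} {t : Tm} :
      HOL D S Γ Ψ (.le .nat (.succ t) .zero) → HOL D S Γ Ψ .bot
  | succ_le_succ {Γ : Ctx} {Ψ : Set (Form P)} {t u : Tm} :
      HOL D S Γ Ψ (.le .nat t u) → HOL D S Γ Ψ (.le .nat (.succ t) (.succ u))
  | le_of_succ_le_succ {Γ : Ctx} {Ψ : Set (Form P)} {t u : Tm} :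
      HOL D S Γ Ψ (.le .nat (.succ t) (.succ u)) → HOL D S Γ Ψ (.le .nat t u)
  | succ_le_of_lt {Γ : Ctx} {Ψ : Set (Form P)} {t u : Tm} :
      HOL D S Γ Ψ (.lt .nat t u) → HOL D S Γ Ψ (.le .nat (.succ t) u)
  | lt_of_succ_le {Γ : Ctx} {Ψ : Set (Form P)} {t u : Tm} :
      HOL D S Γ Ψ (.le .nat (.succ t) u) → HOL D S Γ Ψ (.lt .nat t u)
  /- the order of sizes on lists -/
  | nil_le {Γ : Ctx} {Ψ : Set (Form P)} {τ : Ty} {t : Tm} : WfHyps D S Γ Ψ →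
      HasType D Γ t (.list τ) → HOL D S Γ Ψ (.le (.list τ) .nil t)
  | not_cons_le_nil {Γ : Ctx} {Ψ : Set (Form P)} {τ : Ty} {h t : Tm} :
      HOL D S Γ Ψ (.le (.list τ) (.cons h t) .nil) → HOL D S Γ Ψ .bot
  | cons_le_cons {Γ : Ctx} {Ψ : Set (Form P)} {τ : Ty} {h h' t t' : Tm} : HasType D Γ h τ →
      HasType D Γ h' τ → HOL D S Γ Ψ (.le (.list τ) t t') →
      HOL D S Γ Ψ (.le (.list τ) (.cons h t) (.cons h' t'))
  | le_of_cons_le_cons {Γ : Ctx} {Ψ : Set (Form P)} {τ : Ty} {h h' t t' : Tm} :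
      HOL D S Γ Ψ (.le (.list τ) (.cons h t) (.cons h' t')) → HOL D S Γ Ψ (.le (.list τ) t t')
  | cons_le_of_lt {Γ : Ctx} {Ψ : Set (Form P)} {τ : Ty} {h t t' : Tm} : HasType D Γ h τ →
      HOL D S Γ Ψ (.lt (.list τ) t t') → HOL D S Γ Ψ (.le (.list τ) (.cons h t) t')
  | lt_of_cons_le {Γ : Ctx} {Ψ : Set (Form P)} {τ : Ty} {h t t' : Tm} :
      HOL D S Γ Ψ (.le (.list τ) (.cons h t) t') → HOL D S Γ Ψ (.lt (.list τ) t t')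

/-! Unary higher-order logic. -/

/-- Well-formedness of the judgment `Γ | Ψ ⊢ t : τ | φ`; index `0` of `φ` is `r`. -/
def WfU {P : Type u} (D : Guard) (S : Sig P) (Γ : Ctx) (Ψ : Set (Form P)) (t : Tm) (τ : Ty)
    (φ : Form P) : Prop :=
  HasType D Γ t τ ∧ WfHyps D S Γ Ψ ∧ φ.Wf D S (τ :: Γ)

/-- `∀ x : τ. φ' ⇒ φ[r x/r]`, in `Γ, r`. In `φ'` index `0` is `x`; in `φ` indices `0`, `1` are
`r`, `x`. -/
def unArrow {P : Type u} (τ : Ty) (φ' φ : Form P) : Form P :=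
  .all τ (.imp (φ'.subst (.var 0 .: sh 2)) (φ.subst (.app (.var 1) (.var 0) .: .var 0 .: sh 2)))

/-- `UHOL D S Γ Ψ t τ φ` is derivability of `Γ | Ψ ⊢ t : τ | φ`. -/
inductive UHOL {P : Type u} (D : Guard) (S : Sig P) :
    Ctx → Set (Form P) → Tm → Ty → Form P → Prop
  | var {Γ : Ctx} {Ψ : Set (Form P)} {i : ℕ} {σ : Ty} {φ : Form P} :
      WfU D S Γ Ψ (.var i) σ φ → HOL D S Γ Ψ (φ.inst (.var i)) → UHOL D S Γ Ψ (.var i) σ φ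
  | abs {Γ : Ctx} {Ψ : Set (Form P)} {t : Tm} {τ σ : Ty} {φ' φ : Form P} :
      WfU D S Γ Ψ (.lam τ t) (.arrow τ σ) (unArrow τ φ' φ) →
      UHOL D S (τ :: Γ) (insert φ' (wkHyps 1 Ψ)) t σ φ →
      UHOL D S Γ Ψ (.lam τ t) (.arrow τ σ) (unArrow τ φ' φ)
  /- in `φ'` index `0` is `r`; in `φ` indices `0`, `1` are `r`, `x` -/
  | app {Γ : Ctx} {Ψ : Set (Form P)} {t u : Tm} {τ σ : Ty} {φ' φ : Form P} :
      WfU D S Γ Ψ (.app t u) σ (φ.subst (.var 0 .: u.wk 1 .: sh 1)) →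
      UHOL D S Γ Ψ t (.arrow τ σ) (unArrow τ φ' φ) →
      UHOL D S Γ Ψ u τ φ' →
      UHOL D S Γ Ψ (.app t u) σ (φ.subst (.var 0 .: u.wk 1 .: sh 1))
  | tt {Γ : Ctx} {Ψ : Set (Form P)} {φ : Form P} :
      WfU D S Γ Ψ .tt .bool φ → HOL D S Γ Ψ (φ.inst .tt) → UHOL D S Γ Ψ .tt .bool φ
  | ff {Γ : Ctx} {Ψ : Set (Form P)} {φ : Form P} :
      WfU D S Γ Ψ .ff .bool φ → HOL D S Γ Ψ (φ.inst .ff) → UHOL D S Γ Ψ .ff .bool φ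
  | zero {Γ : Ctx} {Ψ : Set (Form P)} {φ : Form P} :
      WfU D S Γ Ψ .zero .nat φ → HOL D S Γ Ψ (φ.inst .zero) → UHOL D S Γ Ψ .zero .nat φ
  | succ {Γ : Ctx} {Ψ : Set (Form P)} {t : Tm} {φ' φ : Form P} :
      WfU D S Γ Ψ (.succ t) .nat φ →
      UHOL D S Γ Ψ t .nat φ' →
      HOL D S Γ Ψ (.all .nat (.imp φ' (φ.subst (.succ (.var 0) .: sh 1)))) →
      UHOL D S Γ Ψ (.succ t) .nat φ
  | nil {Γ : Ctx} {Ψ : Set (Form P)} {σ : Ty} {φ : Form P} :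
      WfU D S Γ Ψ .nil (.list σ) φ → HOL D S Γ Ψ (φ.inst .nil) → UHOL D S Γ Ψ .nil (.list σ) φ
  | cons {Γ : Ctx} {Ψ : Set (Form P)} {h t : Tm} {σ : Ty} {φ' φ'' φ : Form P} :
      WfU D S Γ Ψ (.cons h t) (.list σ) φ →
      UHOL D S Γ Ψ h σ φ' →
      UHOL D S Γ Ψ t (.list σ) φ'' →
      HOL D S Γ Ψ (.all σ (.all (.list σ)
        (.imp (φ'.subst (.var 1 .: sh 2))
          (.imp (φ''.subst (.var 0 .: sh 2)) (φ.subst (.cons (.var 1) (.var 0) .: sh 2)))))) →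
      UHOL D S Γ Ψ (.cons h t) (.list σ) φ
  | fst {Γ : Ctx} {Ψ : Set (Form P)} {t : Tm} {σ τ : Ty} {φ : Form P} :
      WfU D S Γ Ψ (.fst t) σ φ →
      UHOL D S Γ Ψ t (.prod σ τ) (φ.subst (.fst (.var 0) .: sh 1)) →
      UHOL D S Γ Ψ (.fst t) σ φ
  | snd {Γ : Ctx} {Ψ : Set (Form P)} {t : Tm} {σ τ : Ty} {φ : Form P} :
      WfU D S Γ Ψ (.snd t) τ φ →
      UHOL D S Γ Ψ t (.prod σ τ) (φ.subst (.snd (.var 0) .: sh 1)) →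
      UHOL D S Γ Ψ (.snd t) τ φ
  | pair {Γ : Ctx} {Ψ : Set (Form P)} {t u : Tm} {σ τ : Ty} {φ' φ'' φ : Form P} :
      WfU D S Γ Ψ (.pair t u) (.prod σ τ) φ →
      UHOL D S Γ Ψ t σ φ' →
      UHOL D S Γ Ψ u τ φ'' →
      HOL D S Γ Ψ (.all σ (.all τ
        (.imp (φ'.subst (.var 1 .: sh 2))
          (.imp (φ''.subst (.var 0 .: sh 2)) (φ.subst (.pair (.var 1) (.var 0) .: sh 2)))))) →
      UHOL D S Γ Ψ (.pair t u) (.prod σ τ) φ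
  | sub {Γ : Ctx} {Ψ : Set (Form P)} {t : Tm} {σ : Ty} {φ' φ : Form P} :
      WfU D S Γ Ψ t σ φ →
      UHOL D S Γ Ψ t σ φ' →
      HOL D S Γ Ψ (.imp (φ'.inst t) (φ.inst t)) →
      UHOL D S Γ Ψ t σ φ
  | boolcase {Γ : Ctx} {Ψ : Set (Form P)} {b u v : Tm} {σ : Ty} {φ : Form P} :
      WfU D S Γ Ψ (.casebool b u v) σ φ →
      HasType D Γ b .bool →
      UHOL D S Γ (insert (.eq .bool b .tt) Ψ) u σ φ →
      UHOL D S Γ (insert (.eq .bool b .ff) Ψ) v σ φ →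
      UHOL D S Γ Ψ (.casebool b u v) σ φ
  | natcase {Γ : Ctx} {Ψ : Set (Form P)} {n u v : Tm} {σ : Ty} {φ : Form P} :
      WfU D S Γ Ψ (.casenat n u v) σ φ →
      HasType D Γ n .nat →
      UHOL D S Γ (insert (.eq .nat n .zero) Ψ) u σ φ →
      UHOL D S Γ Ψ v (.arrow .nat σ)
        (.all .nat (.imp (.eq .nat (n.wk 2) (.succ (.var 0)))
          (φ.subst (.app (.var 1) (.var 0) .: sh 2)))) →
      UHOL D S Γ Ψ (.casenat n u v) σ φ
  | listcase {Γ : Ctx} {Ψ : Set (Form P)} {l u v : Tm} {τ σ : Ty} {φ : Form P} :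
      WfU D S Γ Ψ (.caselist l u v) σ φ →
      HasType D Γ l (.list τ) →
      UHOL D S Γ (insert (.eq (.list τ) l .nil) Ψ) u σ φ →
      UHOL D S Γ Ψ v (.arrow τ (.arrow (.list τ) σ))
        (.all τ (.all (.list τ) (.imp (.eq (.list τ) (l.wk 3) (.cons (.var 1) (.var 0)))
          (φ.subst (.app (.app (.var 2) (.var 1)) (.var 0) .: sh 3))))) →
      UHOL D S Γ Ψ (.caselist l u v) σ φ
  /- in `φ'` index `0` is `x`; in `φ` indices `0`, `1` are `r`, `x`; the premise is in the context
  `Γ, x, f` -/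
  | letrec {Γ : Ctx} {Ψ : Set (Form P)} {e : Tm} {I σ : Ty} {φ' φ : Form P} :
      WfU D S Γ Ψ (.letrec e) (.arrow I σ) (unArrow I φ' φ) →
      I.IsInd → D Γ I σ e →
      UHOL D S (.arrow I σ :: I :: Γ)
        (insert
          (.all I (.imp (.lt I (.var 0) (.var 2))
            (.imp (φ'.subst (.var 0 .: sh 3))
              (φ.subst (.app (.var 1) (.var 0) .: .var 0 .: sh 3)))))
          (insert (φ'.subst (sh 1)) (wkHyps 2 Ψ)))
        e σ (φ.subst (.var 0 .: .var 2 .: sh 3)) →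
      UHOL D S Γ Ψ (.letrec e) (.arrow I σ) (unArrow I φ' φ)

/-! Relational higher-order logic. -/

/-- Well-formedness of the judgment `Γ | Ψ ⊢ t₁ : σ₁ ∼ t₂ : σ₂ | φ`; indices `0`, `1` of `φ` are
`r₂`, `r₁`. -/
def WfR {P : Type u} (D : Guard) (S : Sig P) (Γ : Ctx) (Ψ : Set (Form P)) (t₁ : Tm) (σ₁ : Ty)
    (t₂ : Tm) (σ₂ : Ty) (φ : Form P) : Prop :=
  HasType D Γ t₁ σ₁ ∧ HasType D Γ t₂ σ₂ ∧ WfHyps D S Γ Ψ ∧ φ.Wf D S (σ₂ :: σ₁ :: Γ)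

/-- `∀ x₁ : τ₁, x₂ : τ₂. φ' ⇒ φ[r₁ x₁/r₁][r₂ x₂/r₂]`, in `Γ, r₁, r₂`. In `φ'` indices `0`, `1` are
`x₂`, `x₁`; in `φ` indices `0`, `1`, `2`, `3` are `r₂`, `r₁`, `x₂`, `x₁`. -/
def relArrow {P : Type u} (τ₁ τ₂ : Ty) (φ' φ : Form P) : Form P :=
  .all τ₁ (.all τ₂ (.imp (φ'.subst (.var 0 .: .var 1 .: sh 4))
    (φ.subst (.app (.var 2) (.var 0) .: .app (.var 3) (.var 1) .: .var 0 .: .var 1 .: sh 4))))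

/-- `∀ x₁ : τ₁. φ' ⇒ φ[r₁ x₁/r₁]`, in `Γ, r₁, r₂`. In `φ'` index `0` is `x₁`; in `φ` indices `0`,
`1`, `2` are `r₂`, `r₁`, `x₁`. -/
def leftArrow {P : Type u} (τ₁ : Ty) (φ' φ : Form P) : Form P :=
  .all τ₁ (.imp (φ'.subst (.var 0 .: sh 3))
    (φ.subst (.var 1 .: .app (.var 2) (.var 0) .: .var 0 .: sh 3)))

/-- `∀ x₂ : τ₂. φ' ⇒ φ[r₂ x₂/r₂]`, in `Γ, r₁, r₂`. In `φ'` index `0` is `x₂`; in `φ` indices `0`,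
`1`, `2` are `r₂`, `r₁`, `x₂`. -/
def rightArrow {P : Type u} (τ₂ : Ty) (φ' φ : Form P) : Form P :=
  .all τ₂ (.imp (φ'.subst (.var 0 .: sh 3))
    (φ.subst (.app (.var 1) (.var 0) .: .var 2 .: .var 0 .: sh 3)))

/-- `(|m₁|, |m₂|) < (|x₁|, |x₂|)`: both components at most, one of them strictly smaller. -/
def pairLt {P : Type u} (I₁ I₂ : Ty) (m₁ m₂ x₁ x₂ : Tm) : Form P :=
  .and (.and (.le I₁ m₁ x₁) (.le I₂ m₂ x₂)) (.or (.lt I₁ m₁ x₁) (.lt I₂ m₂ x₂))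

/-- `RHOL D S Γ Ψ t₁ σ₁ t₂ σ₂ φ` is derivability of `Γ | Ψ ⊢ t₁ : σ₁ ∼ t₂ : σ₂ | φ`. -/
inductive RHOL {P : Type u} (D : Guard) (S : Sig P) :
    Ctx → Set (Form P) → Tm → Ty → Tm → Ty → Form P → Prop
  /- two-sided rules -/
  | var {Γ : Ctx} {Ψ : Set (Form P)} {i₁ i₂ : ℕ} {σ₁ σ₂ : Ty} {φ : Form P} :
      WfR D S Γ Ψ (.var i₁) σ₁ (.var i₂) σ₂ φ →
      HOL D S Γ Ψ (φ.inst2 (.var i₁) (.var i₂)) →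
      RHOL D S Γ Ψ (.var i₁) σ₁ (.var i₂) σ₂ φ
  /- the premise is in the context `Γ, x₁, x₂`, into which the bodies `t₁`, `t₂` are weakened -/
  | abs {Γ : Ctx} {Ψ : Set (Form P)} {t₁ t₂ : Tm} {τ₁ σ₁ τ₂ σ₂ : Ty} {φ' φ : Form P} :
      WfR D S Γ Ψ (.lam τ₁ t₁) (.arrow τ₁ σ₁) (.lam τ₂ t₂) (.arrow τ₂ σ₂) (relArrow τ₁ τ₂ φ' φ) →
      RHOL D S (τ₂ :: τ₁ :: Γ) (insert φ' (wkHyps 2 Ψ))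
        (t₁.subst (sh 1)) σ₁ (t₂.subst (.var 0 .: sh 2)) σ₂ φ →
      RHOL D S Γ Ψ (.lam τ₁ t₁) (.arrow τ₁ σ₁) (.lam τ₂ t₂) (.arrow τ₂ σ₂) (relArrow τ₁ τ₂ φ' φ)
  /- in `φ` indices `0`, `1`, `2`, `3` are `r₂`, `r₁`, `x₂`, `x₁` -/
  | app {Γ : Ctx} {Ψ : Set (Form P)} {t₁ u₁ t₂ u₂ : Tm} {τ₁ σ₁ τ₂ σ₂ : Ty} {φ' φ : Form P} :
      WfR D S Γ Ψ (.app t₁ u₁) σ₁ (.app t₂ u₂) σ₂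
        (φ.subst (.var 0 .: .var 1 .: u₂.wk 2 .: u₁.wk 2 .: sh 2)) →
      RHOL D S Γ Ψ t₁ (.arrow τ₁ σ₁) t₂ (.arrow τ₂ σ₂) (relArrow τ₁ τ₂ φ' φ) →
      RHOL D S Γ Ψ u₁ τ₁ u₂ τ₂ φ' →
      RHOL D S Γ Ψ (.app t₁ u₁) σ₁ (.app t₂ u₂) σ₂
        (φ.subst (.var 0 .: .var 1 .: u₂.wk 2 .: u₁.wk 2 .: sh 2))
  | tt {Γ : Ctx} {Ψ : Set (Form P)} {φ : Form P} :
      WfR D S Γ Ψ .tt .bool .tt .bool φ → HOL D S Γ Ψ (φ.inst2 .tt .tt) →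
      RHOL D S Γ Ψ .tt .bool .tt .bool φ
  | ff {Γ : Ctx} {Ψ : Set (Form P)} {φ : Form P} :
      WfR D S Γ Ψ .ff .bool .ff .bool φ → HOL D S Γ Ψ (φ.inst2 .ff .ff) →
      RHOL D S Γ Ψ .ff .bool .ff .bool φ
  | zero {Γ : Ctx} {Ψ : Set (Form P)} {φ : Form P} :
      WfR D S Γ Ψ .zero .nat .zero .nat φ → HOL D S Γ Ψ (φ.inst2 .zero .zero) →
      RHOL D S Γ Ψ .zero .nat .zero .nat φ
  | succ {Γ : Ctx} {Ψ : Set (Form P)} {t₁ t₂ : Tm} {φ' φ : Form P} :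
      WfR D S Γ Ψ (.succ t₁) .nat (.succ t₂) .nat φ →
      RHOL D S Γ Ψ t₁ .nat t₂ .nat φ' →
      HOL D S Γ Ψ (.all .nat (.all .nat
        (.imp φ' (φ.subst (.succ (.var 0) .: .succ (.var 1) .: sh 2))))) →
      RHOL D S Γ Ψ (.succ t₁) .nat (.succ t₂) .nat φ
  | nil {Γ : Ctx} {Ψ : Set (Form P)} {σ₁ σ₂ : Ty} {φ : Form P} :
      WfR D S Γ Ψ .nil (.list σ₁) .nil (.list σ₂) φ → HOL D S Γ Ψ (φ.inst2 .nil .nil) →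
      RHOL D S Γ Ψ .nil (.list σ₁) .nil (.list σ₂) φ
  /- the last premise is `∀ x₁ x₂ y₁ y₂. φ'[x₁, x₂] ⇒ φ''[y₁, y₂] ⇒ φ[x₁ :: y₁, x₂ :: y₂]` -/
  | cons {Γ : Ctx} {Ψ : Set (Form P)} {h₁ t₁ h₂ t₂ : Tm} {σ₁ σ₂ : Ty} {φ' φ'' φ : Form P} :
      WfR D S Γ Ψ (.cons h₁ t₁) (.list σ₁) (.cons h₂ t₂) (.list σ₂) φ →
      RHOL D S Γ Ψ h₁ σ₁ h₂ σ₂ φ' →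
      RHOL D S Γ Ψ t₁ (.list σ₁) t₂ (.list σ₂) φ'' →
      HOL D S Γ Ψ (.all σ₁ (.all σ₂ (.all (.list σ₁) (.all (.list σ₂)
        (.imp (φ'.subst (.var 2 .: .var 3 .: sh 4))
          (.imp (φ''.subst (.var 0 .: .var 1 .: sh 4))
            (φ.subst (.cons (.var 2) (.var 0) .: .cons (.var 3) (.var 1) .: sh 4)))))))) →
      RHOL D S Γ Ψ (.cons h₁ t₁) (.list σ₁) (.cons h₂ t₂) (.list σ₂) φ
  | pair {Γ : Ctx} {Ψ : Set (Form P)} {t₁ u₁ t₂ u₂ : Tm} {σ₁ τ₁ σ₂ τ₂ : Ty} {φ' φ'' φ : Form P} :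
      WfR D S Γ Ψ (.pair t₁ u₁) (.prod σ₁ τ₁) (.pair t₂ u₂) (.prod σ₂ τ₂) φ →
      RHOL D S Γ Ψ t₁ σ₁ t₂ σ₂ φ' →
      RHOL D S Γ Ψ u₁ τ₁ u₂ τ₂ φ'' →
      HOL D S Γ Ψ (.all σ₁ (.all σ₂ (.all τ₁ (.all τ₂
        (.imp (φ'.subst (.var 2 .: .var 3 .: sh 4))
          (.imp (φ''.subst (.var 0 .: .var 1 .: sh 4))
            (φ.subst (.pair (.var 2) (.var 0) .: .pair (.var 3) (.var 1) .: sh 4)))))))) →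
      RHOL D S Γ Ψ (.pair t₁ u₁) (.prod σ₁ τ₁) (.pair t₂ u₂) (.prod σ₂ τ₂) φ
  | fst {Γ : Ctx} {Ψ : Set (Form P)} {t₁ t₂ : Tm} {σ₁ τ₁ σ₂ τ₂ : Ty} {φ : Form P} :
      WfR D S Γ Ψ (.fst t₁) σ₁ (.fst t₂) σ₂ φ →
      RHOL D S Γ Ψ t₁ (.prod σ₁ τ₁) t₂ (.prod σ₂ τ₂)
        (φ.subst (.fst (.var 0) .: .fst (.var 1) .: sh 2)) →
      RHOL D S Γ Ψ (.fst t₁) σ₁ (.fst t₂) σ₂ φ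
  | snd {Γ : Ctx} {Ψ : Set (Form P)} {t₁ t₂ : Tm} {σ₁ τ₁ σ₂ τ₂ : Ty} {φ : Form P} :
      WfR D S Γ Ψ (.snd t₁) τ₁ (.snd t₂) τ₂ φ →
      RHOL D S Γ Ψ t₁ (.prod σ₁ τ₁) t₂ (.prod σ₂ τ₂)
        (φ.subst (.snd (.var 0) .: .snd (.var 1) .: sh 2)) →
      RHOL D S Γ Ψ (.snd t₁) τ₁ (.snd t₂) τ₂ φ
  | boolcase {Γ : Ctx} {Ψ : Set (Form P)} {b₁ u₁ v₁ b₂ u₂ v₂ : Tm} {σ₁ σ₂ : Ty} {φ : Form P} :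
      WfR D S Γ Ψ (.casebool b₁ u₁ v₁) σ₁ (.casebool b₂ u₂ v₂) σ₂ φ →
      RHOL D S Γ Ψ b₁ .bool b₂ .bool
        (.or (.and (.eq .bool (.var 1) .tt) (.eq .bool (.var 0) .tt))
          (.and (.eq .bool (.var 1) .ff) (.eq .bool (.var 0) .ff))) →
      RHOL D S Γ (insert (.eq .bool b₂ .tt) (insert (.eq .bool b₁ .tt) Ψ)) u₁ σ₁ u₂ σ₂ φ →
      RHOL D S Γ (insert (.eq .bool b₂ .ff) (insert (.eq .bool b₁ .ff) Ψ)) v₁ σ₁ v₂ σ₂ φ →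
      RHOL D S Γ Ψ (.casebool b₁ u₁ v₁) σ₁ (.casebool b₂ u₂ v₂) σ₂ φ
  | natcase {Γ : Ctx} {Ψ : Set (Form P)} {n₁ u₁ v₁ n₂ u₂ v₂ : Tm} {σ₁ σ₂ : Ty} {φ : Form P} :
      WfR D S Γ Ψ (.casenat n₁ u₁ v₁) σ₁ (.casenat n₂ u₂ v₂) σ₂ φ →
      RHOL D S Γ Ψ n₁ .nat n₂ .nat
        (.iff (.eq .nat (.var 1) .zero) (.eq .nat (.var 0) .zero)) →
      RHOL D S Γ (insert (.eq .nat n₂ .zero) (insert (.eq .nat n₁ .zero) Ψ)) u₁ σ₁ u₂ σ₂ φ →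
      RHOL D S Γ Ψ v₁ (.arrow .nat σ₁) v₂ (.arrow .nat σ₂)
        (.all .nat (.all .nat
          (.imp (.eq .nat (n₁.wk 4) (.succ (.var 1)))
            (.imp (.eq .nat (n₂.wk 4) (.succ (.var 0)))
              (φ.subst (.app (.var 2) (.var 0) .: .app (.var 3) (.var 1) .: sh 4)))))) →
      RHOL D S Γ Ψ (.casenat n₁ u₁ v₁) σ₁ (.casenat n₂ u₂ v₂) σ₂ φ
  /- the last premise is about
  `∀ h₁ h₂ t₁ t₂. l₁ = h₁ :: t₁ ⇒ l₂ = h₂ :: t₂ ⇒ φ[r₁ h₁ t₁/r₁][r₂ h₂ t₂/r₂]` -/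
  | listcase {Γ : Ctx} {Ψ : Set (Form P)} {l₁ u₁ v₁ l₂ u₂ v₂ : Tm} {τ₁ τ₂ σ₁ σ₂ : Ty}
      {φ : Form P} :
      WfR D S Γ Ψ (.caselist l₁ u₁ v₁) σ₁ (.caselist l₂ u₂ v₂) σ₂ φ →
      RHOL D S Γ Ψ l₁ (.list τ₁) l₂ (.list τ₂)
        (.iff (.eq (.list τ₁) (.var 1) .nil) (.eq (.list τ₂) (.var 0) .nil)) →
      RHOL D S Γ (insert (.eq (.list τ₂) l₂ .nil) (insert (.eq (.list τ₁) l₁ .nil) Ψ))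
        u₁ σ₁ u₂ σ₂ φ →
      RHOL D S Γ Ψ v₁ (.arrow τ₁ (.arrow (.list τ₁) σ₁)) v₂ (.arrow τ₂ (.arrow (.list τ₂) σ₂))
        (.all τ₁ (.all τ₂ (.all (.list τ₁) (.all (.list τ₂)
          (.imp (.eq (.list τ₁) (l₁.wk 6) (.cons (.var 3) (.var 1)))
            (.imp (.eq (.list τ₂) (l₂.wk 6) (.cons (.var 2) (.var 0)))
              (φ.subst (.app (.app (.var 4) (.var 2)) (.var 0) .:
                .app (.app (.var 5) (.var 3)) (.var 1) .: sh 6)))))))) →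
      RHOL D S Γ Ψ (.caselist l₁ u₁ v₁) σ₁ (.caselist l₂ u₂ v₂) σ₂ φ
  /- the premise is in the context `Γ, x₁, x₂, f₁, f₂`; in `φ'` indices `0`, `1` are `x₂`, `x₁`; in
  `φ` indices `0`, `1`, `2`, `3` are `r₂`, `r₁`, `x₂`, `x₁` -/
  | letrec {Γ : Ctx} {Ψ : Set (Form P)} {e₁ e₂ : Tm} {I₁ σ₁ I₂ σ₂ : Ty} {φ' φ : Form P} :
      WfR D S Γ Ψ (.letrec e₁) (.arrow I₁ σ₁) (.letrec e₂) (.arrow I₂ σ₂) (relArrow I₁ I₂ φ' φ) →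
      I₁.IsInd → I₂.IsInd → D Γ I₁ σ₁ e₁ → D Γ I₂ σ₂ e₂ →
      RHOL D S (.arrow I₂ σ₂ :: .arrow I₁ σ₁ :: I₂ :: I₁ :: Γ)
        (insert
          (.all I₁ (.all I₂ (.imp (pairLt I₁ I₂ (.var 1) (.var 0) (.var 5) (.var 4))
            (.imp (φ'.subst (.var 0 .: .var 1 .: sh 6))
              (φ.subst (.app (.var 2) (.var 0) .: .app (.var 3) (.var 1) .:
                .var 0 .: .var 1 .: sh 6))))))
          (insert (φ'.subst (sh 2)) (wkHyps 4 Ψ)))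
        (e₁.subst (.var 1 .: .var 3 .: sh 4)) σ₁ (e₂.subst (.var 0 .: .var 2 .: sh 4)) σ₂
        (φ.subst (.var 0 .: .var 1 .: .var 4 .: .var 5 .: sh 6)) →
      RHOL D S Γ Ψ (.letrec e₁) (.arrow I₁ σ₁) (.letrec e₂) (.arrow I₂ σ₂) (relArrow I₁ I₂ φ' φ)
  /- structural rules -/
  | sub {Γ : Ctx} {Ψ : Set (Form P)} {t₁ t₂ : Tm} {σ₁ σ₂ : Ty} {φ' φ : Form P} :
      WfR D S Γ Ψ t₁ σ₁ t₂ σ₂ φ →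
      RHOL D S Γ Ψ t₁ σ₁ t₂ σ₂ φ' →
      HOL D S Γ Ψ (.imp (φ'.inst2 t₁ t₂) (φ.inst2 t₁ t₂)) →
      RHOL D S Γ Ψ t₁ σ₁ t₂ σ₂ φ
  | andI {Γ : Ctx} {Ψ : Set (Form P)} {t₁ t₂ : Tm} {σ₁ σ₂ : Ty} {φ φ' : Form P} :
      WfR D S Γ Ψ t₁ σ₁ t₂ σ₂ (.and φ φ') →
      RHOL D S Γ Ψ t₁ σ₁ t₂ σ₂ φ →
      RHOL D S Γ Ψ t₁ σ₁ t₂ σ₂ φ' →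
      RHOL D S Γ Ψ t₁ σ₁ t₂ σ₂ (.and φ φ')
  | impI {Γ : Ctx} {Ψ : Set (Form P)} {t₁ t₂ : Tm} {σ₁ σ₂ : Ty} {φ' φ : Form P} :
      WfR D S Γ Ψ t₁ σ₁ t₂ σ₂ (.imp φ' φ) →
      RHOL D S Γ (insert (φ'.inst2 t₁ t₂) Ψ) t₁ σ₁ t₂ σ₂ φ →
      RHOL D S Γ Ψ t₁ σ₁ t₂ σ₂ (.imp φ' φ)
  | uholL {Γ : Ctx} {Ψ : Set (Form P)} {t₁ t₂ : Tm} {σ₁ σ₂ : Ty} {φ : Form P} :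
      WfR D S Γ Ψ t₁ σ₁ t₂ σ₂ φ →
      UHOL D S Γ Ψ t₁ σ₁ (φ.subst (t₂.wk 1 .: .var 0 .: sh 1)) →
      RHOL D S Γ Ψ t₁ σ₁ t₂ σ₂ φ
  | uholR {Γ : Ctx} {Ψ : Set (Form P)} {t₁ t₂ : Tm} {σ₁ σ₂ : Ty} {φ : Form P} :
      WfR D S Γ Ψ t₁ σ₁ t₂ σ₂ φ →
      UHOL D S Γ Ψ t₂ σ₂ (φ.subst (.var 0 .: t₁.wk 1 .: sh 1)) →
      RHOL D S Γ Ψ t₁ σ₁ t₂ σ₂ φ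
  /- left rules; `t₂` is arbitrary -/
  | varL {Γ : Ctx} {Ψ : Set (Form P)} {i : ℕ} {t₂ : Tm} {σ₁ σ₂ : Ty} {φ : Form P} :
      WfR D S Γ Ψ (.var i) σ₁ t₂ σ₂ (φ.subst (.var 1 .: sh 2)) →
      φ.inst (.var i) ∈ Ψ →
      RHOL D S Γ Ψ (.var i) σ₁ t₂ σ₂ (φ.subst (.var 1 .: sh 2))
  | absL {Γ : Ctx} {Ψ : Set (Form P)} {t₁ t₂ : Tm} {τ₁ σ₁ σ₂ : Ty} {φ' φ : Form P} :
      WfR D S Γ Ψ (.lam τ₁ t₁) (.arrow τ₁ σ₁) t₂ σ₂ (leftArrow τ₁ φ' φ) →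
      RHOL D S (τ₁ :: Γ) (insert φ' (wkHyps 1 Ψ)) t₁ σ₁ (t₂.wk 1) σ₂ φ →
      RHOL D S Γ Ψ (.lam τ₁ t₁) (.arrow τ₁ σ₁) t₂ σ₂ (leftArrow τ₁ φ' φ)
  | appL {Γ : Ctx} {Ψ : Set (Form P)} {t₁ u₁ t₂ : Tm} {τ₁ σ₁ σ₂ : Ty} {φ' φ : Form P} :
      WfR D S Γ Ψ (.app t₁ u₁) σ₁ t₂ σ₂ (φ.subst (.var 0 .: .var 1 .: u₁.wk 2 .: sh 2)) →
      RHOL D S Γ Ψ t₁ (.arrow τ₁ σ₁) t₂ σ₂ (leftArrow τ₁ φ' φ) →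
      UHOL D S Γ Ψ u₁ τ₁ φ' →
      RHOL D S Γ Ψ (.app t₁ u₁) σ₁ t₂ σ₂ (φ.subst (.var 0 .: .var 1 .: u₁.wk 2 .: sh 2))
  | ttL {Γ : Ctx} {Ψ : Set (Form P)} {t₂ : Tm} {σ₂ : Ty} {φ : Form P} :
      WfR D S Γ Ψ .tt .bool t₂ σ₂ φ → HOL D S Γ Ψ (φ.inst2 .tt t₂) →
      RHOL D S Γ Ψ .tt .bool t₂ σ₂ φ
  | ffL {Γ : Ctx} {Ψ : Set (Form P)} {t₂ : Tm} {σ₂ : Ty} {φ : Form P} :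
      WfR D S Γ Ψ .ff .bool t₂ σ₂ φ → HOL D S Γ Ψ (φ.inst2 .ff t₂) →
      RHOL D S Γ Ψ .ff .bool t₂ σ₂ φ
  | zeroL {Γ : Ctx} {Ψ : Set (Form P)} {t₂ : Tm} {σ₂ : Ty} {φ : Form P} :
      WfR D S Γ Ψ .zero .nat t₂ σ₂ φ → HOL D S Γ Ψ (φ.inst2 .zero t₂) →
      RHOL D S Γ Ψ .zero .nat t₂ σ₂ φ
  | succL {Γ : Ctx} {Ψ : Set (Form P)} {t₁ t₂ : Tm} {σ₂ : Ty} {φ' φ : Form P} :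
      WfR D S Γ Ψ (.succ t₁) .nat t₂ σ₂ φ →
      RHOL D S Γ Ψ t₁ .nat t₂ σ₂ φ' →
      HOL D S Γ Ψ (.all .nat (.all σ₂
        (.imp φ' (φ.subst (.var 0 .: .succ (.var 1) .: sh 2))))) →
      RHOL D S Γ Ψ (.succ t₁) .nat t₂ σ₂ φ
  | nilL {Γ : Ctx} {Ψ : Set (Form P)} {t₂ : Tm} {σ₁ σ₂ : Ty} {φ : Form P} :
      WfR D S Γ Ψ .nil (.list σ₁) t₂ σ₂ φ → HOL D S Γ Ψ (φ.inst2 .nil t₂) →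
      RHOL D S Γ Ψ .nil (.list σ₁) t₂ σ₂ φ
  /- the last premise is `∀ x₁ x₂ y₁. φ'[x₁, x₂] ⇒ φ''[y₁, x₂] ⇒ φ[x₁ :: y₁, x₂]` -/
  | consL {Γ : Ctx} {Ψ : Set (Form P)} {h₁ t₁ t₂ : Tm} {σ₁ σ₂ : Ty} {φ' φ'' φ : Form P} :
      WfR D S Γ Ψ (.cons h₁ t₁) (.list σ₁) t₂ σ₂ φ →
      RHOL D S Γ Ψ h₁ σ₁ t₂ σ₂ φ' →
      RHOL D S Γ Ψ t₁ (.list σ₁) t₂ σ₂ φ'' →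
      HOL D S Γ Ψ (.all σ₁ (.all σ₂ (.all (.list σ₁)
        (.imp (φ'.subst (.var 1 .: .var 2 .: sh 3))
          (.imp (φ''.subst (.var 1 .: .var 0 .: sh 3))
            (φ.subst (.var 1 .: .cons (.var 2) (.var 0) .: sh 3))))))) →
      RHOL D S Γ Ψ (.cons h₁ t₁) (.list σ₁) t₂ σ₂ φ
  | pairL {Γ : Ctx} {Ψ : Set (Form P)} {t₁ u₁ t₂ : Tm} {σ₁ τ₁ σ₂ : Ty} {φ' φ'' φ : Form P} :
      WfR D S Γ Ψ (.pair t₁ u₁) (.prod σ₁ τ₁) t₂ σ₂ φ →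
      RHOL D S Γ Ψ t₁ σ₁ t₂ σ₂ φ' →
      RHOL D S Γ Ψ u₁ τ₁ t₂ σ₂ φ'' →
      HOL D S Γ Ψ (.all σ₁ (.all σ₂ (.all τ₁
        (.imp (φ'.subst (.var 1 .: .var 2 .: sh 3))
          (.imp (φ''.subst (.var 1 .: .var 0 .: sh 3))
            (φ.subst (.var 1 .: .pair (.var 2) (.var 0) .: sh 3))))))) →
      RHOL D S Γ Ψ (.pair t₁ u₁) (.prod σ₁ τ₁) t₂ σ₂ φ
  | fstL {Γ : Ctx} {Ψ : Set (Form P)} {t₁ t₂ : Tm} {σ₁ τ₁ σ₂ : Ty} {φ : Form P} :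
      WfR D S Γ Ψ (.fst t₁) σ₁ t₂ σ₂ φ →
      RHOL D S Γ Ψ t₁ (.prod σ₁ τ₁) t₂ σ₂ (φ.subst (.var 0 .: .fst (.var 1) .: sh 2)) →
      RHOL D S Γ Ψ (.fst t₁) σ₁ t₂ σ₂ φ
  | sndL {Γ : Ctx} {Ψ : Set (Form P)} {t₁ t₂ : Tm} {σ₁ τ₁ σ₂ : Ty} {φ : Form P} :
      WfR D S Γ Ψ (.snd t₁) τ₁ t₂ σ₂ φ →
      RHOL D S Γ Ψ t₁ (.prod σ₁ τ₁) t₂ σ₂ (φ.subst (.var 0 .: .snd (.var 1) .: sh 2)) →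
      RHOL D S Γ Ψ (.snd t₁) τ₁ t₂ σ₂ φ
  | boolcaseL {Γ : Ctx} {Ψ : Set (Form P)} {b₁ u₁ v₁ t₂ : Tm} {σ₁ σ₂ : Ty} {φ : Form P} :
      WfR D S Γ Ψ (.casebool b₁ u₁ v₁) σ₁ t₂ σ₂ φ →
      HasType D Γ b₁ .bool →
      RHOL D S Γ (insert (.eq .bool b₁ .tt) Ψ) u₁ σ₁ t₂ σ₂ φ →
      RHOL D S Γ (insert (.eq .bool b₁ .ff) Ψ) v₁ σ₁ t₂ σ₂ φ →
      RHOL D S Γ Ψ (.casebool b₁ u₁ v₁) σ₁ t₂ σ₂ φ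
  | natcaseL {Γ : Ctx} {Ψ : Set (Form P)} {n₁ u₁ v₁ t₂ : Tm} {σ₁ σ₂ : Ty} {φ : Form P} :
      WfR D S Γ Ψ (.casenat n₁ u₁ v₁) σ₁ t₂ σ₂ φ →
      HasType D Γ n₁ .nat →
      RHOL D S Γ (insert (.eq .nat n₁ .zero) Ψ) u₁ σ₁ t₂ σ₂ φ →
      RHOL D S Γ Ψ v₁ (.arrow .nat σ₁) t₂ σ₂
        (.all .nat (.imp (.eq .nat (n₁.wk 3) (.succ (.var 0)))
          (φ.subst (.var 1 .: .app (.var 2) (.var 0) .: sh 3)))) →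
      RHOL D S Γ Ψ (.casenat n₁ u₁ v₁) σ₁ t₂ σ₂ φ
  | listcaseL {Γ : Ctx} {Ψ : Set (Form P)} {l₁ u₁ v₁ t₂ : Tm} {τ₁ σ₁ σ₂ : Ty} {φ : Form P} :
      WfR D S Γ Ψ (.caselist l₁ u₁ v₁) σ₁ t₂ σ₂ φ →
      HasType D Γ l₁ (.list τ₁) →
      RHOL D S Γ (insert (.eq (.list τ₁) l₁ .nil) Ψ) u₁ σ₁ t₂ σ₂ φ →
      RHOL D S Γ Ψ v₁ (.arrow τ₁ (.arrow (.list τ₁) σ₁)) t₂ σ₂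
        (.all τ₁ (.all (.list τ₁) (.imp (.eq (.list τ₁) (l₁.wk 4) (.cons (.var 1) (.var 0)))
          (φ.subst (.var 2 .: .app (.app (.var 3) (.var 1)) (.var 0) .: sh 4))))) →
      RHOL D S Γ Ψ (.caselist l₁ u₁ v₁) σ₁ t₂ σ₂ φ
  /- the premise is in the context `Γ, x₁, f₁`; in `φ'` index `0` is `x₁`; in `φ` indices `0`, `1`,
  `2` are `r₂`, `r₁`, `x₁` -/
  | letrecL {Γ : Ctx} {Ψ : Set (Form P)} {e₁ t₂ : Tm} {I₁ σ₁ σ₂ : Ty} {φ' φ : Form P} :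
      WfR D S Γ Ψ (.letrec e₁) (.arrow I₁ σ₁) t₂ σ₂ (leftArrow I₁ φ' φ) →
      I₁.IsInd → D Γ I₁ σ₁ e₁ →
      RHOL D S (.arrow I₁ σ₁ :: I₁ :: Γ)
        (insert
          (.all I₁ (.imp (.lt I₁ (.var 0) (.var 2))
            (.imp (φ'.subst (.var 0 .: sh 3))
              (φ.subst (t₂.wk 3 .: .app (.var 1) (.var 0) .: .var 0 .: sh 3)))))
          (insert (φ'.subst (sh 1)) (wkHyps 2 Ψ)))
        e₁ σ₁ (t₂.wk 2) σ₂ (φ.subst (.var 0 .: .var 1 .: .var 3 .: sh 4)) →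
      RHOL D S Γ Ψ (.letrec e₁) (.arrow I₁ σ₁) t₂ σ₂ (leftArrow I₁ φ' φ)
  /- right rules; `t₁` is arbitrary -/
  | varR {Γ : Ctx} {Ψ : Set (Form P)} {t₁ : Tm} {i : ℕ} {σ₁ σ₂ : Ty} {φ : Form P} :
      WfR D S Γ Ψ t₁ σ₁ (.var i) σ₂ (φ.subst (.var 0 .: sh 2)) →
      φ.inst (.var i) ∈ Ψ →
      RHOL D S Γ Ψ t₁ σ₁ (.var i) σ₂ (φ.subst (.var 0 .: sh 2))
  | absR {Γ : Ctx} {Ψ : Set (Form P)} {t₁ t₂ : Tm} {σ₁ τ₂ σ₂ : Ty} {φ' φ : Form P} :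
      WfR D S Γ Ψ t₁ σ₁ (.lam τ₂ t₂) (.arrow τ₂ σ₂) (rightArrow τ₂ φ' φ) →
      RHOL D S (τ₂ :: Γ) (insert φ' (wkHyps 1 Ψ)) (t₁.wk 1) σ₁ t₂ σ₂ φ →
      RHOL D S Γ Ψ t₁ σ₁ (.lam τ₂ t₂) (.arrow τ₂ σ₂) (rightArrow τ₂ φ' φ)
  | appR {Γ : Ctx} {Ψ : Set (Form P)} {t₁ t₂ u₂ : Tm} {σ₁ τ₂ σ₂ : Ty} {φ' φ : Form P} :
      WfR D S Γ Ψ t₁ σ₁ (.app t₂ u₂) σ₂ (φ.subst (.var 0 .: .var 1 .: u₂.wk 2 .: sh 2)) →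
      RHOL D S Γ Ψ t₁ σ₁ t₂ (.arrow τ₂ σ₂) (rightArrow τ₂ φ' φ) →
      UHOL D S Γ Ψ u₂ τ₂ φ' →
      RHOL D S Γ Ψ t₁ σ₁ (.app t₂ u₂) σ₂ (φ.subst (.var 0 .: .var 1 .: u₂.wk 2 .: sh 2))
  | ttR {Γ : Ctx} {Ψ : Set (Form P)} {t₁ : Tm} {σ₁ : Ty} {φ : Form P} :
      WfR D S Γ Ψ t₁ σ₁ .tt .bool φ → HOL D S Γ Ψ (φ.inst2 t₁ .tt) →
      RHOL D S Γ Ψ t₁ σ₁ .tt .bool φ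
  | ffR {Γ : Ctx} {Ψ : Set (Form P)} {t₁ : Tm} {σ₁ : Ty} {φ : Form P} :
      WfR D S Γ Ψ t₁ σ₁ .ff .bool φ → HOL D S Γ Ψ (φ.inst2 t₁ .ff) →
      RHOL D S Γ Ψ t₁ σ₁ .ff .bool φ
  | zeroR {Γ : Ctx} {Ψ : Set (Form P)} {t₁ : Tm} {σ₁ : Ty} {φ : Form P} :
      WfR D S Γ Ψ t₁ σ₁ .zero .nat φ → HOL D S Γ Ψ (φ.inst2 t₁ .zero) →
      RHOL D S Γ Ψ t₁ σ₁ .zero .nat φ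
  | succR {Γ : Ctx} {Ψ : Set (Form P)} {t₁ t₂ : Tm} {σ₁ : Ty} {φ' φ : Form P} :
      WfR D S Γ Ψ t₁ σ₁ (.succ t₂) .nat φ →
      RHOL D S Γ Ψ t₁ σ₁ t₂ .nat φ' →
      HOL D S Γ Ψ (.all σ₁ (.all .nat
        (.imp φ' (φ.subst (.succ (.var 0) .: .var 1 .: sh 2))))) →
      RHOL D S Γ Ψ t₁ σ₁ (.succ t₂) .nat φ
  | nilR {Γ : Ctx} {Ψ : Set (Form P)} {t₁ : Tm} {σ₁ σ₂ : Ty} {φ : Form P} :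
      WfR D S Γ Ψ t₁ σ₁ .nil (.list σ₂) φ → HOL D S Γ Ψ (φ.inst2 t₁ .nil) →
      RHOL D S Γ Ψ t₁ σ₁ .nil (.list σ₂) φ
  /- the last premise is `∀ x₁ x₂ y₂. φ'[x₁, x₂] ⇒ φ''[x₁, y₂] ⇒ φ[x₁, x₂ :: y₂]` -/
  | consR {Γ : Ctx} {Ψ : Set (Form P)} {t₁ h₂ t₂ : Tm} {σ₁ σ₂ : Ty} {φ' φ'' φ : Form P} :
      WfR D S Γ Ψ t₁ σ₁ (.cons h₂ t₂) (.list σ₂) φ →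
      RHOL D S Γ Ψ t₁ σ₁ h₂ σ₂ φ' →
      RHOL D S Γ Ψ t₁ σ₁ t₂ (.list σ₂) φ'' →
      HOL D S Γ Ψ (.all σ₁ (.all σ₂ (.all (.list σ₂)
        (.imp (φ'.subst (.var 1 .: .var 2 .: sh 3))
          (.imp (φ''.subst (.var 0 .: .var 2 .: sh 3))
            (φ.subst (.cons (.var 1) (.var 0) .: .var 2 .: sh 3))))))) →
      RHOL D S Γ Ψ t₁ σ₁ (.cons h₂ t₂) (.list σ₂) φ
  | pairR {Γ : Ctx} {Ψ : Set (Form P)} {t₁ t₂ u₂ : Tm} {σ₁ σ₂ τ₂ : Ty} {φ' φ'' φ : Form P} :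
      WfR D S Γ Ψ t₁ σ₁ (.pair t₂ u₂) (.prod σ₂ τ₂) φ →
      RHOL D S Γ Ψ t₁ σ₁ t₂ σ₂ φ' →
      RHOL D S Γ Ψ t₁ σ₁ u₂ τ₂ φ'' →
      HOL D S Γ Ψ (.all σ₁ (.all σ₂ (.all τ₂
        (.imp (φ'.subst (.var 1 .: .var 2 .: sh 3))
          (.imp (φ''.subst (.var 0 .: .var 2 .: sh 3))
            (φ.subst (.pair (.var 1) (.var 0) .: .var 2 .: sh 3))))))) →
      RHOL D S Γ Ψ t₁ σ₁ (.pair t₂ u₂) (.prod σ₂ τ₂) φ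
  | fstR {Γ : Ctx} {Ψ : Set (Form P)} {t₁ t₂ : Tm} {σ₁ σ₂ τ₂ : Ty} {φ : Form P} :
      WfR D S Γ Ψ t₁ σ₁ (.fst t₂) σ₂ φ →
      RHOL D S Γ Ψ t₁ σ₁ t₂ (.prod σ₂ τ₂) (φ.subst (.fst (.var 0) .: .var 1 .: sh 2)) →
      RHOL D S Γ Ψ t₁ σ₁ (.fst t₂) σ₂ φ
  | sndR {Γ : Ctx} {Ψ : Set (Form P)} {t₁ t₂ : Tm} {σ₁ σ₂ τ₂ : Ty} {φ : Form P} :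
      WfR D S Γ Ψ t₁ σ₁ (.snd t₂) τ₂ φ →
      RHOL D S Γ Ψ t₁ σ₁ t₂ (.prod σ₂ τ₂) (φ.subst (.snd (.var 0) .: .var 1 .: sh 2)) →
      RHOL D S Γ Ψ t₁ σ₁ (.snd t₂) τ₂ φ
  | boolcaseR {Γ : Ctx} {Ψ : Set (Form P)} {t₁ b₂ u₂ v₂ : Tm} {σ₁ σ₂ : Ty} {φ : Form P} :
      WfR D S Γ Ψ t₁ σ₁ (.casebool b₂ u₂ v₂) σ₂ φ →
      HasType D Γ b₂ .bool →
      RHOL D S Γ (insert (.eq .bool b₂ .tt) Ψ) t₁ σ₁ u₂ σ₂ φ →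
      RHOL D S Γ (insert (.eq .bool b₂ .ff) Ψ) t₁ σ₁ v₂ σ₂ φ →
      RHOL D S Γ Ψ t₁ σ₁ (.casebool b₂ u₂ v₂) σ₂ φ
  | natcaseR {Γ : Ctx} {Ψ : Set (Form P)} {t₁ n₂ u₂ v₂ : Tm} {σ₁ σ₂ : Ty} {φ : Form P} :
      WfR D S Γ Ψ t₁ σ₁ (.casenat n₂ u₂ v₂) σ₂ φ →
      HasType D Γ n₂ .nat →
      RHOL D S Γ (insert (.eq .nat n₂ .zero) Ψ) t₁ σ₁ u₂ σ₂ φ →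
      RHOL D S Γ Ψ t₁ σ₁ v₂ (.arrow .nat σ₂)
        (.all .nat (.imp (.eq .nat (n₂.wk 3) (.succ (.var 0)))
          (φ.subst (.app (.var 1) (.var 0) .: .var 2 .: sh 3)))) →
      RHOL D S Γ Ψ t₁ σ₁ (.casenat n₂ u₂ v₂) σ₂ φ
  | listcaseR {Γ : Ctx} {Ψ : Set (Form P)} {t₁ l₂ u₂ v₂ : Tm} {σ₁ τ₂ σ₂ : Ty} {φ : Form P} :
      WfR D S Γ Ψ t₁ σ₁ (.caselist l₂ u₂ v₂) σ₂ φ →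
      HasType D Γ l₂ (.list τ₂) →
      RHOL D S Γ (insert (.eq (.list τ₂) l₂ .nil) Ψ) t₁ σ₁ u₂ σ₂ φ →
      RHOL D S Γ Ψ t₁ σ₁ v₂ (.arrow τ₂ (.arrow (.list τ₂) σ₂))
        (.all τ₂ (.all (.list τ₂) (.imp (.eq (.list τ₂) (l₂.wk 4) (.cons (.var 1) (.var 0)))
          (φ.subst (.app (.app (.var 2) (.var 1)) (.var 0) .: .var 3 .: sh 4))))) →
      RHOL D S Γ Ψ t₁ σ₁ (.caselist l₂ u₂ v₂) σ₂ φ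
  | letrecR {Γ : Ctx} {Ψ : Set (Form P)} {t₁ e₂ : Tm} {σ₁ I₂ σ₂ : Ty} {φ' φ : Form P} :
      WfR D S Γ Ψ t₁ σ₁ (.letrec e₂) (.arrow I₂ σ₂) (rightArrow I₂ φ' φ) →
      I₂.IsInd → D Γ I₂ σ₂ e₂ →
      RHOL D S (.arrow I₂ σ₂ :: I₂ :: Γ)
        (insert
          (.all I₂ (.imp (.lt I₂ (.var 0) (.var 2))
            (.imp (φ'.subst (.var 0 .: sh 3))
              (φ.subst (.app (.var 1) (.var 0) .: t₁.wk 3 .: .var 0 .: sh 3)))))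
          (insert (φ'.subst (sh 1)) (wkHyps 2 Ψ)))
        (t₁.wk 2) σ₁ e₂ σ₂ (φ.subst (.var 0 .: .var 1 .: .var 3 .: sh 4)) →
      RHOL D S Γ Ψ t₁ σ₁ (.letrec e₂) (.arrow I₂ σ₂) (rightArrow I₂ φ' φ)

/-- `φ[t/r₂]`, again in `Γ, r₁, r₂`, for a term `t` of `Γ`. -/
def Form.substR₂ {P : Type u} (φ : Form P) (t : Tm) : Form P :=
  φ.subst (t.wk 2 .: .var 1 .: sh 2)

/-- `φ[t/r₁]`, again in `Γ, r₁, r₂`, for a term `t` of `Γ`. -/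
def Form.substR₁ {P : Type u} (φ : Form P) (t : Tm) : Form P :=
  φ.subst (.var 0 .: t.wk 2 .: sh 2)

end RelLogic

/-! A relational judgment is nothing more than a statement of HOL about the two terms: a well-formed
judgment `Γ | Ψ ⊢ t₁ ∼ t₂ | φ` is derivable in RHOL exactly when HOL proves `φ[t₁/r₁][t₂/r₂]`
(`RHOL.hol` for soundness, `HOL.rhol` for completeness). Transitivity then costs nothing: the two
given judgments yield `φ[t₁, t₂]` and `φ'[t₂, t₃]` in HOL, and the conjunction of these is the
instance of the target assertion at `t₁`, `t₃`.

Completeness is cheap. The rule `uholL` turns a relational goal into a unary one with `t₂` fixed. In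
UHOL every well-typed term satisfies `⊤` (`UHOL.top`), and subsumption replaces `⊤` by any assertion
that HOL proves of the term (`HOL.uhol`).

Soundness is an induction on derivations that replays each rule in HOL. Most rules instantiate a
quantified premise or are immediate. Abstractions need a β-step under an equality. The case
constructs need case distinctions, obtained from the induction rules. A two-sided case construct has
four combinations of branches, of which the premise on the scrutinees refutes two. Recursive
definitions need two facts. First, `letrec e` applied to an arbitrary argument equals its unfolding
(`letrec_unfold`); this is not a conversion, since μ-reduction fires only on constructors, but it
follows by induction on the argument. Second, the induction built into the rule must be available in
HOL: strong induction for one definition, and induction on pairs of sizes (`pair_induction`) for two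
definitions run in step.

All this rests on stability of typing, assertions and HOL derivations under substitution. For
typing, this is where the stability of the test on recursive definitions is needed. -/

namespace RelLogic

universe u

/-! The algebra of substitutions. -/

attribute [simp] Tm.subst Form.subst Tm.wk Tm.inst Form.wk Form.inst Form.inst2

/-- Composition of substitutions, in diagrammatic order. -/
def comp (σ θ : ℕ → Tm) : ℕ → Tm := fun i => (σ i).subst θ

infixr:68 " ⨾ " => comp

theorem comp_apply (σ θ : ℕ → Tm) (i : ℕ) : (σ ⨾ θ) i = (σ i).subst θ := rfl

@[simp] theorem scons_zero (t : Tm) (σ : ℕ → Tm) : (t .: σ) 0 = t := rfl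

@[simp] theorem scons_succ (t : Tm) (σ : ℕ → Tm) (i : ℕ) : (t .: σ) (i + 1) = σ i := rfl

@[simp] theorem sh_apply (k i : ℕ) : sh k i = .var (i + k) := rfl

@[simp] theorem sh_zero : sh 0 = Tm.var := rfl

theorem scons_ext {σ θ : ℕ → Tm} (h0 : σ 0 = θ 0) (hs : ∀ i, σ (i + 1) = θ (i + 1)) : σ = θ := by
  funext i
  cases i
  · exact h0
  · exact hs _

theorem up_var_comp (ρ : ℕ → ℕ) : up (fun i => .var (ρ i)) = fun i => .var (upRen ρ i) :=
  scons_ext rfl fun _ => rfl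

theorem rename_eq_subst (t : Tm) : ∀ ρ : ℕ → ℕ, t.rename ρ = t.subst (fun i => .var (ρ i)) := by
  induction t <;> intro ρ <;> simp_all [Tm.rename, up_var_comp]

theorem up_comp_upRen (ρ : ℕ → ℕ) (σ : ℕ → Tm) :
    (fun i => up σ (upRen ρ i)) = up (fun i => σ (ρ i)) :=
  scons_ext rfl fun _ => rfl

/-- `up` shifts by renaming, so composition of substitutions can pass a binder only once the mixed
laws for renaming and substitution are known. This law and `subst_rename` are the ones that
`up_comp_up` combines. -/
theorem rename_subst (t : Tm) :
    ∀ (ρ : ℕ → ℕ) (σ : ℕ → Tm), (t.rename ρ).subst σ = t.subst (fun i => σ (ρ i)) := by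
  induction t <;> intro ρ σ <;> simp_all [Tm.rename, up_comp_upRen]

theorem rename_rename (t : Tm) (ρ ρ' : ℕ → ℕ) :
    (t.rename ρ).rename ρ' = t.rename (fun i => ρ' (ρ i)) := by
  rw [rename_eq_subst _ ρ', rename_subst, rename_eq_subst]

theorem up_rename (σ : ℕ → Tm) (ρ : ℕ → ℕ) :
    (fun i => (up σ i).rename (upRen ρ)) = up (fun i => (σ i).rename ρ) :=
  scons_ext rfl fun i => by
    change ((σ i).rename Nat.succ).rename (upRen ρ) = ((σ i).rename ρ).rename Nat.succ
    simp only [rename_rename]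
    rfl

theorem subst_rename (t : Tm) :
    ∀ (σ : ℕ → Tm) (ρ : ℕ → ℕ), (t.subst σ).rename ρ = t.subst (fun i => (σ i).rename ρ) := by
  induction t <;> intro σ ρ <;> simp_all [Tm.rename, up_rename]

theorem up_comp_up (σ θ : ℕ → Tm) : up σ ⨾ up θ = up (σ ⨾ θ) :=
  scons_ext rfl fun i => by
    change ((σ i).rename Nat.succ).subst (up θ) = ((σ i).subst θ).rename Nat.succ
    simp only [rename_subst, subst_rename]
    rfl

@[simp] theorem Tm.subst_subst (t : Tm) :
    ∀ σ θ : ℕ → Tm, (t.subst σ).subst θ = t.subst (σ ⨾ θ) := by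
  induction t <;> intro σ θ <;> simp_all [up_comp_up, comp_apply]

-- Removes `up` in favour of extension and composition. With the laws below, `simp` can then
-- normalize the substitutions arising in the rules, and most bookkeeping with indices is left to
-- it.
@[simp] theorem up_eq (σ : ℕ → Tm) : up σ = (.var 0 .: σ ⨾ sh 1) :=
  scons_ext rfl fun _ => rename_eq_subst _ _

theorem up_var : up Tm.var = Tm.var := scons_ext rfl fun _ => rfl

@[simp] theorem Tm.subst_var (t : Tm) : t.subst Tm.var = t := by
  -- `up Tm.var` has to stay folded here, so that `up_var` recognizes the identity under a binder.
  induction t <;> simp_all [-up_eq, up_var]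

@[simp] theorem scons_comp (t : Tm) (σ θ : ℕ → Tm) : (t .: σ) ⨾ θ = (t.subst θ .: σ ⨾ θ) :=
  scons_ext rfl fun _ => rfl

@[simp] theorem sh_succ_comp_scons (k : ℕ) (t : Tm) (σ : ℕ → Tm) :
    sh (k + 1) ⨾ (t .: σ) = sh k ⨾ σ := rfl

@[simp] theorem var_comp (σ : ℕ → Tm) : Tm.var ⨾ σ = σ := rfl

@[simp] theorem comp_var (σ : ℕ → Tm) : σ ⨾ Tm.var = σ := by
  funext i
  exact Tm.subst_var _

@[simp] theorem comp_assoc (σ θ η : ℕ → Tm) : (σ ⨾ θ) ⨾ η = σ ⨾ θ ⨾ η := by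
  funext i
  exact Tm.subst_subst _ _ _

@[simp] theorem sh_comp_sh (k l : ℕ) : sh k ⨾ sh l = sh (k + l) := by
  funext i
  simp [comp_apply, add_assoc]

@[simp] theorem sh_comp_sh_comp (k l : ℕ) (σ : ℕ → Tm) : sh k ⨾ sh l ⨾ σ = sh (k + l) ⨾ σ := by
  rw [← comp_assoc, sh_comp_sh]

-- The η-law of the calculus; at `k = 0` it recognizes the identity substitution after it has been
-- pushed under a binder.
@[simp] theorem var_scons_sh (k : ℕ) : (.var k .: sh (k + 1)) = sh k :=
  scons_ext (by simp) fun i => by simp; omega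

@[simp] theorem Form.subst_subst {P : Type u} (φ : Form P) :
    ∀ σ θ : ℕ → Tm, (φ.subst σ).subst θ = φ.subst (σ ⨾ θ) := by
  induction φ <;> intro σ θ <;> simp_all

@[simp] theorem Form.subst_var {P : Type u} (φ : Form P) : φ.subst Tm.var = φ := by
  induction φ <;> simp_all [-up_eq, up_var]
  exact List.map_id'' Tm.subst_var _

/-! Reduction is stable under substitution. -/

theorem Tm.IsConstr.subst {c : Tm} (h : c.IsConstr) (θ : ℕ → Tm) : (c.subst θ).IsConstr := by
  cases h <;> constructor

theorem Red.subst {t t' : Tm} (h : Red t t') : ∀ θ : ℕ → Tm, Red (t.subst θ) (t'.subst θ) := by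
  induction h with
  | beta τ t u => intro θ; simpa using Red.beta τ (t.subst (up θ)) (u.subst θ)
  | mu e c hc =>
    intro θ
    simpa using Red.mu (e.subst (up (up θ))) (c.subst θ) (hc.subst θ)
  | _ => intro θ; constructor <;> solve_by_elim

theorem Conv.subst {t t' : Tm} (h : Conv t t') (θ : ℕ → Tm) : Conv (t.subst θ) (t'.subst θ) := by
  induction h with
  | rel _ _ h => exact .rel _ _ (h.subst θ)
  | refl _ => exact .refl _
  | symm _ _ _ ih => exact .symm _ _ ih
  | trans _ _ _ _ _ ih₁ ih₂ => exact .trans _ _ _ ih₁ ih₂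

theorem Red.conv {t t' : Tm} (h : Red t t') : Conv t t' := .rel _ _ h

/-! Typing is stable under substitution. -/

theorem HasType.var_zero {D : Guard} {Γ : Ctx} {τ : Ty} : HasType D (τ :: Γ) (.var 0) τ :=
  .var rfl

theorem SubstTyped.scons {D : Guard} {Γ Δ : Ctx} {θ : ℕ → Tm} {t : Tm} {τ : Ty}
    (ht : HasType D Δ t τ) (h : SubstTyped D Δ θ Γ) : SubstTyped D Δ (t .: θ) (τ :: Γ) := by
  intro i σ hi
  cases i with
  | zero => simp at hi; exact hi ▸ ht
  | succ i => exact h i σ (by simpa using hi)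

theorem SubstTyped.var {D : Guard} (Γ : Ctx) : SubstTyped D Γ Tm.var Γ := fun _ _ h => .var h

/-- Comes before substitution, because a substitution passes a binder only if the shifted terms are
still well typed. For `letrec`, stability of the test is applied to the renaming read as a
substitution by variables. -/
theorem HasType.rename {D : Guard} (hD : D.Stable) {Γ : Ctx} {t : Tm} {τ : Ty}
    (h : HasType D Γ t τ) : ∀ (Δ : Ctx) (ρ : ℕ → ℕ),
    (∀ (i : ℕ) (σ : Ty), Γ[i]? = some σ → Δ[ρ i]? = some σ) → HasType D Δ (t.rename ρ) τ := by
  have up : ∀ {Γ Δ : Ctx} {ρ : ℕ → ℕ} (σ : Ty),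
      (∀ (i : ℕ) (τ : Ty), Γ[i]? = some τ → Δ[ρ i]? = some τ) →
      ∀ (i : ℕ) (τ : Ty), (σ :: Γ)[i]? = some τ → (σ :: Δ)[upRen ρ i]? = some τ := by
    intro Γ Δ ρ σ h i τ hi
    cases i with
    | zero => exact hi
    | succ i => exact h i τ hi
  induction h with
  | lam _ ih => exact fun Δ ρ hρ => .lam (ih _ _ (up _ hρ))
  | var h => exact fun Δ ρ hρ => .var (hρ _ _ h)
  | letrec hI he hg ih =>
    intro Δ ρ hρ
    refine .letrec hI (ih _ _ (up _ (up _ hρ))) ?_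
    have := hD _ Δ (fun i => .var (ρ i)) _ _ _ hI (fun i τ h => .var (hρ i τ h)) he hg
    rwa [up_var_comp, up_var_comp, ← rename_eq_subst] at this
  | _ => intro Δ ρ hρ; constructor <;> solve_by_elim

theorem SubstTyped.up {D : Guard} (hD : D.Stable) {Γ Δ : Ctx} {θ : ℕ → Tm}
    (h : SubstTyped D Δ θ Γ) (τ : Ty) : SubstTyped D (τ :: Δ) (up θ) (τ :: Γ) :=
  .scons .var_zero fun i σ hi => (h i σ hi).rename hD _ _ fun _ _ h => h

theorem HasType.subst {D : Guard} (hD : D.Stable) {Γ : Ctx} {t : Tm} {τ : Ty}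
    (h : HasType D Γ t τ) :
    ∀ {Δ : Ctx} {θ : ℕ → Tm}, SubstTyped D Δ θ Γ → HasType D Δ (t.subst θ) τ := by
  induction h with
  | var h => exact fun hθ => hθ _ _ h
  | lam _ ih => exact fun hθ => .lam (ih (hθ.up hD _))
  | letrec hI he hg ih =>
    exact fun hθ => .letrec hI (ih ((hθ.up hD _).up hD _)) (hD _ _ _ _ _ _ hI hθ he hg)
  | _ => intro Δ θ hθ; constructor <;> solve_by_elim

theorem SubstTyped.comp {D : Guard} (hD : D.Stable) {Γ Δ Ξ : Ctx} {σ θ : ℕ → Tm}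
    (hσ : SubstTyped D Δ σ Γ) (hθ : SubstTyped D Ξ θ Δ) : SubstTyped D Ξ (σ ⨾ θ) Γ :=
  fun i τ hi => (hσ i τ hi).subst hD hθ

theorem SubstTyped.sh_cons {D : Guard} {Γ Δ : Ctx} {k : ℕ} (τ : Ty)
    (h : SubstTyped D Δ (RelLogic.sh k) Γ) : SubstTyped D (τ :: Δ) (RelLogic.sh (k + 1)) Γ := by
  intro i σ hi
  cases h i σ hi with
  | var h => exact .var h

theorem Form.Wf.subst {P : Type u} {D : Guard} (hD : D.Stable) {S : Sig P} {Γ : Ctx} {φ : Form P}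
    (h : φ.Wf D S Γ) :
    ∀ {Δ : Ctx} {θ : ℕ → Tm}, SubstTyped D Δ θ Γ → (φ.subst θ).Wf D S Δ := by
  induction h with
  | pred h =>
    intro Δ θ hθ
    refine .pred ?_
    rw [List.forall₂_map_left_iff]
    exact h.imp fun _ _ h => h.subst hD hθ
  | eq h₁ h₂ => exact fun hθ => .eq (h₁.subst hD hθ) (h₂.subst hD hθ)
  | le hI h₁ h₂ => exact fun hθ => .le hI (h₁.subst hD hθ) (h₂.subst hD hθ)
  | lt hI h₁ h₂ => exact fun hθ => .lt hI (h₁.subst hD hθ) (h₂.subst hD hθ)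
  | all _ ih => exact fun hθ => .all (ih (hθ.up hD _))
  | ex _ ih => exact fun hθ => .ex (ih (hθ.up hD _))
  | _ => intro Δ θ hθ; constructor <;> solve_by_elim

/-! ### Substitution sees only the variables of the context; closed assertions. -/

theorem HasType.subst_congr {D : Guard} {Γ : Ctx} {t : Tm} {τ : Ty} (h : HasType D Γ t τ) :
    ∀ {θ η : ℕ → Tm}, (∀ i < Γ.length, θ i = η i) → t.subst θ = t.subst η := by
  have hup : ∀ {n : ℕ} {θ η : ℕ → Tm}, (∀ i < n, θ i = η i) → ∀ i < n + 1, up θ i = up η i := by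
    intro n θ η h i hi
    cases i with
    | zero => rfl
    | succ i => exact congrArg (Tm.rename Nat.succ) (h i (by omega))
  induction h with
  | var h =>
    intro θ η hθ
    obtain ⟨hi, -⟩ := List.getElem?_eq_some_iff.1 h
    exact hθ _ hi
  | lam _ ih => exact fun hθ => congrArg _ (ih (hup hθ))
  | letrec _ _ _ ih => exact fun hθ => congrArg _ (ih (hup (hup hθ)))
  | _ => intro θ η hθ; simp only [Tm.subst] <;> congr 1 <;> solve_by_elim

theorem Form.Wf.subst_congr {P : Type u} {D : Guard} {S : Sig P} {Γ : Ctx} {φ : Form P}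
    (h : φ.Wf D S Γ) :
    ∀ {θ η : ℕ → Tm}, (∀ i < Γ.length, θ i = η i) → φ.subst θ = φ.subst η := by
  have hup : ∀ {n : ℕ} {θ η : ℕ → Tm}, (∀ i < n, θ i = η i) → ∀ i < n + 1, up θ i = up η i := by
    intro n θ η h i hi
    cases i with
    | zero => rfl
    | succ i => exact congrArg (Tm.rename Nat.succ) (h i (by omega))
  induction h with
  | pred h =>
    intro θ η hθ
    refine congrArg _ (List.map_congr_left fun t ht => ?_)
    obtain ⟨i, hi, rfl⟩ := List.mem_iff_getElem.1 ht
    exact (h.get hi (h.length_eq ▸ hi)).subst_congr hθ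
  | eq h₁ h₂ =>
    exact fun hθ => by rw [Form.subst, Form.subst, h₁.subst_congr hθ, h₂.subst_congr hθ]
  | le _ h₁ h₂ =>
    exact fun hθ => by rw [Form.subst, Form.subst, h₁.subst_congr hθ, h₂.subst_congr hθ]
  | lt _ h₁ h₂ =>
    exact fun hθ => by rw [Form.subst, Form.subst, h₁.subst_congr hθ, h₂.subst_congr hθ]
  | all _ ih => exact fun hθ => congrArg _ (ih (hup hθ))
  | ex _ ih => exact fun hθ => congrArg _ (ih (hup hθ))
  | _ => intro θ η hθ; simp only [Form.subst] <;> congr 1 <;> solve_by_elim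

/-- Meant for the axioms of the basic predicates: they have no free variables, so they remain axioms
after any substitution. -/
theorem Form.Wf.subst_closed {P : Type u} {D : Guard} {S : Sig P} {φ : Form P}
    (h : φ.Wf D S []) (θ : ℕ → Tm) : φ.subst θ = φ :=
  (h.subst_congr (η := Tm.var) (by simp)).trans φ.subst_var

theorem Form.Wf.of_closed {P : Type u} {D : Guard} (hD : D.Stable) {S : Sig P} {Γ : Ctx}
    {φ : Form P} (h : φ.Wf D S []) : φ.Wf D S Γ :=
  h.subst_closed Tm.var ▸ h.subst hD (by intro i τ hi; simp at hi)

/-! Inversion, in a form suitable for simplification. -/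

@[simp] theorem SubstTyped.scons_iff {D : Guard} {Γ Δ : Ctx} {θ : ℕ → Tm} {t : Tm} {τ : Ty} :
    SubstTyped D Δ (t .: θ) (τ :: Γ) ↔ HasType D Δ t τ ∧ SubstTyped D Δ θ Γ :=
  ⟨fun h => ⟨h 0 τ rfl, fun i σ hi => h (i + 1) σ hi⟩, fun h => .scons h.1 h.2⟩

@[simp] theorem SubstTyped.var_self {D : Guard} (Γ : Ctx) : SubstTyped D Γ Tm.var Γ := .var Γ

@[simp] theorem HasType.var_iff {D : Guard} {Γ : Ctx} {i : ℕ} {τ : Ty} :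
    HasType D Γ (.var i) τ ↔ Γ[i]? = some τ :=
  ⟨fun h => by cases h; assumption, .var⟩

-- Peels one fresh variable at a time, down to `sh 0`, the identity. This is how `simp` discharges
-- the typing of all shifts below.
@[simp] theorem SubstTyped.sh_cons_iff {D : Guard} {Γ Δ : Ctx} {k : ℕ} {τ : Ty} :
    SubstTyped D (τ :: Δ) (RelLogic.sh (k + 1)) Γ ↔ SubstTyped D Δ (RelLogic.sh k) Γ :=
  ⟨fun h i σ hi => .var (by simpa [← add_assoc] using h i σ hi), .sh_cons τ⟩

@[simp] theorem Form.Wf.eq_iff {P : Type u} {D : Guard} {S : Sig P} {Γ : Ctx} {τ : Ty} {t u : Tm} :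
    Form.Wf D S Γ (.eq τ t u) ↔ HasType D Γ t τ ∧ HasType D Γ u τ :=
  ⟨fun h => by cases h; constructor <;> assumption, fun h => .eq h.1 h.2⟩

@[simp] theorem Form.Wf.le_iff {P : Type u} {D : Guard} {S : Sig P} {Γ : Ctx} {I : Ty} {t u : Tm} :
    Form.Wf D S Γ (.le I t u) ↔ I.IsInd ∧ HasType D Γ t I ∧ HasType D Γ u I :=
  ⟨fun h => by cases h; refine ⟨?_, ?_, ?_⟩ <;> assumption, fun h => .le h.1 h.2.1 h.2.2⟩

@[simp] theorem Form.Wf.lt_iff {P : Type u} {D : Guard} {S : Sig P} {Γ : Ctx} {I : Ty} {t u : Tm} :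
    Form.Wf D S Γ (.lt I t u) ↔ I.IsInd ∧ HasType D Γ t I ∧ HasType D Γ u I :=
  ⟨fun h => by cases h; refine ⟨?_, ?_, ?_⟩ <;> assumption, fun h => .lt h.1 h.2.1 h.2.2⟩

@[simp] theorem Form.Wf.top_iff {P : Type u} {D : Guard} {S : Sig P} {Γ : Ctx} :
    Form.Wf D S Γ .top ↔ True :=
  iff_true_intro .top

@[simp] theorem Form.Wf.bot_iff {P : Type u} {D : Guard} {S : Sig P} {Γ : Ctx} :
    Form.Wf D S Γ .bot ↔ True :=
  iff_true_intro .bot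

@[simp] theorem Form.Wf.and_iff {P : Type u} {D : Guard} {S : Sig P} {Γ : Ctx} {φ ψ : Form P} :
    Form.Wf D S Γ (.and φ ψ) ↔ φ.Wf D S Γ ∧ ψ.Wf D S Γ :=
  ⟨fun h => by cases h; constructor <;> assumption, fun h => .and h.1 h.2⟩

@[simp] theorem Form.Wf.or_iff {P : Type u} {D : Guard} {S : Sig P} {Γ : Ctx} {φ ψ : Form P} :
    Form.Wf D S Γ (.or φ ψ) ↔ φ.Wf D S Γ ∧ ψ.Wf D S Γ :=
  ⟨fun h => by cases h; constructor <;> assumption, fun h => .or h.1 h.2⟩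

@[simp] theorem Form.Wf.imp_iff {P : Type u} {D : Guard} {S : Sig P} {Γ : Ctx} {φ ψ : Form P} :
    Form.Wf D S Γ (.imp φ ψ) ↔ φ.Wf D S Γ ∧ ψ.Wf D S Γ :=
  ⟨fun h => by cases h; constructor <;> assumption, fun h => .imp h.1 h.2⟩

@[simp] theorem Form.Wf.all_iff {P : Type u} {D : Guard} {S : Sig P} {Γ : Ctx} {τ : Ty}
    {φ : Form P} : Form.Wf D S Γ (.all τ φ) ↔ φ.Wf D S (τ :: Γ) :=
  ⟨fun h => by cases h; assumption, .all⟩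

@[simp] theorem Form.Wf.ex_iff {P : Type u} {D : Guard} {S : Sig P} {Γ : Ctx} {τ : Ty}
    {φ : Form P} : Form.Wf D S Γ (.ex τ φ) ↔ φ.Wf D S (τ :: Γ) :=
  ⟨fun h => by cases h; assumption, .ex⟩

theorem HasType.succ_iff {D : Guard} {Γ : Ctx} {t : Tm} {τ : Ty} :
    HasType D Γ (.succ t) τ ↔ τ = .nat ∧ HasType D Γ t .nat :=
  ⟨fun h => by cases h; exact ⟨rfl, by assumption⟩, fun h => h.1 ▸ .succ h.2⟩

theorem HasType.cons_iff {D : Guard} {Γ : Ctx} {h t : Tm} {τ : Ty} :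
    HasType D Γ (.cons h t) (.list τ) ↔ HasType D Γ h τ ∧ HasType D Γ t (.list τ) :=
  ⟨fun h => by cases h; constructor <;> assumption, fun h => .cons h.1 h.2⟩

/-! Hypotheses. -/

theorem WfHyps.insert {P : Type u} {D : Guard} {S : Sig P} {Γ : Ctx} {Ψ : Set (Form P)}
    {φ : Form P} (hφ : φ.Wf D S Γ) (h : WfHyps D S Γ Ψ) : WfHyps D S Γ (insert φ Ψ) := by
  rintro ψ (rfl | hψ)
  · exact hφ
  · exact h ψ hψ

theorem WfHyps.of_insert {P : Type u} {D : Guard} {S : Sig P} {Γ : Ctx} {Ψ : Set (Form P)}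
    {φ : Form P} (h : WfHyps D S Γ (Insert.insert φ Ψ)) : WfHyps D S Γ Ψ :=
  fun ψ hψ => h ψ (.inr hψ)

theorem WfHyps.wk {P : Type u} {D : Guard} (hD : D.Stable) {S : Sig P} {Γ Δ : Ctx}
    {Ψ : Set (Form P)} {k : ℕ} (h : WfHyps D S Γ Ψ) (hk : SubstTyped D Δ (sh k) Γ) :
    WfHyps D S Δ (wkHyps k Ψ) := by
  rintro _ ⟨ψ, hψ, rfl⟩
  exact (h ψ hψ).subst hD hk

theorem wkHyps_wkHyps {P : Type u} (k l : ℕ) (Ψ : Set (Form P)) :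
    wkHyps l (wkHyps k Ψ) = wkHyps (k + l) Ψ := by
  simp [wkHyps, Set.image_image]
  rfl

/-! Derivable judgments are well formed and stable under substitution. -/

theorem HOL.wf {P : Type u} {D : Guard} (hD : D.Stable) {S : Sig P} {Γ : Ctx} {Ψ : Set (Form P)}
    {φ : Form P} (h : HOL D S Γ Ψ φ) : WfHyps D S Γ Ψ ∧ φ.Wf D S Γ := by
  induction h with
  | ax hΨ h => exact ⟨hΨ, hΨ _ h⟩
  | predAx hΨ _ h => exact ⟨hΨ, h.of_closed hD⟩
  | conv hΨ h₁ h₂ _ => exact ⟨hΨ, .eq h₁ h₂⟩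
  | subst hφ _ _ _ ih => exact ⟨ih.1, hφ.subst hD (by simpa using (Form.Wf.eq_iff.1 ih.2).2)⟩
  | impI hΨ hψ _ ih => exact ⟨hΨ, .imp hψ ih.2⟩
  | impE _ _ ih _ => exact ⟨ih.1, (Form.Wf.imp_iff.1 ih.2).2⟩
  | allI hΨ _ ih => exact ⟨hΨ, .all ih.2⟩
  | allE _ ht ih => exact ⟨ih.1, (Form.Wf.all_iff.1 ih.2).subst hD (by simpa using ht)⟩
  | exI hφ _ _ ih => exact ⟨ih.1, .ex hφ⟩
  | exE hχ _ _ ih => exact ⟨ih.1, hχ⟩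
  | orE _ _ _ ih₁ ih₂ => exact ⟨ih₁.1, ih₂.2⟩
  | bool hφ _ _ ih => exact ⟨ih.1, .all hφ⟩
  -- This rule does not ask for `φ` to be well formed, but `φ` is a hypothesis of its step premise.
  | nat _ _ ih₁ ih₂ => exact ⟨ih₁.1, .all (ih₂.1 _ (.inl rfl))⟩
  | list hφ _ _ ih => exact ⟨ih.1, .all hφ⟩
  | strong _ hΨ _ ih => exact ⟨hΨ, .all ih.2⟩
  | tt_ne_ff hΨ => exact ⟨hΨ, .imp (.eq .tt .ff) .bot⟩
  | zero_ne_succ hΨ ht => exact ⟨hΨ, .imp (.eq .zero (.succ ht)) .bot⟩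
  | nil_ne_cons hΨ ht => exact ⟨hΨ, .imp (.eq .nil ht) .bot⟩
  | zero_le hΨ ht => exact ⟨hΨ, .le .nat .zero ht⟩
  | nil_le hΨ ht => exact ⟨hΨ, .le (.list _) .nil ht⟩
  | lt_of_succ_le | succ_le_of_lt | lt_of_cons_le | cons_le_of_lt | succ_le_succ | cons_le_cons
  | le_of_succ_le_succ | le_of_cons_le_cons =>
    simp_all [HasType.succ_iff, HasType.cons_iff, Ty.IsInd.nat, Ty.IsInd.list]
  | _ => simp_all [HasType.succ_iff, HasType.cons_iff]

/-- Substitution and weakening. -/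
theorem HOL.substitution {P : Type u} {D : Guard} (hD : D.Stable) {S : Sig P} {Γ : Ctx}
    {Ψ : Set (Form P)} {φ : Form P} (h : HOL D S Γ Ψ φ) :
    ∀ {Δ : Ctx} {θ : ℕ → Tm} {Ψ' : Set (Form P)}, SubstTyped D Δ θ Γ → WfHyps D S Δ Ψ' →
      (∀ ψ ∈ Ψ, ψ.subst θ ∈ Ψ') → HOL D S Δ Ψ' (φ.subst θ) := by
  -- `Ψ'` need only contain the substituted hypotheses, so the same induction also gives weakening.
  -- `hins` and `hwk` preserve this inclusion when a hypothesis is added and when a binder is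
  -- passed.
  have hins : ∀ {Ψ Ψ' : Set (Form P)} {θ : ℕ → Tm} (χ : Form P), (∀ ψ ∈ Ψ, ψ.subst θ ∈ Ψ') →
      ∀ ψ ∈ insert χ Ψ, ψ.subst θ ∈ insert (χ.subst θ) Ψ' := by
    rintro Ψ Ψ' θ χ h ψ (rfl | hψ)
    · exact .inl rfl
    · exact .inr (h ψ hψ)
  have hwk : ∀ {Ψ Ψ' : Set (Form P)} {θ : ℕ → Tm}, (∀ ψ ∈ Ψ, ψ.subst θ ∈ Ψ') →
      ∀ ψ ∈ wkHyps 1 Ψ, ψ.subst (up θ) ∈ wkHyps 1 Ψ' := by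
    rintro Ψ Ψ' θ h _ ⟨ψ, hψ, rfl⟩
    exact ⟨_, h ψ hψ, by simp⟩
  have hwf1 : ∀ {Δ : Ctx} {Ψ' : Set (Form P)} (τ : Ty), WfHyps D S Δ Ψ' →
      WfHyps D S (τ :: Δ) (wkHyps 1 Ψ') := fun τ h => h.wk hD (by simp)
  induction h with
  | ax _ h => exact fun hθ hΨ hs => .ax hΨ (hs _ h)
  | @predAx _ _ φ _ h hφ =>
    intro Δ θ Ψ' hθ hΨ hs
    rw [hφ.subst_closed]
    exact .predAx hΨ h hφ
  | conv _ h₁ h₂ h => exact fun hθ hΨ _ => .conv hΨ (h₁.subst hD hθ) (h₂.subst hD hθ) (h.subst _)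
  | @subst _ _ _ t u φ hφ _ _ ih₁ ih₂ =>
    intro Δ θ Ψ' hθ hΨ hs
    have := HOL.subst (hφ.subst hD (hθ.up hD _)) (by simpa using ih₁ hθ hΨ hs) (ih₂ hθ hΨ hs)
    simpa using this
  | impI _ hψ _ ih =>
    exact fun hθ hΨ hs => .impI hΨ (hψ.subst hD hθ)
      (ih hθ (hΨ.insert (hψ.subst hD hθ)) (hins _ hs))
  | impE _ _ ih₁ ih₂ => exact fun hθ hΨ hs => .impE (ih₁ hθ hΨ hs) (ih₂ hθ hΨ hs)
  | allI _ _ ih => exact fun hθ hΨ hs => .allI hΨ (ih (hθ.up hD _) (hwf1 _ hΨ) (hwk hs))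
  | allE _ ht ih =>
    intro Δ θ Ψ' hθ hΨ hs
    simpa using (ih hθ hΨ hs).allE (ht.subst hD hθ)
  | exI hφ ht _ ih =>
    intro Δ θ Ψ' hθ hΨ hs
    exact .exI (hφ.subst hD (hθ.up hD _)) (ht.subst hD hθ) (by simpa using ih hθ hΨ hs)
  | exE hχ h₁ _ ih₁ ih₂ =>
    intro Δ θ Ψ' hθ hΨ hs
    refine .exE (hχ.subst hD hθ) (ih₁ hθ hΨ hs) ?_
    have := ih₂ (hθ.up hD _) ((hwf1 _ hΨ).insert
      ((Form.Wf.ex_iff.1 (h₁.wf hD).2).subst hD (hθ.up hD _))) (hins _ (hwk hs))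
    simpa using this
  | topI => exact fun _ hΨ _ => .topI hΨ
  | botE _ hφ ih => exact fun hθ hΨ hs => .botE (ih hθ hΨ hs) (hφ.subst hD hθ)
  | andI _ _ ih₁ ih₂ => exact fun hθ hΨ hs => .andI (ih₁ hθ hΨ hs) (ih₂ hθ hΨ hs)
  | andE₁ _ ih => exact fun hθ hΨ hs => .andE₁ (ih hθ hΨ hs)
  | andE₂ _ ih => exact fun hθ hΨ hs => .andE₂ (ih hθ hΨ hs)
  | orI₁ _ hψ ih => exact fun hθ hΨ hs => .orI₁ (ih hθ hΨ hs) (hψ.subst hD hθ)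
  | orI₂ _ hψ ih => exact fun hθ hΨ hs => .orI₂ (ih hθ hΨ hs) (hψ.subst hD hθ)
  | orE h _ _ ih ih₁ ih₂ =>
    intro Δ θ Ψ' hθ hΨ hs
    have hw := Form.Wf.or_iff.1 (h.wf hD).2
    exact .orE (ih hθ hΨ hs) (ih₁ hθ (hΨ.insert (hw.1.subst hD hθ)) (hins _ hs))
      (ih₂ hθ (hΨ.insert (hw.2.subst hD hθ)) (hins _ hs))
  | bool hφ _ _ ih₁ ih₂ =>
    intro Δ θ Ψ' hθ hΨ hs
    exact .bool (hφ.subst hD (hθ.up hD _)) (by simpa using ih₁ hθ hΨ hs)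
      (by simpa using ih₂ hθ hΨ hs)
  | nat _ h ih₁ ih₂ =>
    intro Δ θ Ψ' hθ hΨ hs
    have hφ := (h.wf hD).1 _ (.inl rfl)
    refine .nat (by simpa using ih₁ hθ hΨ hs) ?_
    simpa using ih₂ (hθ.up hD _) ((hwf1 _ hΨ).insert (hφ.subst hD (hθ.up hD _)))
      (hins _ (hwk hs))
  | list hφ _ h ih₁ ih₂ =>
    intro Δ θ Ψ' hθ hΨ hs
    refine .list (hφ.subst hD (hθ.up hD _)) (by simpa using ih₁ hθ hΨ hs) ?_
    have hw := (h.wf hD).1 _ (.inl rfl)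
    -- The list rule adds head and tail at once: pass two binders and merge the two shifts.
    have hs₂ := hwk (hwk hs)
    rw [wkHyps_wkHyps, wkHyps_wkHyps] at hs₂
    have := ih₂ ((hθ.up hD _).up hD _) ((hΨ.wk hD (by simp)).insert
      (hw.subst hD ((hθ.up hD _).up hD _))) (hins _ hs₂)
    simpa using this
  | strong hI _ h ih =>
    intro Δ θ Ψ' hθ hΨ hs
    refine .strong hI hΨ ?_
    have hw := (h.wf hD).1 _ (.inl rfl)
    have := ih (hθ.up hD _) ((hwf1 _ hΨ).insert
      (hw.subst hD (hθ.up hD _))) (hins _ (hwk hs))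
    simpa using this
  | tt_ne_ff => exact fun hθ hΨ hs => .tt_ne_ff hΨ
  | zero_ne_succ _ ht => exact fun hθ hΨ hs => .zero_ne_succ hΨ (ht.subst hD hθ)
  | nil_ne_cons _ ht => exact fun hθ hΨ hs => .nil_ne_cons hΨ (ht.subst hD hθ)
  | succ_inj _ ih => exact fun hθ hΨ hs => .succ_inj (ih hθ hΨ hs)
  | cons_inj₁ _ ih => exact fun hθ hΨ hs => .cons_inj₁ (ih hθ hΨ hs)
  | cons_inj₂ _ ih => exact fun hθ hΨ hs => .cons_inj₂ (ih hθ hΨ hs)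
  | le_refl _ hI ht => exact fun hθ hΨ hs => .le_refl hΨ hI (ht.subst hD hθ)
  | le_trans _ _ ih₁ ih₂ => exact fun hθ hΨ hs => .le_trans (ih₁ hθ hΨ hs) (ih₂ hθ hΨ hs)
  | lt_of_lt_of_le _ _ ih₁ ih₂ =>
    exact fun hθ hΨ hs => .lt_of_lt_of_le (ih₁ hθ hΨ hs) (ih₂ hθ hΨ hs)
  | lt_of_le_of_lt _ _ ih₁ ih₂ =>
    exact fun hθ hΨ hs => .lt_of_le_of_lt (ih₁ hθ hΨ hs) (ih₂ hθ hΨ hs)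
  | le_of_lt _ ih => exact fun hθ hΨ hs => .le_of_lt (ih hθ hΨ hs)
  | zero_le _ ht => exact fun hθ hΨ hs => .zero_le hΨ (ht.subst hD hθ)
  | not_succ_le_zero _ ih => exact fun hθ hΨ hs => .not_succ_le_zero (ih hθ hΨ hs)
  | succ_le_succ _ ih => exact fun hθ hΨ hs => .succ_le_succ (ih hθ hΨ hs)
  | le_of_succ_le_succ _ ih => exact fun hθ hΨ hs => .le_of_succ_le_succ (ih hθ hΨ hs)
  | succ_le_of_lt _ ih => exact fun hθ hΨ hs => .succ_le_of_lt (ih hθ hΨ hs)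
  | lt_of_succ_le _ ih => exact fun hθ hΨ hs => .lt_of_succ_le (ih hθ hΨ hs)
  | nil_le _ ht => exact fun hθ hΨ hs => .nil_le hΨ (ht.subst hD hθ)
  | not_cons_le_nil _ ih => exact fun hθ hΨ hs => .not_cons_le_nil (ih hθ hΨ hs)
  | cons_le_cons ht hu _ ih =>
    exact fun hθ hΨ hs => .cons_le_cons (ht.subst hD hθ) (hu.subst hD hθ) (ih hθ hΨ hs)
  | le_of_cons_le_cons _ ih => exact fun hθ hΨ hs => .le_of_cons_le_cons (ih hθ hΨ hs)
  | cons_le_of_lt ht _ ih =>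
    exact fun hθ hΨ hs => .cons_le_of_lt (ht.subst hD hθ) (ih hθ hΨ hs)
  | lt_of_cons_le _ ih => exact fun hθ hΨ hs => .lt_of_cons_le (ih hθ hΨ hs)

section

variable {P : Type u} {D : Guard} {S : Sig P} {Γ Δ : Ctx} {Ψ Ψ' : Set (Form P)} {φ ψ χ : Form P}
  {σ τ : Ty} {t u v : Tm} {θ : ℕ → Tm}

/-! Derived rules of higher-order logic. -/

namespace HOL

theorem wfHyps (hD : D.Stable) (h : HOL D S Γ Ψ φ) : WfHyps D S Γ Ψ := (h.wf hD).1

theorem wfForm (hD : D.Stable) (h : HOL D S Γ Ψ φ) : φ.Wf D S Γ := (h.wf hD).2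

theorem mono (hD : D.Stable) (h : HOL D S Γ Ψ φ) (hΨ' : WfHyps D S Γ Ψ') (hs : Ψ ⊆ Ψ') :
    HOL D S Γ Ψ' φ := by
  simpa using h.substitution hD (.var Γ) hΨ' fun ψ hψ => by simpa using hs hψ

theorem weaken (hD : D.Stable) (h : HOL D S Γ Ψ φ) (hψ : ψ.Wf D S Γ) :
    HOL D S Γ (insert ψ Ψ) φ :=
  h.mono hD ((h.wfHyps hD).insert hψ) (Set.subset_insert _ _)

theorem wk (hD : D.Stable) (h : HOL D S Γ Ψ φ) (τ : Ty) :
    HOL D S (τ :: Γ) (wkHyps 1 Ψ) (φ.wk 1) :=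
  h.substitution hD (by simp) ((h.wfHyps hD).wk hD (by simp)) fun _ h => ⟨_, h, rfl⟩

theorem hyp (hΨ : WfHyps D S Γ Ψ) (hφ : φ.Wf D S Γ) : HOL D S Γ (insert φ Ψ) φ :=
  .ax (hΨ.insert hφ) (.inl rfl)

theorem cut (hD : D.Stable) (h : HOL D S Γ Ψ ψ) (h' : HOL D S Γ (insert ψ Ψ) φ) :
    HOL D S Γ Ψ φ :=
  .impE (.impI (h.wfHyps hD) (h.wfForm hD) h') h

/-! Equality. -/

theorem eq_refl (hΨ : WfHyps D S Γ Ψ) (ht : HasType D Γ t τ) : HOL D S Γ Ψ (.eq τ t t) :=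
  .conv hΨ ht ht (.refl t)

theorem of_red (hΨ : WfHyps D S Γ Ψ) (ht : HasType D Γ t τ) (hu : HasType D Γ u τ)
    (h : Red t u) : HOL D S Γ Ψ (.eq τ t u) :=
  .conv hΨ ht hu h.conv

/-- `HOL.subst` expects an assertion over `τ :: Γ`, and `φ.subst (up θ)` is one. Keeping `φ` in its
own context `Δ` lets the other terms be supplied by `θ` instead of being weakened by hand. -/
theorem rewrite (hD : D.Stable) (h : HOL D S Γ Ψ (.eq τ t u)) (hφ : φ.Wf D S (τ :: Δ))
    (hθ : SubstTyped D Γ θ Δ) (ht : HOL D S Γ Ψ (φ.subst (t .: θ))) :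
    HOL D S Γ Ψ (φ.subst (u .: θ)) := by
  have := HOL.subst (φ := φ.subst (up θ)) (hφ.subst hD (hθ.up hD τ)) (by simpa using ht) h
  simpa using this

theorem eq_symm (hD : D.Stable) (h : HOL D S Γ Ψ (.eq τ t u)) : HOL D S Γ Ψ (.eq τ u t) := by
  have ht := (Form.Wf.eq_iff.1 (h.wfForm hD)).1
  -- Leibniz's argument: `x = t`, with `t` stored at index `1`, is true at `x := t` and is
  -- transported to `x := u`.
  simpa using h.rewrite hD (φ := .eq τ (.var 0) (.var 1)) (Δ := [τ]) (θ := t .: Tm.var)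
    (by simp) (by intro i σ hi; cases i <;> simp_all) (eq_refl (h.wfHyps hD) ht)

theorem eq_trans (hD : D.Stable) (h : HOL D S Γ Ψ (.eq τ t u)) (h' : HOL D S Γ Ψ (.eq τ u v)) :
    HOL D S Γ Ψ (.eq τ t v) := by
  have ht := (Form.Wf.eq_iff.1 (h.wfForm hD)).1
  simpa using h'.rewrite hD (φ := .eq τ (.var 1) (.var 0)) (Δ := [τ]) (θ := t .: Tm.var)
    (by simp) (by intro i σ hi; cases i <;> simp_all) h

theorem eq_congr (hD : D.Stable) (h : HOL D S Γ Ψ (.eq τ t u)) (hv : HasType D (τ :: Γ) v σ) :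
    HOL D S Γ Ψ (.eq σ (v.inst t) (v.inst u)) := by
  have ht := (Form.Wf.eq_iff.1 (h.wfForm hD)).1
  have hvt : HasType D Γ (v.inst t) σ := hv.subst hD (by simpa using ht)
  have hw : HasType D (τ :: Γ) ((v.inst t).wk 1) σ := hvt.subst hD (by simp)
  simpa using h.rewrite hD (φ := .eq σ ((v.inst t).wk 1) v) (θ := Tm.var)
    (.eq hw hv) (by simp) (by simpa using eq_refl (h.wfHyps hD) (by simpa using hvt))

theorem rewrite₂ (hD : D.Stable) {τ' : Ty} {t' u' : Tm} (h : HOL D S Γ Ψ (.eq τ t u))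
    (h' : HOL D S Γ Ψ (.eq τ' t' u')) (hφ : φ.Wf D S (τ' :: τ :: Δ)) (hθ : SubstTyped D Γ θ Δ)
    (ht : HOL D S Γ Ψ (φ.subst (t' .: t .: θ))) : HOL D S Γ Ψ (φ.subst (u' .: u .: θ)) := by
  have hu := (Form.Wf.eq_iff.1 (h'.wfForm hD)).2
  have h₁ := Form.Wf.eq_iff.1 (h.wfForm hD)
  have := h'.rewrite hD (θ := t .: θ) hφ (by simp [h₁, hθ]) ht
  -- Index `0` of `φ` already holds `u'`; index `1` is what remains to be rewritten, and it becomes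
  -- the bound variable.
  have := h.rewrite hD (φ := φ.subst (u'.wk 1 .: .var 0 .: θ ⨾ sh 1)) (Δ := Γ) (θ := Tm.var)
    (hφ.subst hD ?_) (by simp) (by simpa using this)
  · simpa using this
  · simp only [SubstTyped.scons_iff]
    exact ⟨hu.subst hD (by simp), .var_zero, hθ.comp hD (by simp)⟩

/-! Case distinctions. -/

theorem bool_cases (hΨ : WfHyps D S Γ Ψ) (ht : HasType D Γ t .bool)
    (h₁ : HOL D S Γ (insert (.eq .bool t .tt) Ψ) χ)
    (h₂ : HOL D S Γ (insert (.eq .bool t .ff) Ψ) χ) : HOL D S Γ Ψ χ := by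
  have h : HOL D S Γ Ψ (.all .bool (.or (.eq .bool (.var 0) .tt) (.eq .bool (.var 0) .ff))) :=
    .bool (by simp [HasType.tt, HasType.ff])
      (.orI₁ (eq_refl hΨ .tt) (by simp [HasType.tt, HasType.ff]))
      (.orI₂ (eq_refl hΨ .ff) (by simp [HasType.tt, HasType.ff]))
  exact .orE (h.allE ht) (by simpa using h₁) (by simpa using h₂)

/-- Induction proves that every number is zero or a successor, the induction hypothesis playing no
role. The disjunction and the existential are then eliminated at `t`. -/
theorem nat_cases (hD : D.Stable) (hΨ : WfHyps D S Γ Ψ) (ht : HasType D Γ t .nat)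
    (hχ : χ.Wf D S Γ) (h₁ : HOL D S Γ (insert (.eq .nat t .zero) Ψ) χ)
    (h₂ : HOL D S (.nat :: Γ) (insert (.eq .nat (t.wk 1) (.succ (.var 0))) (wkHyps 1 Ψ))
      (χ.wk 1)) : HOL D S Γ Ψ χ := by
  have h : HOL D S Γ Ψ (.all .nat (.or (.eq .nat (.var 0) .zero)
      (.ex .nat (.eq .nat (.var 1) (.succ (.var 0)))))) := by
    have hw : Form.Wf D S (.nat :: Γ) (.or (.eq .nat (.var 0) .zero)
        (.ex .nat (.eq .nat (.var 1) (.succ (.var 0))))) := by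
      simp [HasType.zero, HasType.succ_iff]
    refine .nat (.orI₁ (eq_refl hΨ .zero) (by simp [HasType.zero, HasType.succ_iff])) ?_
    have hΨ' := (hΨ.wk hD (k := 1) (Δ := .nat :: Γ) (by simp)).insert hw
    refine .orI₂ (.exI (t := .var 0) ?_ .var_zero ?_) ?_
    · simp [HasType.succ_iff]
    · simpa using eq_refl hΨ' (.succ .var_zero)
    · simp [HasType.zero, HasType.succ_iff]
  have ho := h.allE ht
  have hw₁ := (Form.Wf.or_iff.1 (ho.wfForm hD)).2
  have hΨ₁ := hΨ.insert hw₁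
  refine .orE ho (by simpa using h₁) (.exE hχ (.ax hΨ₁ (.inl rfl)) ?_)
  have hΨ₂ := (hΨ₁.wk hD (k := 1) (Δ := .nat :: Γ) (by simp)).insert (Form.Wf.ex_iff.1 hw₁)
  -- The branch still carries the existential disjunct just eliminated, so the hypotheses of `h₂`
  -- have to be enlarged.
  have := h₂.mono hD hΨ₂ (by
    refine Set.insert_subset (.inl (by simp)) ?_
    rintro _ ⟨ψ, hψ, rfl⟩
    exact .inr ⟨ψ, .inr hψ, rfl⟩)
  simpa using this

theorem list_cases (hD : D.Stable) (hΨ : WfHyps D S Γ Ψ) (ht : HasType D Γ t (.list τ))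
    (hχ : χ.Wf D S Γ) (h₁ : HOL D S Γ (insert (.eq (.list τ) t .nil) Ψ) χ)
    (h₂ : HOL D S (.list τ :: τ :: Γ)
      (insert (.eq (.list τ) (t.wk 2) (.cons (.var 1) (.var 0))) (wkHyps 2 Ψ)) (χ.wk 2)) :
    HOL D S Γ Ψ χ := by
  have hw : Form.Wf D S (.list τ :: Γ) (.or (.eq (.list τ) (.var 0) .nil)
      (.ex τ (.ex (.list τ) (.eq (.list τ) (.var 2) (.cons (.var 1) (.var 0)))))) := by
    simp [HasType.nil, HasType.cons_iff]
  have h : HOL D S Γ Ψ (.all (.list τ) (.or (.eq (.list τ) (.var 0) .nil)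
      (.ex τ (.ex (.list τ) (.eq (.list τ) (.var 2) (.cons (.var 1) (.var 0))))))) := by
    refine .list hw (.orI₁ (eq_refl hΨ .nil) ?_) ?_
    · simp [HasType.nil, HasType.cons_iff]
    have hΨ' : WfHyps D S (.list τ :: τ :: Γ) (wkHyps 2 Ψ) := hΨ.wk hD (by simp)
    refine .orI₂ (.exI (t := .var 1) ?_ (.var rfl) (.exI (t := .var 0) ?_ (.var rfl) ?_)) ?_
    · simp [HasType.cons_iff]
    · simp [HasType.cons_iff]
    · simpa using eq_refl (hΨ'.insert (hw.subst hD (θ := .var 0 .: sh 2) (by simp)))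
        (.cons (.var rfl) (.var rfl))
    · simp [HasType.nil, HasType.cons_iff]
  have ho := h.allE ht
  refine .orE ho (by simpa using h₁) ?_
  have hw₁ := (Form.Wf.or_iff.1 (ho.wfForm hD)).2
  have hw₂ := Form.Wf.ex_iff.1 hw₁
  have hΨ₁ := hΨ.insert hw₁
  have hΨ₂ := (hΨ₁.wk hD (k := 1) (Δ := τ :: Γ) (by simp)).insert hw₂
  refine .exE hχ (.ax hΨ₁ (.inl rfl)) 
    (.exE (hχ.subst hD (θ := sh 1) (Δ := τ :: Γ) (by simp)) (.ax hΨ₂ (.inl rfl)) ?_)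
  have hw₃ := Form.Wf.ex_iff.1 hw₂
  have hΨ₃ := (hΨ₂.wk hD (k := 1) (Δ := .list τ :: τ :: Γ) (by simp)).insert hw₃
  have := h₂.mono hD hΨ₃ (by
    refine Set.insert_subset (.inl (by simp)) ?_
    rintro _ ⟨ψ, hψ, rfl⟩
    exact .inr ⟨ψ.wk 1, .inr ⟨ψ, .inr hψ, rfl⟩, by simp⟩)
  simpa using this

end HOL

end

section

variable {P : Type u} {D : Guard} {S : Sig P} {Γ Δ : Ctx} {Ψ Ψ' : Set (Form P)}
  {φ ψ χ φ' : Form P} {σ τ I : Ty} {t u v : Tm} {θ : ℕ → Tm}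

namespace HOL

/-! Elimination of the case constructs. -/

/-- Here `v` is a case construct with a hole for its scrutinee and `u` a constructor. The construct
at `t` need not reduce; congruence replaces `t` by `u`, and then it reduces to the branch `r`. -/
theorem eq_of_red_congr (hD : D.Stable) (h : HOL D S Γ Ψ (.eq τ t u))
    (hv : HasType D (τ :: Γ) v σ) {r : Tm} (hr : HasType D Γ r σ) (hred : Red (v.inst u) r) :
    HOL D S Γ Ψ (.eq σ r (v.inst t)) := by
  have hu := (Form.Wf.eq_iff.1 (h.wfForm hD)).2
  exact ((h.eq_congr hD hv).eq_trans hD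
    (of_red (h.wfHyps hD) (hv.subst hD (by simpa using hu)) hr hred)).eq_symm hD

theorem rewrite_inst (hD : D.Stable) (h : HOL D S Γ Ψ (.eq τ t u)) (hφ : φ.Wf D S (τ :: Γ))
    (ht : HOL D S Γ Ψ (φ.inst t)) : HOL D S Γ Ψ (φ.inst u) :=
  h.rewrite hD hφ (.var Γ) ht

theorem casebool_elim (hD : D.Stable) (hΨ : WfHyps D S Γ Ψ) (hφ : φ.Wf D S (σ :: Γ))
    (ht : HasType D Γ t .bool) (hu : HasType D Γ u σ) (hv : HasType D Γ v σ)
    (h₁ : HOL D S Γ (insert (.eq .bool t .tt) Ψ) (φ.inst u))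
    (h₂ : HOL D S Γ (insert (.eq .bool t .ff) Ψ) (φ.inst v)) :
    HOL D S Γ Ψ (φ.inst (.casebool t u v)) := by
  have hw : HasType D (.bool :: Γ) (.casebool (.var 0) (u.wk 1) (v.wk 1)) σ :=
    .casebool .var_zero (hu.subst hD (by simp)) (hv.subst hD (by simp))
  refine bool_cases hΨ ht (rewrite_inst hD (t := u) ?_ hφ h₁) (rewrite_inst hD (t := v) ?_ hφ h₂)
  · simpa using eq_of_red_congr hD (hyp hΨ (.eq ht .tt)) hw hu
      (by simpa using Red.casebool_tt u v)
  · simpa using eq_of_red_congr hD (hyp hΨ (.eq ht .ff)) hw hv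
      (by simpa using Red.casebool_ff u v)

/-- In the successor branch `nat_cases` supplies a fresh predecessor. Instantiating `h₂` there gives
the assertion for `v` applied to it, and that application equals the case construct. -/
theorem casenat_elim (hD : D.Stable) (hφ : φ.Wf D S (σ :: Γ))
    (ht : HasType D Γ t .nat) (hu : HasType D Γ u σ) (hv : HasType D Γ v (.arrow .nat σ))
    (h₁ : HOL D S Γ (insert (.eq .nat t .zero) Ψ) (φ.inst u))
    (h₂ : HOL D S Γ Ψ (.all .nat (.imp (.eq .nat (t.wk 1) (.succ (.var 0)))
      (φ.subst (.app (v.wk 1) (.var 0) .: sh 1))))) :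
    HOL D S Γ Ψ (φ.inst (.casenat t u v)) := by
  have hΨ := h₂.wfHyps hD
  have hw : HasType D Γ (.casenat t u v) σ := .casenat ht hu hv
  have hw' : ∀ {Δ : Ctx} {k : ℕ}, SubstTyped D Δ (sh k) Γ → HasType D (.nat :: Δ)
      (.casenat (.var 0) (u.wk (k + 1)) (v.wk (k + 1))) σ :=
    fun h => .casenat .var_zero (hu.subst hD (by simpa using h)) (hv.subst hD (by simpa using h))
  refine nat_cases hD hΨ ht (hφ.subst hD (by simpa using hw))
    (rewrite_inst hD (t := u) ?_ hφ h₁) ?_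
  · simpa using eq_of_red_congr hD (hyp hΨ (.eq ht .zero)) (hw' (k := 0) (.var Γ)) hu
      (by simpa using Red.casenat_zero u v)
  · have he := hyp (hΨ.wk hD (k := 1) (Δ := .nat :: Γ) (by simp))
      (φ := .eq .nat (t.wk 1) (.succ (.var 0)))
      (.eq (ht.subst hD (by simp)) (.succ .var_zero))
    have h₃ := ((h₂.wk hD .nat).weaken hD (he.wfForm hD)).allE (.var_zero)
    simp at h₃
    have h₄ := h₃.impE (by simpa using he)
    have h₅ := eq_of_red_congr hD he (hw' (k := 1) (by simp))
      (r := .app (v.wk 1) (.var 0)) (.app (hv.subst hD (by simp)) .var_zero)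
      (by simpa using Red.casenat_succ (.var 0) (u.wk 1) (v.wk 1))
    simpa using h₅.rewrite hD (θ := sh 1) hφ (by simp) h₄

theorem caselist_elim (hD : D.Stable) (hφ : φ.Wf D S (σ :: Γ))
    (ht : HasType D Γ t (.list τ)) (hu : HasType D Γ u σ)
    (hv : HasType D Γ v (.arrow τ (.arrow (.list τ) σ)))
    (h₁ : HOL D S Γ (insert (.eq (.list τ) t .nil) Ψ) (φ.inst u))
    (h₂ : HOL D S Γ Ψ (.all τ (.all (.list τ)
      (.imp (.eq (.list τ) (t.wk 2) (.cons (.var 1) (.var 0)))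
      (φ.subst (.app (.app (v.wk 2) (.var 1)) (.var 0) .: sh 2)))))) :
    HOL D S Γ Ψ (φ.inst (.caselist t u v)) := by
  have hΨ := h₂.wfHyps hD
  have hw : HasType D Γ (.caselist t u v) σ := .caselist ht hu hv
  have hw' : ∀ {Δ : Ctx} {k : ℕ}, SubstTyped D Δ (sh k) Γ → HasType D (.list τ :: Δ)
      (.caselist (.var 0) (u.wk (k + 1)) (v.wk (k + 1))) σ :=
    fun h => .caselist .var_zero (hu.subst hD (by simpa using h)) (hv.subst hD (by simpa using h))
  refine list_cases hD hΨ ht (hφ.subst hD (by simpa using hw))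
    (rewrite_inst hD (t := u) ?_ hφ h₁) ?_
  · simpa using eq_of_red_congr hD (hyp hΨ (.eq ht .nil)) (hw' (k := 0) (.var Γ)) hu
      (by simpa using Red.caselist_nil u v)
  · have he := hyp (hΨ.wk hD (k := 2) (Δ := .list τ :: τ :: Γ) (by simp))
      (φ := .eq (.list τ) (t.wk 2) (.cons (.var 1) (.var 0)))
      (.eq (ht.subst hD (by simp)) (.cons (.var rfl) .var_zero))
    have h₃ := (h₂.wk hD τ).wk hD (.list τ)
    rw [wkHyps_wkHyps] at h₃
    have h₃ := ((h₃.weaken hD (he.wfForm hD)).allE (t := .var 1) (.var rfl)).allE .var_zero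
    simp at h₃
    have h₄ := h₃.impE (by simpa using he)
    have h₅ := eq_of_red_congr hD he (hw' (k := 2) (by simp))
      (r := .app (.app (v.wk 2) (.var 1)) (.var 0))
      (.app (.app (hv.subst hD (by simp)) (.var rfl)) .var_zero)
      (by simpa using Red.caselist_cons (.var 1) (.var 0) (u.wk 2) (v.wk 2))
    simpa using h₅.rewrite hD (θ := sh 2) hφ (by simp) h₄

/-! Recursive definitions. -/

/-- For an argument headed by a constructor this is a μ-step. In general the equation is proved for
all elements of `I` by induction, where both cases have such an argument, and then instantiated at
`t`. The induction hypothesis is not needed. -/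
theorem letrec_unfold (hD : D.Stable) (hΨ : WfHyps D S Γ Ψ) {e : Tm}
    (he : HasType D Γ (.letrec e) (.arrow I σ)) (ht : HasType D Γ t I) :
    HOL D S Γ Ψ (.eq σ (e.subst (.letrec e .: t .: Tm.var)) (.app (.letrec e) t)) := by
  obtain ⟨hI, he'⟩ : I.IsInd ∧ HasType D (.arrow I σ :: I :: Γ) e σ := by
    cases he; constructor <;> assumption
  -- `k` counts the variables added by the induction rule: none for `zero` and `nil`, one for
  -- `succ`, two for `cons`.
  have key : ∀ {Δ : Ctx} {Ψ : Set (Form P)} {k : ℕ} {c : Tm}, WfHyps D S Δ Ψ →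
      SubstTyped D Δ (sh k) Γ → HasType D Δ c I → c.IsConstr →
      HOL D S Δ Ψ (.eq σ (e.subst ((Tm.letrec e).wk k .: c .: sh k))
        (.app ((Tm.letrec e).wk k) c)) := by
    intro Δ Ψ k c hΨ hk hc hc'
    refine (of_red hΨ (.app (he.subst hD hk) hc) (he'.subst hD ?_) ?_).eq_symm hD
    · simpa [hk, hc] using he.subst hD hk
    · simpa using Red.mu (e.subst (up (up (sh k)))) c hc'
  have hw : HasType D (I :: Γ) (e.subst ((Tm.letrec e).wk 1 .: .var 0 .: sh 1)) σ := by
    refine he'.subst hD ?_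
    simpa using he.subst hD (θ := sh 1) (Δ := I :: Γ) (by simp)
  have hw' : HasType D (I :: Γ) (.app ((Tm.letrec e).wk 1) (.var 0)) σ :=
    .app (he.subst hD (by simp)) .var_zero
  have hall : HOL D S Γ Ψ (.all I (.eq σ (e.subst ((Tm.letrec e).wk 1 .: .var 0 .: sh 1))
      (.app ((Tm.letrec e).wk 1) (.var 0)))) := by
    cases hI with
    | nat =>
      refine .nat ?_ ?_
      · simpa using key hΨ (k := 0) (.var Γ) .zero .zero
      · have hΨ' := (hΨ.wk hD (k := 1) (Δ := .nat :: Γ) (by simp)).insert (.eq hw hw')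
        simpa using key hΨ' (k := 1) (by simp) (.succ .var_zero) (.succ _)
    | list τ =>
      refine .list (.eq hw hw') ?_ ?_
      · simpa using key hΨ (k := 0) (.var Γ) .nil .nil
      · have hΨ' := (hΨ.wk hD (k := 2) (Δ := .list τ :: τ :: Γ) (by simp)).insert
          ((Form.Wf.eq (P := P) (S := S) hw hw').subst hD (θ := .var 0 .: sh 2) (by simp))
        simpa using key hΨ' (k := 2) (by simp) (.cons (.var rfl) .var_zero) (.cons _ _)
  simpa using hall.allE ht

/-- Induction for a recursive definition `letrec f x = e`; index `0` of `φ'` is `x`, and indices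
`0`, `1` of `φ` are the result and `x`. -/
theorem letrec_elim (hD : D.Stable) (hΨ : WfHyps D S Γ Ψ) {e : Tm}
    (he : HasType D Γ (.letrec e) (.arrow I σ)) (hφ' : φ'.Wf D S (I :: Γ))
    (hφ : φ.Wf D S (σ :: I :: Γ))
    (h : HOL D S (.arrow I σ :: I :: Γ)
        (insert
          (.all I (.imp (.lt I (.var 0) (.var 2))
            (.imp (φ'.subst (.var 0 .: sh 3))
              (φ.subst (.app (.var 1) (.var 0) .: .var 0 .: sh 3)))))
          (insert (φ'.subst (sh 1)) (wkHyps 2 Ψ)))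
        (φ.subst (e .: .var 1 .: sh 2))) :
    HOL D S Γ Ψ (.all I (.imp φ' (φ.subst (.app ((Tm.letrec e).wk 1) (.var 0) .: Tm.var)))) := by
  have hI : I.IsInd := by cases he; assumption
  have he₁ : ∀ {Δ : Ctx} {k : ℕ}, SubstTyped D Δ (sh k) Γ →
      HasType D Δ ((Tm.letrec e).wk k) (.arrow I σ) := fun h => he.subst hD h
  have hG : Form.Wf D S (I :: Γ)
      (.imp φ' (φ.subst (.app ((Tm.letrec e).wk 1) (.var 0) .: Tm.var))) := by
    refine .imp hφ' (hφ.subst hD ?_)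
    simpa only [SubstTyped.scons_iff, SubstTyped.var_self, and_true] using
      HasType.app (he₁ (by simp)) .var_zero
  refine .strong hI hΨ ?_
  have hA : Form.Wf D S (I :: Γ) (.all I (.imp (.lt I (.var 0) (.var 1)) ((Form.imp φ' (φ.subst
      (.app ((Tm.letrec e).wk 1) (.var 0) .: Tm.var))).subst (.var 0 .: sh 2)))) :=
    .all (.imp (.lt hI (.var rfl) (.var rfl)) (hG.subst hD (by simp)))
  have hΨ₁ := (hΨ.wk hD (k := 1) (Δ := I :: Γ) (by simp)).insert hA
  refine .impI hΨ₁ hφ' ?_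
  have hΨ₂ := hΨ₁.insert hφ'
  have hu := letrec_unfold hD hΨ₂ (he₁ (k := 1) (by simp)) .var_zero
  refine hu.rewrite hD hφ (.var _) ?_
  -- Substituting the definition itself for `f` turns the assumption about recursive calls into the
  -- strong induction hypothesis.
  have := h.substitution hD (θ := (Tm.letrec e).wk 1 .: .var 0 .: sh 1)
    (by simpa using he₁ (Δ := I :: Γ) (k := 1) (by simp)) hΨ₂ (by
      rintro _ (rfl | rfl | ⟨ψ, hψ, rfl⟩)
      · exact .inr (.inl (by simp))
      · exact .inl (by simp)
      · exact .inr (.inr ⟨ψ, hψ, by simp⟩))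
  simpa using this

/-- Induction on pairs, ordered by the sizes of both components; indices `0`, `1` of `φ` are the
second and the first component. -/
theorem pair_induction (hD : D.Stable) (hΨ : WfHyps D S Γ Ψ) {I₁ I₂ : Ty} (hI₁ : I₁.IsInd)
    (hI₂ : I₂.IsInd) (hφ : φ.Wf D S (I₂ :: I₁ :: Γ))
    (h : HOL D S (I₂ :: I₁ :: Γ)
      (insert (.all I₁ (.all I₂ (.imp (pairLt I₁ I₂ (.var 1) (.var 0) (.var 3) (.var 2))
        (φ.subst (.var 0 .: .var 1 .: sh 4))))) (wkHyps 2 Ψ)) φ) :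
    HOL D S Γ Ψ (.all I₁ (.all I₂ φ)) := by
  -- `Q(x₁, x₂)` says that `φ` holds at all pairs with components of size at most `|x₁|`, `|x₂|`.
  -- The nested strong inductions need this strengthening: when only the second component decreases,
  -- the first satisfies just `|m₁| ≤ |x₁|`, and for lists equal size does not mean equality.
  set Q : Form P := .all I₁ (.all I₂ (.imp (.le I₁ (.var 1) (.var 3))
    (.imp (.le I₂ (.var 0) (.var 2))
    (φ.subst (.var 0 .: .var 1 .: sh 4))))) with hQ
  have hQw : Q.Wf D S (I₂ :: I₁ :: Γ) := by
    simpa [hQ, hI₁, hI₂] using hφ.subst hD (by simp)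
  have hmain : HOL D S Γ Ψ (.all I₁ (.all I₂ Q)) := by
    set A : Form P := .all I₁ (.imp (.lt I₁ (.var 0) (.var 1))
      ((Form.all I₂ Q).subst (.var 0 .: sh 2))) with hA
    have hAw : A.Wf D S (I₁ :: Γ) :=
      .all (.imp (.lt hI₁ (.var rfl) (.var rfl)) ((Form.Wf.all hQw).subst hD (by simp)))
    have hΨ₁ := (hΨ.wk hD (k := 1) (Δ := I₁ :: Γ) (by simp)).insert hAw
    refine .strong hI₁ hΨ (.strong hI₂ hΨ₁ ?_)
    set B : Form P := .all I₂ (.imp (.lt I₂ (.var 0) (.var 1)) (Q.subst (.var 0 .: sh 2))) with hB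
    have hBw : B.Wf D S (I₂ :: I₁ :: Γ) :=
      .all (.imp (.lt hI₂ (.var rfl) (.var rfl)) (hQw.subst hD (by simp)))
    have hΨ₂ := (hΨ₁.wk hD (k := 1) (Δ := I₂ :: I₁ :: Γ) (by simp)).insert hBw
    have hΨ₄ := (hΨ₂.wk hD (k := 1) (Δ := I₁ :: I₂ :: I₁ :: Γ) (by simp)).wk hD (k := 1)
      (Δ := I₂ :: I₁ :: I₂ :: I₁ :: Γ) (by simp)
    have hw₁ : Form.Wf D S (I₂ :: I₁ :: I₂ :: I₁ :: Γ) (.le I₁ (.var 1) (.var 3)) := by simp [hI₁]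
    have hw₂ : Form.Wf D S (I₂ :: I₁ :: I₂ :: I₁ :: Γ) (.le I₂ (.var 0) (.var 2)) := by simp [hI₂]
    refine .allI hΨ₂ (.allI (hΨ₂.wk hD (by simp)) (.impI hΨ₄ hw₁ (.impI (hΨ₄.insert hw₁) hw₂ ?_)))
    have hΨ₅ := (hΨ₄.insert hw₁).insert hw₂
    have a₁ : HOL D S (I₂ :: I₁ :: I₂ :: I₁ :: Γ) _ (.le I₁ (.var 1) (.var 3)) :=
      .ax hΨ₅ (.inr (.inl rfl))
    have a₂ : HOL D S (I₂ :: I₁ :: I₂ :: I₁ :: Γ) _ (.le I₂ (.var 0) (.var 2)) :=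
      .ax hΨ₅ (.inl rfl)
    have aA := HOL.ax hΨ₅ (.inr (.inr ⟨_, ⟨_, .inr ⟨A, .inl rfl, rfl⟩, rfl⟩, rfl⟩))
    have aB := HOL.ax hΨ₅ (.inr (.inr ⟨_, ⟨B, .inl rfl, rfl⟩, rfl⟩))
    set Ψ₅ := insert (.le I₂ (.var 0) (.var 2)) (insert (.le I₁ (.var 1) (.var 3))
      (wkHyps 1 (wkHyps 1 (insert B (wkHyps 1 (insert A (wkHyps 1 Ψ))))))) with hΨ₅'
    -- Let `(y₁, y₂)` be the pair bounded by `(x₁, x₂)`. The hypothesis of `h` at `(y₁, y₂)`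
    -- concerns pairs `(m₁, m₂)` below it, and is reduced to `A` or `B` according to the component
    -- that decreases.
    have hIH : HOL D S (I₂ :: I₁ :: I₂ :: I₁ :: Γ) Ψ₅
        (.all I₁ (.all I₂ (.imp (pairLt I₁ I₂ (.var 1) (.var 0) (.var 3) (.var 2))
          (φ.subst (.var 0 .: .var 1 .: sh 6))))) := by
      have hΨ₇ := (hΨ₅.wk hD (k := 1) (Δ := I₁ :: I₂ :: I₁ :: I₂ :: I₁ :: Γ) (by simp)).wk hD
        (k := 1) (Δ := I₂ :: I₁ :: I₂ :: I₁ :: I₂ :: I₁ :: Γ) (by simp)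
      have hw : (pairLt I₁ I₂ (.var 1) (.var 0) (.var 3) (.var 2)).Wf D S
        (I₂ :: I₁ :: I₂ :: I₁ :: I₂ :: I₁ :: Γ) := by simp [pairLt, hI₁, hI₂]
      refine .allI hΨ₅ (.allI (hΨ₅.wk hD (by simp)) (.impI hΨ₇ hw ?_))
      have a₁ := ((a₁.wk hD I₁).wk hD I₂).weaken hD hw
      have a₂ := ((a₂.wk hD I₁).wk hD I₂).weaken hD hw
      have aA := ((aA.wk hD I₁).wk hD I₂).weaken hD hw
      have aB := ((aB.wk hD I₁).wk hD I₂).weaken hD hw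
      have hp := hyp hΨ₇ hw
      have b₁ := hp.andE₁.andE₁
      have b₂ := hp.andE₁.andE₂
      have hw' := Form.Wf.or_iff.1 (hp.andE₂.wfForm hD)
      refine .orE hp.andE₂ ?_ ?_
      -- From `|m₁| < |y₁| ≤ |x₁|`, the outer hypothesis `A` gives `Q(m₁, m₂)`, which is used at
      -- `(m₁, m₂)` itself.
      · have c := hyp (hΨ₇.insert hw) hw'.1
        have d := (aA.weaken hD hw'.1).allE (t := .var 1) (.var rfl)
        simp [hQ] at d
        have d := d.impE (by simpa using c.lt_of_lt_of_le (by simpa using a₁.weaken hD hw'.1))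
        have d := d.allE (t := .var 0) (.var rfl)
        simp at d
        have d := d.allE (t := .var 1) (.var rfl)
        simp at d
        have d := d.allE (t := .var 0) (.var rfl)
        simp at d
        exact (d.impE (.le_refl (d.wfHyps hD) hI₁ (.var rfl))).impE
          (.le_refl (d.wfHyps hD) hI₂ (.var rfl))
      -- From `|m₂| < |y₂| ≤ |x₂|`, the inner hypothesis `B` gives `Q(x₁, m₂)`, which is used at
      -- `(m₁, m₂)` since `|m₁| ≤ |y₁| ≤ |x₁|`.
      · have c := hyp (hΨ₇.insert hw) hw'.2
        have d := (aB.weaken hD hw'.2).allE (t := .var 0) (.var rfl)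
        simp [hQ] at d
        have d := d.impE (by simpa using c.lt_of_lt_of_le (by simpa using a₂.weaken hD hw'.2))
        have d := d.allE (t := .var 1) (.var rfl)
        simp at d
        have d := d.allE (t := .var 0) (.var rfl)
        simp at d
        exact (d.impE (.le_trans (b₁.weaken hD hw'.2) (by simpa using a₁.weaken hD hw'.2))).impE
          (.le_refl (d.wfHyps hD) hI₂ (.var rfl))
    refine hIH.cut hD (h.substitution hD (by simp) (hΨ₅.insert (hIH.wfForm hD)) ?_)
    rintro _ (rfl | ⟨ψ, hψ, rfl⟩)
    · exact .inl (by simp [pairLt])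
    · exact .inr (.inr (.inr ⟨_, ⟨_, .inr ⟨_, .inr ⟨ψ, hψ, rfl⟩, rfl⟩, rfl⟩, by simp⟩))
  have hΨ₁ := hΨ.wk hD (k := 1) (Δ := I₁ :: Γ) (by simp)
  have hm := (hmain.wk hD I₁).wk hD I₂
  refine .allI hΨ (.allI hΨ₁ ?_)
  -- `Q(x₁, x₂)` is used at its own bounds.
  have d := hm.allE (t := .var 1) (.var rfl)
  simp [hQ] at d
  have d := d.allE (t := .var 0) (.var rfl)
  simp at d
  have d := d.allE (t := .var 1) (.var rfl)
  simp at d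
  have d := d.allE (t := .var 0) (.var rfl)
  simp at d
  exact (d.impE (.le_refl (d.wfHyps hD) hI₁ (.var rfl))).impE
    (.le_refl (d.wfHyps hD) hI₂ (.var rfl))

/-- Simultaneous induction for two recursive definitions `letrec f₁ x₁ = e₁` and
`letrec f₂ x₂ = e₂`; the indices in `φ'` and `φ` are those of `relArrow`. -/
theorem letrec_elim₂ (hD : D.Stable) (hΨ : WfHyps D S Γ Ψ) {e₁ e₂ : Tm} {I₁ I₂ σ₁ σ₂ : Ty}
    (he₁ : HasType D Γ (.letrec e₁) (.arrow I₁ σ₁)) (he₂ : HasType D Γ (.letrec e₂) (.arrow I₂ σ₂))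
    (hφ' : φ'.Wf D S (I₂ :: I₁ :: Γ)) (hφ : φ.Wf D S (σ₂ :: σ₁ :: I₂ :: I₁ :: Γ))
    (h : HOL D S (.arrow I₂ σ₂ :: .arrow I₁ σ₁ :: I₂ :: I₁ :: Γ)
        (insert
          (.all I₁ (.all I₂ (.imp (pairLt I₁ I₂ (.var 1) (.var 0) (.var 5) (.var 4))
            (.imp (φ'.subst (.var 0 .: .var 1 .: sh 6))
              (φ.subst (.app (.var 2) (.var 0) .: .app (.var 3) (.var 1) .:
                .var 0 .: .var 1 .: sh 6))))))
          (insert (φ'.subst (sh 2)) (wkHyps 4 Ψ)))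
        (φ.subst (e₂.subst (.var 0 .: .var 2 .: sh 4) .: e₁.subst (.var 1 .: .var 3 .: sh 4) .:
          .var 2 .: .var 3 .: sh 4))) :
    HOL D S Γ Ψ (.all I₁ (.all I₂ (.imp φ' (φ.subst (.app ((Tm.letrec e₂).wk 2) (.var 0) .:
      .app ((Tm.letrec e₁).wk 2) (.var 1) .: Tm.var))))) := by
  have hI₁ : I₁.IsInd := by cases he₁; assumption
  have hI₂ : I₂.IsInd := by cases he₂; assumption
  have hf₁ : HasType D (I₂ :: I₁ :: Γ) ((Tm.letrec e₁).wk 2) (.arrow I₁ σ₁) :=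
    he₁.subst hD (by simp)
  have hf₂ : HasType D (I₂ :: I₁ :: Γ) ((Tm.letrec e₂).wk 2) (.arrow I₂ σ₂) :=
    he₂.subst hD (by simp)
  have hG : Form.Wf D S (I₂ :: I₁ :: Γ) (.imp φ' (φ.subst (.app ((Tm.letrec e₂).wk 2) (.var 0) .:
      .app ((Tm.letrec e₁).wk 2) (.var 1) .: Tm.var))) := by
    refine .imp hφ' (hφ.subst hD ?_)
    simp only [SubstTyped.scons_iff, SubstTyped.var_self, and_true]
    exact ⟨.app hf₂ (.var rfl), .app hf₁ (.var rfl)⟩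
  refine pair_induction hD hΨ hI₁ hI₂ hG ?_
  have hA : Form.Wf D S (I₂ :: I₁ :: Γ)
      (.all I₁ (.all I₂ (.imp (pairLt I₁ I₂ (.var 1) (.var 0) (.var 3) (.var 2))
        ((Form.imp φ' (φ.subst (.app ((Tm.letrec e₂).wk 2) (.var 0) .:
          .app ((Tm.letrec e₁).wk 2) (.var 1) .: Tm.var))).subst (.var 0 .: .var 1 .: sh 4))))) :=
    .all (.all (.imp (by simp [pairLt, hI₁, hI₂]) (hG.subst hD (by simp))))
  have hΨ₁ := (hΨ.wk hD (k := 2) (Δ := I₂ :: I₁ :: Γ) (by simp)).insert hA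
  refine .impI hΨ₁ hφ' ?_
  have hΨ₂ := hΨ₁.insert hφ'
  -- Both applications are traded for their unfolded bodies; what is left is `h` with the
  -- definitions substituted for `f₁` and `f₂`.
  refine rewrite₂ hD (letrec_unfold hD hΨ₂ hf₁ (.var rfl)) (letrec_unfold hD hΨ₂ hf₂ (.var rfl))
    hφ (.var _) ?_
  have := h.substitution hD
    (θ := (Tm.letrec e₂).wk 2 .: (Tm.letrec e₁).wk 2 .: .var 0 .: .var 1 .: sh 2)
    (by simp only [SubstTyped.scons_iff]; exact ⟨hf₂, hf₁, by simp⟩) hΨ₂ (by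
      rintro _ (rfl | rfl | ⟨ψ, hψ, rfl⟩)
      · exact .inr (.inl (by simp [pairLt]))
      · exact .inl (by simp)
      · exact .inr (.inr ⟨ψ, hψ, by simp⟩))
  simpa using this

end HOL

end

section

variable {P : Type u} {D : Guard} {S : Sig P} {Γ Δ : Ctx} {Ψ Ψ' : Set (Form P)}
  {φ ψ χ φ' : Form P} {σ τ I : Ty} {t u v : Tm} {θ : ℕ → Tm}

/-! Unary higher-order logic is equivalent to higher-order logic. -/

theorem UHOL.wf (h : UHOL D S Γ Ψ t τ φ) : WfU D S Γ Ψ t τ φ := by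
  cases h <;> assumption

/-- Soundness of UHOL. -/
theorem UHOL.hol (hD : D.Stable) (h : UHOL D S Γ Ψ t τ φ) : HOL D S Γ Ψ (φ.inst t) := by
  induction h with
  | var _ h | tt _ h | ff _ h | zero _ h | nil _ h => exact h
  | @abs Γ Ψ t τ σ φ' φ hw h ih =>
    obtain ⟨ht, hΨ, -⟩ := hw
    obtain ⟨ht', hΨ', hφ⟩ := h.wf
    have hφ' := hΨ' _ (.inl rfl)
    have he : HOL D S (τ :: Γ) (insert φ' (wkHyps 1 Ψ))
        (.eq σ t (.app ((Tm.lam τ t).wk 1) (.var 0))) :=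
      (HOL.of_red hΨ' (.app (ht.subst hD (by simp)) .var_zero) ht'
        (by simpa using Red.beta τ (t.subst (up (sh 1))) (.var 0))).eq_symm hD
    have := HOL.allI hΨ (.impI (hΨ.wk hD (by simp)) hφ' (he.rewrite_inst hD hφ ih))
    simpa [unArrow] using this
  | app _ _ hu ih₁ ih₂ =>
    have := ih₁.allE hu.wf.1
    simp at this
    simpa using this.impE ih₂
  | succ _ ht h ih =>
    have := h.allE ht.wf.1
    simp at this
    simpa using this.impE ih
  | cons _ hh ht h ih₁ ih₂ | pair _ hh ht h ih₁ ih₂ =>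
    have := h.allE hh.wf.1
    simp at this
    have := this.allE ht.wf.1
    simp at this
    simpa using (this.impE ih₁).impE ih₂
  | fst _ _ ih | snd _ _ ih => simpa using ih
  | sub _ _ h ih => exact h.impE ih
  | boolcase hw hb hu hv ih₁ ih₂ =>
    exact .casebool_elim hD hw.2.1 hw.2.2 hb hu.wf.1 hv.wf.1 ih₁ ih₂
  | natcase hw hn hu hv ih₁ ih₂ =>
    exact .casenat_elim hD hw.2.2 hn hu.wf.1 hv.wf.1 ih₁ (by simpa using ih₂)
  | listcase hw hl hu hv ih₁ ih₂ =>
    exact .caselist_elim hD hw.2.2 hl hu.wf.1 hv.wf.1 ih₁ (by simpa using ih₂)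
  | @letrec Γ Ψ e I σ φ' φ hw hI hg h ih =>
    obtain ⟨he, hΨ, -⟩ := hw
    obtain ⟨-, hΨ', hφ⟩ := h.wf
    have he₁ : ∀ {Δ : Ctx} {k : ℕ}, SubstTyped D Δ (sh k) Γ →
        HasType D Δ ((Tm.letrec e).wk k) (.arrow I σ) := fun h => he.subst hD h
    -- The premise shows `φ'` well formed only in the context containing `f`; substituting the
    -- definition for `f` removes that variable.
    have hφ₁ : φ'.Wf D S (I :: Γ) := by
      simpa using (hΨ' _ (.inr (.inl rfl))).subst hD
        (θ := (Tm.letrec e).wk 1 .: .var 0 .: sh 1) (Δ := I :: Γ)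
        (by simp only [SubstTyped.scons_iff]; exact ⟨he₁ (by simp), by simp⟩)
    have hφ₂ : φ.Wf D S (σ :: I :: Γ) := by
      simpa using hφ.subst hD (θ := .var 0 .: (Tm.letrec e).wk 2 .: .var 1 .: sh 2)
        (Δ := σ :: I :: Γ)
        (by simp only [SubstTyped.scons_iff]; exact ⟨.var_zero, he₁ (by simp), by simp⟩)
    simpa [unArrow] using HOL.letrec_elim hD hΨ he hφ₁ hφ₂ (by simpa using ih)

theorem HOL.imp_top (hΨ : WfHyps D S Γ Ψ) (hφ : φ.Wf D S Γ) : HOL D S Γ Ψ (.imp φ .top) :=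
  .impI hΨ hφ (.topI (hΨ.insert hφ))

/-- Subsumption compares assertions after `t` has been put for `r`, so once `t` has some derivation,
its assertion can be exchanged for anything HOL proves of `t`. -/
theorem UHOL.of_uhol (hD : D.Stable) (hφ : φ.Wf D S (τ :: Γ)) (h : UHOL D S Γ Ψ t τ φ')
    (h' : HOL D S Γ Ψ (φ.inst t)) : UHOL D S Γ Ψ t τ φ :=
  .sub ⟨h.wf.1, h.wf.2.1, hφ⟩ h
    (.impI h.wf.2.1 ((h.hol hD).wfForm hD) (h'.weaken hD ((h.hol hD).wfForm hD)))

/-- Every term former has a UHOL rule, used with `⊤` for its assertions. `of_uhol` bridges the gaps: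
premises for functions and case branches must have an arrow-like shape, and the conclusions for
`lam` and `letrec` have one. `Ψ` is general because premises add hypotheses. -/
theorem UHOL.top (hD : D.Stable) (ht : HasType D Γ t τ) :
    ∀ {Ψ : Set (Form P)}, WfHyps D S Γ Ψ → UHOL D S Γ Ψ t τ .top := by
  have hw₁ : ∀ {Γ : Ctx} {Ψ : Set (Form P)} (τ : Ty), WfHyps D S Γ Ψ →
      WfHyps D S (τ :: Γ) (wkHyps 1 Ψ) := fun τ h => h.wk hD (by simp)
  have h₁ : ∀ {Γ : Ctx} {Ψ : Set (Form P)} {τ : Ty} {φ : Form P}, WfHyps D S Γ Ψ →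
      φ.Wf D S (τ :: Γ) → HOL D S Γ Ψ (.all τ (.imp φ .top)) :=
    fun hΨ hφ => .allI hΨ (.imp_top (hw₁ _ hΨ) hφ)
  have h₂ : ∀ {Γ : Ctx} {Ψ : Set (Form P)} {σ τ : Ty} {φ : Form P}, WfHyps D S Γ Ψ →
      φ.Wf D S (τ :: σ :: Γ) → HOL D S Γ Ψ (.all σ (.all τ (.imp φ .top))) :=
    fun hΨ hφ => .allI hΨ (h₁ (hw₁ _ hΨ) hφ)
  have h₃ : ∀ {Γ : Ctx} {Ψ : Set (Form P)} {σ τ : Ty}, WfHyps D S Γ Ψ →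
      HOL D S Γ Ψ (.all σ (.all τ (.imp .top (.imp .top .top)))) :=
    fun hΨ => .allI hΨ (.allI (hw₁ _ hΨ) (.impI (hw₁ _ (hw₁ _ hΨ)) .top
      (.imp_top ((hw₁ _ (hw₁ _ hΨ)).insert .top) .top)))
  induction ht with
  | var h => exact fun hΨ => .var ⟨.var h, hΨ, .top⟩ (.topI hΨ)
  | pair ht hu ih₁ ih₂ =>
    exact fun hΨ => .pair ⟨.pair ht hu, hΨ, .top⟩ (ih₁ hΨ) (ih₂ hΨ) (h₃ hΨ)
  | cons ht hu ih₁ ih₂ =>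
    exact fun hΨ => .cons ⟨.cons ht hu, hΨ, .top⟩ (ih₁ hΨ) (ih₂ hΨ) (h₃ hΨ)
  | fst ht ih => exact fun hΨ => .fst ⟨.fst ht, hΨ, .top⟩ (ih hΨ)
  | snd ht ih => exact fun hΨ => .snd ⟨.snd ht, hΨ, .top⟩ (ih hΨ)
  | app ht hu ih₁ ih₂ =>
    exact fun hΨ => .app (φ := .top) (φ' := .top) ⟨.app ht hu, hΨ, .top⟩
      (.of_uhol hD (.all (.imp .top .top)) (ih₁ hΨ) (h₁ hΨ .top)) (ih₂ hΨ)
  | lam ht ih =>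
    exact fun hΨ => .of_uhol hD .top (.abs (φ := .top) (φ' := .top)
      ⟨.lam ht, hΨ, .all (.imp .top .top)⟩ (ih ((hw₁ _ hΨ).insert .top))) (.topI hΨ)
  | tt => exact fun hΨ => .tt ⟨.tt, hΨ, .top⟩ (.topI hΨ)
  | ff => exact fun hΨ => .ff ⟨.ff, hΨ, .top⟩ (.topI hΨ)
  | zero => exact fun hΨ => .zero ⟨.zero, hΨ, .top⟩ (.topI hΨ)
  | nil => exact fun hΨ => .nil ⟨.nil, hΨ, .top⟩ (.topI hΨ)
  | succ ht ih => exact fun hΨ => .succ ⟨.succ ht, hΨ, .top⟩ (ih hΨ) (h₁ hΨ .top)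
  | casebool ht hu hv _ ih₁ ih₂ =>
    exact fun hΨ => .boolcase ⟨.casebool ht hu hv, hΨ, .top⟩ ht
      (ih₁ (hΨ.insert (.eq ht .tt))) (ih₂ (hΨ.insert (.eq ht .ff)))
  | casenat ht hu hv _ ih₁ ih₂ =>
    intro Ψ hΨ
    refine .natcase ⟨.casenat ht hu hv, hΨ, .top⟩ ht (ih₁ (hΨ.insert (.eq ht .zero)))
      (.of_uhol hD (.all (.imp (.eq (ht.subst hD (by simp)) (.succ .var_zero)) .top)) (ih₂ hΨ)
        (h₁ hΨ (.eq ?_ (.succ .var_zero))))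
    simpa using ht.subst hD (θ := sh 1) (by simp)
  | caselist ht hu hv _ ih₁ ih₂ =>
    intro Ψ hΨ
    refine .listcase ⟨.caselist ht hu hv, hΨ, .top⟩ ht (ih₁ (hΨ.insert (.eq ht .nil)))
      (.of_uhol hD (.all (.all (.imp (.eq (ht.subst hD (by simp))
        (.cons (.var rfl) .var_zero)) .top))) (ih₂ hΨ)
        (h₂ hΨ (.eq ?_ (.cons (.var rfl) .var_zero))))
    simpa using ht.subst hD (θ := sh 2) (by simp)
  | letrec hI he hg ih =>
    intro Ψ hΨ
    refine .of_uhol hD .top (.letrec (φ := .top) (φ' := .top)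
      ⟨.letrec hI he hg, hΨ, .all (.imp .top .top)⟩ hI hg (ih (((hΨ.wk hD (by simp)).insert
        .top).insert (.all (.imp (.lt hI (.var rfl) (.var rfl)) (.imp .top .top)))))) (.topI hΨ)

/-- Completeness of UHOL. -/
theorem HOL.uhol (hD : D.Stable) (ht : HasType D Γ t τ) (hφ : φ.Wf D S (τ :: Γ))
    (h : HOL D S Γ Ψ (φ.inst t)) : UHOL D S Γ Ψ t τ φ :=
  have hΨ := h.wfHyps hD
  .sub ⟨ht, hΨ, hφ⟩ (.top hD ht hΨ) (.impI hΨ .top (h.weaken hD .top))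

end

section

variable {P : Type u} {D : Guard} {S : Sig P} {Γ Δ : Ctx} {Ψ Ψ' : Set (Form P)}
  {φ ψ χ φ' : Form P} {σ τ σ₁ σ₂ I : Ty} {t u v t₁ t₂ t₃ : Tm} {θ : ℕ → Tm}

/-! Relational higher-order logic is equivalent to higher-order logic. -/

theorem RHOL.wf (h : RHOL D S Γ Ψ t₁ σ₁ t₂ σ₂ φ) : WfR D S Γ Ψ t₁ σ₁ t₂ σ₂ φ := by
  cases h <;> assumption

/-- Completeness of RHOL. -/
theorem HOL.rhol (hD : D.Stable) (h : WfR D S Γ Ψ t₁ σ₁ t₂ σ₂ φ)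
    (h' : HOL D S Γ Ψ (φ.inst2 t₁ t₂)) : RHOL D S Γ Ψ t₁ σ₁ t₂ σ₂ φ := by
  obtain ⟨ht₁, ht₂, hΨ, hφ⟩ := h
  refine .uholL ⟨ht₁, ht₂, hΨ, hφ⟩ (HOL.uhol hD ht₁ (hφ.subst hD ?_) (by simpa using h'))
  simp only [SubstTyped.scons_iff]
  exact ⟨ht₂.subst hD (by simp), .var_zero, by simp⟩

/-! ### Auxiliary facts for the soundness of RHOL. -/

theorem HOL.beta (hD : D.Stable) (hΨ : WfHyps D S Δ Ψ)
    (ht : HasType D Γ (.lam τ t) (.arrow τ σ)) (hθ : SubstTyped D Δ θ Γ) (hu : HasType D Δ u τ) :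
    HOL D S Δ Ψ (.eq σ (t.subst (u .: θ)) (.app ((Tm.lam τ t).subst θ) u)) := by
  have ht' : HasType D (τ :: Γ) t σ := by cases ht; assumption
  exact (HOL.of_red hΨ (.app (ht.subst hD hθ) hu) (ht'.subst hD (by simp [hθ, hu]))
    (by simpa using Red.beta τ (t.subst (up θ)) u)).eq_symm hD

/-- Fixing the right term makes a relational assertion a unary one about `r₁`; in this way the left
rules reuse the unary eliminations. -/
theorem Form.Wf.inst_left (hD : D.Stable) (hφ : φ.Wf D S (σ₂ :: σ₁ :: Γ)) (ht : HasType D Γ t σ₂) :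
    (φ.subst (t.wk 1 .: Tm.var)).Wf D S (σ₁ :: Γ) :=
  hφ.subst hD (by
    simp only [SubstTyped.scons_iff, SubstTyped.var_self, and_true]
    exact ht.subst hD (by simp))

theorem Form.Wf.inst_right (hD : D.Stable) (hφ : φ.Wf D S (σ₂ :: σ₁ :: Γ)) (ht : HasType D Γ t σ₁) :
    (φ.subst (.var 0 .: t.wk 1 .: sh 1)).Wf D S (σ₂ :: Γ) :=
  hφ.subst hD (by
    simp only [SubstTyped.scons_iff]
    exact ⟨.var_zero, ht.subst hD (by simp), by simp⟩)

/-! ### Two-sided elimination of the case constructs. -/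

theorem HOL.false_of_tt_ff (hD : D.Stable) (h : HOL D S Γ Ψ (.eq .bool t .tt))
    (h' : HOL D S Γ Ψ (.eq .bool t .ff)) : HOL D S Γ Ψ .bot :=
  .impE (.tt_ne_ff (h.wfHyps hD)) ((h.eq_symm hD).eq_trans hD h')

theorem HOL.false_of_zero_succ (hD : D.Stable) (h : HOL D S Γ Ψ (.eq .nat t .zero))
    (h' : HOL D S Γ Ψ (.eq .nat t (.succ u))) : HOL D S Γ Ψ .bot :=
  .impE (.zero_ne_succ (h.wfHyps hD)
    (HasType.succ_iff.1 (Form.Wf.eq_iff.1 (h'.wfForm hD)).2).2) ((h.eq_symm hD).eq_trans hD h')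

theorem HOL.false_of_nil_cons (hD : D.Stable) (h : HOL D S Γ Ψ (.eq (.list τ) t .nil))
    (h' : HOL D S Γ Ψ (.eq (.list τ) t (.cons u v))) : HOL D S Γ Ψ .bot :=
  .impE (.nil_ne_cons (h.wfHyps hD) (Form.Wf.eq_iff.1 (h'.wfForm hD)).2)
    ((h.eq_symm hD).eq_trans hD h')

theorem Form.Wf.subst_left (hD : D.Stable) (hφ : φ.Wf D S (σ₂ :: σ₁ :: Γ))
    (hθ : SubstTyped D Δ θ Γ) (ht : HasType D Δ t σ₁) :
    (φ.subst (.var 0 .: t.wk 1 .: θ ⨾ sh 1)).Wf D S (σ₂ :: Δ) :=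
  hφ.subst hD (by
    simp only [SubstTyped.scons_iff]
    exact ⟨.var_zero, ht.subst hD (by simp), hθ.comp hD (by simp)⟩)

/-- The left scrutinee is eliminated first, then the right one. The two mixed combinations
contradict `h`; the two others are `h₁` and `h₂`. -/
theorem HOL.casebool_elim₂ (hD : D.Stable) {b₁ u₁ v₁ b₂ u₂ v₂ : Tm}
    (hφ : φ.Wf D S (σ₂ :: σ₁ :: Γ)) (hb₁ : HasType D Γ b₁ .bool) (hb₂ : HasType D Γ b₂ .bool)
    (hu₁ : HasType D Γ u₁ σ₁) (hu₂ : HasType D Γ u₂ σ₂) (hv₁ : HasType D Γ v₁ σ₁)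
    (hv₂ : HasType D Γ v₂ σ₂)
    (h : HOL D S Γ Ψ (.or (.and (.eq .bool b₁ .tt) (.eq .bool b₂ .tt))
      (.and (.eq .bool b₁ .ff) (.eq .bool b₂ .ff))))
    (h₁ : HOL D S Γ (insert (.eq .bool b₂ .tt) (insert (.eq .bool b₁ .tt) Ψ)) (φ.inst2 u₁ u₂))
    (h₂ : HOL D S Γ (insert (.eq .bool b₂ .ff) (insert (.eq .bool b₁ .ff) Ψ)) (φ.inst2 v₁ v₂)) :
    HOL D S Γ Ψ (φ.inst2 (.casebool b₁ u₁ v₁) (.casebool b₂ u₂ v₂)) := by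
  have hΨ := h.wfHyps hD
  have hw := Form.Wf.or_iff.1 (h.wfForm hD)
  have hwt : ∀ {c : Tm}, HasType D Γ c .bool → WfHyps D S Γ (insert (.eq .bool b₁ c) Ψ) :=
    fun hc => hΨ.insert (.eq hb₁ hc)
  have hwt₂ : ∀ {c c' : Tm}, HasType D Γ c .bool → HasType D Γ c' .bool →
      WfHyps D S Γ (insert (.eq .bool b₂ c') (insert (.eq .bool b₁ c) Ψ)) :=
    fun hc hc' => (hwt hc).insert (.eq hb₂ hc')
  simpa using HOL.casebool_elim hD hΨ
    (hφ.inst_left hD (HasType.casebool hb₂ hu₂ hv₂)) hb₁ hu₁ hv₁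
    (by
      simpa using HOL.casebool_elim hD (hwt .tt) (hφ.inst_right hD hu₁) hb₂ hu₂ hv₂
        (by simpa using h₁) (.botE (.orE ((h.weaken hD (.eq hb₁ .tt)).weaken hD (.eq hb₂ .ff))
          (.false_of_tt_ff hD (HOL.hyp (hwt₂ .tt .ff) hw.1).andE₂
            (.ax ((hwt₂ .tt .ff).insert hw.1) (.inr (.inl rfl))))
          (.false_of_tt_ff hD (.ax ((hwt₂ .tt .ff).insert hw.2) (.inr (.inr (.inl rfl))))
            (HOL.hyp (hwt₂ .tt .ff) hw.2).andE₁))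
          (by simpa using (hφ.inst_right hD hu₁).subst hD (θ := v₂ .: Tm.var) (by simp [hv₂]))))
    (by
      simpa using HOL.casebool_elim hD (hwt .ff) (hφ.inst_right hD hv₁) hb₂ hu₂ hv₂
        (.botE (.orE ((h.weaken hD (.eq hb₁ .ff)).weaken hD (.eq hb₂ .tt))
          (.false_of_tt_ff hD (HOL.hyp (hwt₂ .ff .tt) hw.1).andE₁
            (.ax ((hwt₂ .ff .tt).insert hw.1) (.inr (.inr (.inl rfl)))))
          (.false_of_tt_ff hD (.ax ((hwt₂ .ff .tt).insert hw.2) (.inr (.inl rfl)))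
            (HOL.hyp (hwt₂ .ff .tt) hw.2).andE₂))
          (by simpa using (hφ.inst_right hD hv₁).subst hD (θ := u₂ .: Tm.var) (by simp [hu₂])))
        (by simpa using h₂))

theorem HOL.casenat_elim₂ (hD : D.Stable) {n₁ u₁ v₁ n₂ u₂ v₂ : Tm}
    (hφ : φ.Wf D S (σ₂ :: σ₁ :: Γ)) (hn₁ : HasType D Γ n₁ .nat) (hn₂ : HasType D Γ n₂ .nat)
    (hu₁ : HasType D Γ u₁ σ₁) (hu₂ : HasType D Γ u₂ σ₂) (hv₁ : HasType D Γ v₁ (.arrow .nat σ₁))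
    (hv₂ : HasType D Γ v₂ (.arrow .nat σ₂))
    (h : HOL D S Γ Ψ (.iff (.eq .nat n₁ .zero) (.eq .nat n₂ .zero)))
    (h₁ : HOL D S Γ (insert (.eq .nat n₂ .zero) (insert (.eq .nat n₁ .zero) Ψ)) (φ.inst2 u₁ u₂))
    (h₂ : HOL D S Γ Ψ (.all .nat (.all .nat (.imp (.eq .nat (n₁.wk 2) (.succ (.var 1)))
      (.imp (.eq .nat (n₂.wk 2) (.succ (.var 0)))
        (φ.subst (.app (v₂.wk 2) (.var 0) .: .app (v₁.wk 2) (.var 1) .: sh 2))))))) :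
    HOL D S Γ Ψ (φ.inst2 (.casenat n₁ u₁ v₁) (.casenat n₂ u₂ v₂)) := by
  have hΨ := h.wfHyps hD
  have hz : Form.Wf D S Γ (.eq .nat n₁ .zero) := .eq hn₁ .zero
  have wt : ∀ {t : Tm} {τ : Ty} (k : ℕ) {Δ : Ctx}, HasType D Γ t τ → SubstTyped D Δ (sh k) Γ →
      HasType D Δ (t.wk k) τ := fun _ _ ht hk => ht.subst hD hk
  suffices H : HOL D S Γ Ψ ((φ.subst ((Tm.casenat n₂ u₂ v₂).wk 1 .: Tm.var)).inst
      (.casenat n₁ u₁ v₁)) by simpa using H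
  refine .casenat_elim hD (hφ.inst_left hD (.casenat hn₂ hu₂ hv₂)) hn₁ hu₁ hv₁ ?_ ?_
  · suffices H : HOL D S Γ (insert (.eq .nat n₁ .zero) Ψ)
        ((φ.subst (.var 0 .: u₁.wk 1 .: sh 1)).inst (.casenat n₂ u₂ v₂)) by simpa using H
    have hΨ₁ := hΨ.insert hz
    refine .casenat_elim hD (hφ.inst_right hD hu₁) hn₂ hu₂ hv₂ (by simpa using h₁) ?_
    have hs : Form.Wf D S (.nat :: Γ) (.eq .nat (n₂.wk 1) (.succ (.var 0))) :=
      .eq (wt 1 hn₂ (by simp)) (.succ .var_zero)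
    have hΨ₂ := hΨ₁.wk hD (k := 1) (Δ := .nat :: Γ) (by simp)
    refine .allI hΨ₁ (.impI hΨ₂ hs (.botE ?_ ((hφ.inst_right hD hu₁).subst hD ?_)))
    -- Mixed branch: `n₁ = zero` forces `n₂ = zero`, against `n₂` being a successor.
    · have := (((h.weaken hD hz).andE₁.impE (.hyp hΨ hz)).wk hD .nat).weaken hD hs
      exact .false_of_zero_succ hD this (.hyp hΨ₂ hs)
    · simp only [SubstTyped.scons_iff]
      exact ⟨.app (wt 1 hv₂ (by simp)) .var_zero, by simp⟩
  · have hs : Form.Wf D S (.nat :: Γ) (.eq .nat (n₁.wk 1) (.succ (.var 0))) :=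
      .eq (wt 1 hn₁ (by simp)) (.succ .var_zero)
    have hΨ₁ := hΨ.wk hD (k := 1) (Δ := .nat :: Γ) (by simp)
    have hΨ₂ := hΨ₁.insert hs
    refine .allI hΨ (.impI hΨ₁ hs ?_)
    have hv : HasType D (.nat :: Γ) (.app (v₁.wk 1) (.var 0)) σ₁ :=
      .app (wt 1 hv₁ (by simp)) .var_zero
    have hφ₁ := hφ.subst_left hD (θ := sh 1) (by simp) hv
    suffices H : HOL D S (.nat :: Γ) (insert (.eq .nat (n₁.wk 1) (.succ (.var 0))) (wkHyps 1 Ψ))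
        ((φ.subst (.var 0 .: (Tm.app (v₁.wk 1) (.var 0)).wk 1 .: sh 1 ⨾ sh 1)).inst
          (.casenat (n₂.wk 1) (u₂.wk 1) (v₂.wk 1))) by simpa using H
    refine .casenat_elim hD hφ₁ (wt 1 hn₂ (by simp)) (wt 1 hu₂ (by simp)) (wt 1 hv₂ (by simp)) ?_ ?_
    · have hz' : Form.Wf D S (.nat :: Γ) (.eq .nat (n₂.wk 1) .zero) :=
        .eq (wt 1 hn₂ (by simp)) .zero
      refine .botE (.false_of_zero_succ hD (t := n₁.wk 1) (u := .var 0) ?_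
        (.ax (hΨ₂.insert hz') (.inr (.inl rfl)))) (hφ₁.subst hD ?_)
      -- The other mixed branch, by the converse half of the equivalence.
      · exact (((h.andE₂.wk hD .nat).weaken hD hs).weaken hD hz').impE (.hyp hΨ₂ hz')
      · simp only [SubstTyped.scons_iff]
        exact ⟨wt 1 hu₂ (by simp), by simp⟩
    · have hs' : Form.Wf D S (.nat :: .nat :: Γ) (.eq .nat ((n₂.wk 1).wk 1) (.succ (.var 0))) :=
        .eq (by simpa using wt 2 hn₂ (by simp)) (.succ .var_zero)
      have hΨ₃ := hΨ₂.wk hD (k := 1) (Δ := .nat :: .nat :: Γ) (by simp)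
      refine .allI hΨ₂ (.impI hΨ₃ hs' ?_)
      have d := ((((h₂.wk hD .nat).weaken hD hs).wk hD .nat).weaken hD hs').allE
        (t := .var 1) (.var rfl)
      simp at d
      have d := d.allE (t := .var 0) (.var rfl)
      simp at d
      have e := ((HOL.hyp hΨ₁ hs).wk hD .nat).weaken hD hs'
      have e' := HOL.hyp hΨ₃ hs'
      simp at e e'
      simpa using (d.impE (by simpa using e)).impE (by simpa using e')

theorem HOL.caselist_elim₂ (hD : D.Stable) {l₁ u₁ v₁ l₂ u₂ v₂ : Tm} {τ₁ τ₂ : Ty}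
    (hφ : φ.Wf D S (σ₂ :: σ₁ :: Γ)) (hl₁ : HasType D Γ l₁ (.list τ₁))
    (hl₂ : HasType D Γ l₂ (.list τ₂)) (hu₁ : HasType D Γ u₁ σ₁) (hu₂ : HasType D Γ u₂ σ₂)
    (hv₁ : HasType D Γ v₁ (.arrow τ₁ (.arrow (.list τ₁) σ₁)))
    (hv₂ : HasType D Γ v₂ (.arrow τ₂ (.arrow (.list τ₂) σ₂)))
    (h : HOL D S Γ Ψ (.iff (.eq (.list τ₁) l₁ .nil) (.eq (.list τ₂) l₂ .nil)))
    (h₁ : HOL D S Γ (insert (.eq (.list τ₂) l₂ .nil) (insert (.eq (.list τ₁) l₁ .nil) Ψ))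
      (φ.inst2 u₁ u₂))
    (h₂ : HOL D S Γ Ψ (.all τ₁ (.all τ₂ (.all (.list τ₁) (.all (.list τ₂)
      (.imp (.eq (.list τ₁) (l₁.wk 4) (.cons (.var 3) (.var 1)))
        (.imp (.eq (.list τ₂) (l₂.wk 4) (.cons (.var 2) (.var 0)))
          (φ.subst (.app (.app (v₂.wk 4) (.var 2)) (.var 0) .:
            .app (.app (v₁.wk 4) (.var 3)) (.var 1) .: sh 4))))))))) :
    HOL D S Γ Ψ (φ.inst2 (.caselist l₁ u₁ v₁) (.caselist l₂ u₂ v₂)) := by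
  have hΨ := h.wfHyps hD
  have hz : Form.Wf D S Γ (.eq (.list τ₁) l₁ .nil) := .eq hl₁ .nil
  have wt : ∀ {t : Tm} {τ : Ty} (k : ℕ) {Δ : Ctx}, HasType D Γ t τ → SubstTyped D Δ (sh k) Γ →
      HasType D Δ (t.wk k) τ := fun _ _ ht hk => ht.subst hD hk
  suffices H : HOL D S Γ Ψ ((φ.subst ((Tm.caselist l₂ u₂ v₂).wk 1 .: Tm.var)).inst
      (.caselist l₁ u₁ v₁)) by simpa using H
  refine .caselist_elim hD (hφ.inst_left hD (.caselist hl₂ hu₂ hv₂)) hl₁ hu₁ hv₁ ?_ ?_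
  · suffices H : HOL D S Γ (insert (.eq (.list τ₁) l₁ .nil) Ψ)
        ((φ.subst (.var 0 .: u₁.wk 1 .: sh 1)).inst (.caselist l₂ u₂ v₂)) by simpa using H
    have hΨ₁ := hΨ.insert hz
    refine .caselist_elim hD (hφ.inst_right hD hu₁) hl₂ hu₂ hv₂ (by simpa using h₁) ?_
    have hs : Form.Wf D S (.list τ₂ :: τ₂ :: Γ)
        (.eq (.list τ₂) (l₂.wk 2) (.cons (.var 1) (.var 0))) :=
      .eq (wt 2 hl₂ (by simp)) (.cons (.var rfl) .var_zero)
    have hΨ₂ := hΨ₁.wk hD (k := 1) (Δ := τ₂ :: Γ) (by simp)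
    have hΨ₃ := hΨ₂.wk hD (k := 1) (Δ := .list τ₂ :: τ₂ :: Γ) (by simp)
    refine .allI hΨ₁ (.allI hΨ₂ (.impI hΨ₃ hs (.botE ?_ ((hφ.inst_right hD hu₁).subst hD ?_))))
    · have := ((((h.weaken hD hz).andE₁.impE (.hyp hΨ hz)).wk hD τ₂).wk hD (.list τ₂)).weaken hD hs
      exact .false_of_nil_cons hD (t := l₂.wk 2) (by simpa using this) (.hyp hΨ₃ hs)
    · simp only [SubstTyped.scons_iff]
      exact ⟨.app (.app (wt 2 hv₂ (by simp)) (.var rfl)) .var_zero, by simp⟩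
  · have hs : Form.Wf D S (.list τ₁ :: τ₁ :: Γ)
        (.eq (.list τ₁) (l₁.wk 2) (.cons (.var 1) (.var 0))) :=
      .eq (wt 2 hl₁ (by simp)) (.cons (.var rfl) .var_zero)
    have hΨ₁ := hΨ.wk hD (k := 1) (Δ := τ₁ :: Γ) (by simp)
    have hΨ₂ := hΨ₁.wk hD (k := 1) (Δ := .list τ₁ :: τ₁ :: Γ) (by simp)
    have hΨ₃ := hΨ₂.insert hs
    refine .allI hΨ (.allI hΨ₁ (.impI hΨ₂ hs ?_))
    have hv : HasType D (.list τ₁ :: τ₁ :: Γ) (.app (.app (v₁.wk 2) (.var 1)) (.var 0)) σ₁ :=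
      .app (.app (wt 2 hv₁ (by simp)) (.var rfl)) .var_zero
    have hφ₁ := hφ.subst_left hD (θ := sh 2) (by simp) hv
    suffices H : HOL D S (.list τ₁ :: τ₁ :: Γ)
        (insert (.eq (.list τ₁) (l₁.wk 2) (.cons (.var 1) (.var 0))) (wkHyps 1 (wkHyps 1 Ψ)))
        ((φ.subst (.var 0 .: (Tm.app (.app (v₁.wk 2) (.var 1)) (.var 0)).wk 1 .: sh 2 ⨾ sh 1)).inst
          (.caselist (l₂.wk 2) (u₂.wk 2) (v₂.wk 2))) by simpa using H
    refine .caselist_elim hD hφ₁ (wt 2 hl₂ (by simp)) (wt 2 hu₂ (by simp)) (wt 2 hv₂ (by simp))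
      ?_ ?_
    · have hz' : Form.Wf D S (.list τ₁ :: τ₁ :: Γ) (.eq (.list τ₂) (l₂.wk 2) .nil) :=
        .eq (wt 2 hl₂ (by simp)) .nil
      refine .botE (.false_of_nil_cons hD (τ := τ₁) (t := l₁.wk 2) (u := .var 1) (v := .var 0) ?_
        (.ax (hΨ₃.insert hz') (.inr (.inl rfl)))) (hφ₁.subst hD ?_)
      · have := ((((h.andE₂.wk hD τ₁).wk hD (.list τ₁)).weaken hD hs).weaken hD hz')
        simp at this
        simpa using this.impE (by simpa using HOL.hyp hΨ₃ hz')
      · simp only [SubstTyped.scons_iff]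
        exact ⟨wt 2 hu₂ (by simp), by simp⟩
    · have hs' : Form.Wf D S (.list τ₂ :: τ₂ :: .list τ₁ :: τ₁ :: Γ)
          (.eq (.list τ₂) ((l₂.wk 2).wk 2) (.cons (.var 1) (.var 0))) :=
        .eq (by simpa using wt 4 hl₂ (by simp)) (.cons (.var rfl) .var_zero)
      have hΨ₄ := hΨ₃.wk hD (k := 1) (Δ := τ₂ :: .list τ₁ :: τ₁ :: Γ) (by simp)
      have hΨ₅ := hΨ₄.wk hD (k := 1) (Δ := .list τ₂ :: τ₂ :: .list τ₁ :: τ₁ :: Γ) (by simp)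
      refine .allI hΨ₃ (.allI hΨ₄ (.impI hΨ₅ hs' ?_))
      -- `h₂` quantifies over both heads before both tails, while the context declares left head,
      -- left tail, right head, right tail. Hence the indices `3`, `1`, `2`, `0`.
      have d := ((((((h₂.wk hD τ₁).wk hD (.list τ₁)).weaken hD hs).wk hD τ₂).wk hD
        (.list τ₂)).weaken hD hs').allE (t := .var 3) (.var rfl)
      simp at d
      have d := d.allE (t := .var 1) (.var rfl)
      simp at d
      have d := d.allE (t := .var 2) (.var rfl)
      simp at d
      have d := d.allE (t := .var 0) (.var rfl)
      simp at d
      have e := (((HOL.hyp hΨ₂ hs).wk hD τ₂).wk hD (.list τ₂)).weaken hD hs'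
      have e' := HOL.hyp hΨ₅ hs'
      simp at e e'
      simpa using (d.impE (by simpa using e)).impE (by simpa using e')

/-- Soundness of RHOL. -/
theorem RHOL.hol (hD : D.Stable) (h : RHOL D S Γ Ψ t₁ σ₁ t₂ σ₂ φ) :
    HOL D S Γ Ψ (φ.inst2 t₁ t₂) := by
  induction h with
  | var _ h | tt _ h | ff _ h | zero _ h | nil _ h
  | ttL _ h | ffL _ h | zeroL _ h | nilL _ h | ttR _ h | ffR _ h | zeroR _ h | nilR _ h => exact h
  | varL hw h | varR hw h => simpa using HOL.ax hw.2.2.1 h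
  | @abs Γ Ψ t₁ t₂ τ₁ σ₁ τ₂ σ₂ φ' φ hw h ih =>
    obtain ⟨ht₁, ht₂, hΨ, -⟩ := hw
    obtain ⟨-, -, hΨ', hφ⟩ := h.wf
    -- `relArrow` speaks of the abstractions applied to `x₁`, `x₂`, the premise of their bodies; two
    -- β-equations connect them.
    have he₁ := HOL.beta hD hΨ' ht₁ (u := .var 1) (θ := sh 2) (by simp) (.var rfl)
    have he₂ := HOL.beta hD hΨ' ht₂ (u := .var 0) (θ := sh 2) (by simp) (.var rfl)
    have := HOL.rewrite₂ hD he₁ he₂ hφ (.var _) (by simpa using ih)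
    simpa [relArrow] using HOL.allI hΨ (.allI (hΨ.wk hD (by simp))
      (.impI (by simpa [wkHyps_wkHyps] using hΨ'.of_insert) (hΨ' _ (.inl rfl))
        (by simpa [wkHyps_wkHyps] using this)))
  | app _ _ hu ih₁ ih₂ =>
    have := ih₁.allE hu.wf.1
    simp at this
    have := this.allE hu.wf.2.1
    simp at this
    simpa using this.impE ih₂
  | appL _ _ hu ih | appR _ _ hu ih =>
    have := ih.allE hu.wf.1
    simp at this
    simpa using this.impE (hu.hol hD)
  | succ _ ht h ih | succL _ ht h ih | succR _ ht h ih =>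
    have := h.allE ht.wf.1
    simp at this
    have := this.allE ht.wf.2.1
    simp at this
    simpa using this.impE ih
  | cons _ hh ht h ih₁ ih₂ | pair _ hh ht h ih₁ ih₂ =>
    have := h.allE hh.wf.1
    simp at this
    have := this.allE hh.wf.2.1
    simp at this
    have := this.allE ht.wf.1
    simp at this
    have := this.allE ht.wf.2.1
    simp at this
    exact (this.impE (by simpa using ih₁)).impE (by simpa using ih₂)
  | consL _ hh ht h ih₁ ih₂ | pairL _ hh ht h ih₁ ih₂ =>
    have := h.allE hh.wf.1
    simp at this
    have := this.allE hh.wf.2.1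
    simp at this
    have := this.allE ht.wf.1
    simp at this
    simpa using (this.impE ih₁).impE ih₂
  | consR _ hh ht h ih₁ ih₂ | pairR _ hh ht h ih₁ ih₂ =>
    have := h.allE hh.wf.1
    simp at this
    have := this.allE hh.wf.2.1
    simp at this
    have := this.allE ht.wf.2.1
    simp at this
    simpa using (this.impE ih₁).impE ih₂
  | fst _ _ ih | snd _ _ ih | fstL _ _ ih | sndL _ _ ih | fstR _ _ ih | sndR _ _ ih =>
    simpa using ih
  | boolcase hw hb hu hv ih ih₁ ih₂ =>
    exact .casebool_elim₂ hD hw.2.2.2 hb.wf.1 hb.wf.2.1 hu.wf.1 hu.wf.2.1 hv.wf.1 hv.wf.2.1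
      (by simpa using ih) ih₁ ih₂
  | natcase hw hn hu hv ih ih₁ ih₂ =>
    exact .casenat_elim₂ hD hw.2.2.2 hn.wf.1 hn.wf.2.1 hu.wf.1 hu.wf.2.1 hv.wf.1 hv.wf.2.1
      (by simpa [Form.iff] using ih) ih₁ (by simpa using ih₂)
  | listcase hw hl hu hv ih ih₁ ih₂ =>
    exact .caselist_elim₂ hD hw.2.2.2 hl.wf.1 hl.wf.2.1 hu.wf.1 hu.wf.2.1 hv.wf.1 hv.wf.2.1
      (by simpa [Form.iff] using ih) ih₁ (by simpa using ih₂)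
  | @letrec Γ Ψ e₁ e₂ I₁ σ₁ I₂ σ₂ φ' φ hw hI₁ hI₂ _ _ h ih =>
    obtain ⟨he₁, he₂, hΨ, -⟩ := hw
    obtain ⟨-, -, hΨ', hφ⟩ := h.wf
    have wt : ∀ {t : Tm} {τ : Ty} {k : ℕ} {Δ : Ctx}, HasType D Γ t τ → SubstTyped D Δ (sh k) Γ →
        HasType D Δ (t.wk k) τ := fun ht hk => ht.subst hD hk
    have hφ₁ : φ'.Wf D S (I₂ :: I₁ :: Γ) := by
      simpa using (hΨ' _ (.inr (.inl rfl))).subst hD (Δ := I₂ :: I₁ :: Γ)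
        (θ := (Tm.letrec e₂).wk 2 .: (Tm.letrec e₁).wk 2 .: .var 0 .: .var 1 .: sh 2)
        (by simp only [SubstTyped.scons_iff]; exact ⟨wt he₂ (by simp), wt he₁ (by simp), by simp⟩)
    have hφ₂ : φ.Wf D S (σ₂ :: σ₁ :: I₂ :: I₁ :: Γ) := by
      simpa using hφ.subst hD (Δ := σ₂ :: σ₁ :: I₂ :: I₁ :: Γ)
        (θ := .var 0 .: .var 1 .: (Tm.letrec e₂).wk 4 .: (Tm.letrec e₁).wk 4 .:
          .var 2 .: .var 3 .: sh 4)
        (by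
          simp only [SubstTyped.scons_iff]
          exact ⟨.var rfl, .var rfl, wt he₂ (by simp), wt he₁ (by simp), by simp⟩)
    simpa [relArrow] using HOL.letrec_elim₂ hD hΨ he₁ he₂ hφ₁ hφ₂ (by simpa using ih)
  | sub _ _ h ih => exact h.impE ih
  | andI _ _ _ ih₁ ih₂ => exact ih₁.andI ih₂
  | impI hw h ih => exact .impI hw.2.2.1 (h.wf.2.2.1 _ (.inl rfl)) ih
  | uholL _ h | uholR _ h => simpa using h.hol hD
  | @absL Γ Ψ t₁ t₂ τ₁ σ₁ σ₂ φ' φ hw h ih =>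
    obtain ⟨ht₁, ht₂, hΨ, -⟩ := hw
    obtain ⟨-, ht₂', hΨ', hφ⟩ := h.wf
    have he := HOL.beta hD hΨ' ht₁ (u := .var 0) (θ := sh 1) (by simp) .var_zero
    have := he.rewrite_inst hD (hφ.inst_left hD ht₂') (by simpa using ih)
    simpa [leftArrow] using HOL.allI hΨ (.impI hΨ'.of_insert (hΨ' _ (.inl rfl)) this)
  | @absR Γ Ψ t₁ t₂ σ₁ τ₂ σ₂ φ' φ hw h ih =>
    obtain ⟨ht₁, ht₂, hΨ, -⟩ := hw
    obtain ⟨ht₁', -, hΨ', hφ⟩ := h.wf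
    have he := HOL.beta hD hΨ' ht₂ (u := .var 0) (θ := sh 1) (by simp) .var_zero
    have := he.rewrite_inst hD (hφ.inst_right hD ht₁') (by simpa using ih)
    simpa [rightArrow] using HOL.allI hΨ (.impI hΨ'.of_insert (hΨ' _ (.inl rfl)) this)
  | boolcaseL hw hb hu hv ih₁ ih₂ =>
    simpa using HOL.casebool_elim hD hw.2.2.1 (hw.2.2.2.inst_left hD hw.2.1) hb hu.wf.1 hv.wf.1
      (by simpa using ih₁) (by simpa using ih₂)
  | boolcaseR hw hb hu hv ih₁ ih₂ =>
    simpa using HOL.casebool_elim hD hw.2.2.1 (hw.2.2.2.inst_right hD hw.1) hb hu.wf.2.1 hv.wf.2.1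
      (by simpa using ih₁) (by simpa using ih₂)
  | natcaseL hw hb hu hv ih₁ ih₂ =>
    simpa using HOL.casenat_elim hD (hw.2.2.2.inst_left hD hw.2.1) hb hu.wf.1 hv.wf.1
      (by simpa using ih₁) (by simpa using ih₂)
  | natcaseR hw hb hu hv ih₁ ih₂ =>
    simpa using HOL.casenat_elim hD (hw.2.2.2.inst_right hD hw.1) hb hu.wf.2.1 hv.wf.2.1
      (by simpa using ih₁) (by simpa using ih₂)
  | listcaseL hw hb hu hv ih₁ ih₂ =>
    simpa using HOL.caselist_elim hD (hw.2.2.2.inst_left hD hw.2.1) hb hu.wf.1 hv.wf.1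
      (by simpa using ih₁) (by simpa using ih₂)
  | listcaseR hw hb hu hv ih₁ ih₂ =>
    simpa using HOL.caselist_elim hD (hw.2.2.2.inst_right hD hw.1) hb hu.wf.2.1 hv.wf.2.1
      (by simpa using ih₁) (by simpa using ih₂)
  | @letrecL Γ Ψ e₁ t₂ I₁ σ₁ σ₂ φ' φ hw hI hg h ih =>
    obtain ⟨he, ht, hΨ, -⟩ := hw
    obtain ⟨-, -, hΨ', hφ⟩ := h.wf
    have wt : ∀ {t : Tm} {τ : Ty} {k : ℕ} {Δ : Ctx}, HasType D Γ t τ → SubstTyped D Δ (sh k) Γ →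
        HasType D Δ (t.wk k) τ := fun ht hk => ht.subst hD hk
    have hφ₁ : φ'.Wf D S (I₁ :: Γ) := by
      simpa using (hΨ' _ (.inr (.inl rfl))).subst hD
        (θ := (Tm.letrec e₁).wk 1 .: .var 0 .: sh 1) (Δ := I₁ :: Γ)
        (by simp only [SubstTyped.scons_iff]; exact ⟨wt he (by simp), by simp⟩)
    have hφ₂ : φ.Wf D S (σ₂ :: σ₁ :: I₁ :: Γ) := by
      simpa using hφ.subst hD (Δ := σ₂ :: σ₁ :: I₁ :: Γ)
        (θ := .var 0 .: .var 1 .: (Tm.letrec e₁).wk 3 .: .var 2 .: sh 3)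
        (by
          simp only [SubstTyped.scons_iff]
          exact ⟨.var rfl, .var rfl, wt he (by simp), by simp⟩)
    -- With `r₂` fixed to `t₂`, one-sided recursion becomes unary recursion, so `letrec_elim`
    -- applies.
    have hφ₃ := hφ₂.inst_left hD (wt ht (k := 1) (by simp))
    simpa [leftArrow] using
      HOL.letrec_elim hD hΨ he hφ₁ hφ₃ (by simpa using ih)
  | @letrecR Γ Ψ t₁ e₂ σ₁ I₂ σ₂ φ' φ hw hI hg h ih =>
    obtain ⟨ht, he, hΨ, -⟩ := hw
    obtain ⟨-, -, hΨ', hφ⟩ := h.wf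
    have wt : ∀ {t : Tm} {τ : Ty} {k : ℕ} {Δ : Ctx}, HasType D Γ t τ → SubstTyped D Δ (sh k) Γ →
        HasType D Δ (t.wk k) τ := fun ht hk => ht.subst hD hk
    have hφ₁ : φ'.Wf D S (I₂ :: Γ) := by
      simpa using (hΨ' _ (.inr (.inl rfl))).subst hD
        (θ := (Tm.letrec e₂).wk 1 .: .var 0 .: sh 1) (Δ := I₂ :: Γ)
        (by simp only [SubstTyped.scons_iff]; exact ⟨wt he (by simp), by simp⟩)
    have hφ₂ : φ.Wf D S (σ₂ :: σ₁ :: I₂ :: Γ) := by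
      simpa using hφ.subst hD (Δ := σ₂ :: σ₁ :: I₂ :: Γ)
        (θ := .var 0 .: .var 1 .: (Tm.letrec e₂).wk 3 .: .var 2 .: sh 3)
        (by
          simp only [SubstTyped.scons_iff]
          exact ⟨.var rfl, .var rfl, wt he (by simp), by simp⟩)
    have hφ₃ := hφ₂.inst_right hD (wt ht (k := 1) (by simp))
    simpa [rightArrow] using
      HOL.letrec_elim hD hΨ he hφ₁ hφ₃ (by simpa using ih)

end

end RelLogic

/-! ### The transitivity rule. -/

theorem mainTheorem5 {P : Type*} (D : RelLogic.Guard) (hD : D.Stable) (S : RelLogic.Sig P)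
    (Γ : RelLogic.Ctx) (Ψ : Set (RelLogic.Form P)) (t₁ t₂ t₃ : RelLogic.Tm)
    (σ₁ σ₂ σ₃ : RelLogic.Ty) (φ φ' : RelLogic.Form P)
    (h₁₂ : RelLogic.RHOL D S Γ Ψ t₁ σ₁ t₂ σ₂ φ)
    (h₂₃ : RelLogic.RHOL D S Γ Ψ t₂ σ₂ t₃ σ₃ φ') :
    RelLogic.RHOL D S Γ Ψ t₁ σ₁ t₃ σ₃ (.and (φ.substR₂ t₂) (φ'.substR₁ t₂)) := by
  obtain ⟨ht₁, ht₂, hΨ, hφ⟩ := h₁₂.wf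
  obtain ⟨-, ht₃, -, hφ'⟩ := h₂₃.wf
  have ht : RelLogic.HasType D (σ₃ :: σ₁ :: Γ) (t₂.wk 2) σ₂ := ht₂.subst hD (by simp)
  -- At `t₁`, `t₃` the target assertion is the conjunction of `φ[t₁, t₂]` and `φ'[t₂, t₃]`, both
  -- given by soundness. What remains is that each conjunct is well formed over `r₁ : σ₁`, `r₂ :
  -- σ₃`.
  refine RelLogic.HOL.rhol hD ⟨ht₁, ht₃, hΨ, .and (hφ.subst hD ?_) (hφ'.subst hD ?_)⟩
    (.andI (by simpa [RelLogic.Form.substR₂] using h₁₂.hol hD)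
      (by simpa [RelLogic.Form.substR₁] using h₂₃.hol hD))
  · simp only [RelLogic.SubstTyped.scons_iff]
    exact ⟨ht, .var rfl, by simp⟩
  · simp only [RelLogic.SubstTyped.scons_iff]
    exact ⟨.var rfl, ht, by simp⟩
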